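/- Let $a,b,c>0$. Let $\mathbf S_0$ be the space of real symmetric traceless $3\times 3$ matrices, with the norm $|Q|^2=\sum_{i,j}Q_{ij}^2$, and for $Q\in\mathbf S_0$ let $$f(Q)=k-\frac a2\operatorname{tr}Q^2-\frac b3\operatorname{tr}Q^3+\frac c4\left(\operatorname{tr}Q^2\right)^2,$$ where the constant $k$ is chosen so that $\inf_{\mathbf S_0} f=0$. Put $\mathscr N=f^{-1}(0)$, $s_*=\frac{1}{4c}\left(b+\sqrt{b^2+24ac}\right)$ and $\kappa_*=\frac\pi2 s_*^2>0$. For $Q\in\mathbf S_0$ with eigenvalues $\lambda_1(Q)\ge\lambda_2(Q)\ge\lambda_3(Q)$ let $\phi(Q)=s_*^{-1}(\lambda_1(Q)-\lambda_2(Q))$ and, if $\phi(Q)>0$, let $\varrho(Q)=s_*\left(\mathbf n\otimes\mathbf n-\frac13\mathrm{Id}\right)\in\mathscr N$, where $\mathbf n$ is a unit eigenvector of $Q$ for $\lambda_1(Q)$. Let $B^2_r\subset\mathbb R^2$ be the open disk of radius $r$ centred at $0$, let $A=B^2_1\setminus B^2_{1/2}$, and for $Q\in H^1(B^2_1,\mathbf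 S_0)$ let $$\phi_0(Q,A)=\operatorname*{ess\,inf}_A\phi\circ Q,\qquad E_\varepsilon(Q,B^2_1)=\int_{B^2_1}\left\{\frac12|\nabla Q|^2+\frac1{\varepsilon^2}f(Q)\right\}.$$ There exists a constant $M>0$, depending only on $f$ (that is, on $a,b,c$), with the following property. Let $0<\varepsilon<1$ and let $Q\in H^1(B^2_1,\mathbf S_0)$ be such that $\phi_0(Q,A)>0$ and the homotopy class of $\varrho\circ Q$ restricted to the boundary is non-trivial, in the following sense: for almost every $r\in(1/2,1)$ the restriction of $\varrho\circ Q$ to $\partial B^2_r$ agrees almost everywhere with a continuous loop in $\mathscr N$ which is not homotopic in $\mathscr N$ to a constant. Then $$E_\varepsilon(Q,B^2_1)\ \ge\ \kappa_*\,\phi_0(Q,A)^2\,|\log\varepsilon|-M.$$ -/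

import Mathlib

open MeasureTheory
open scoped ContDiff Matrix

noncomputable section

namespace QTensor

/-- The plane `ℝ²` with its Euclidean norm. -/
abbrev Plane : Type := EuclideanSpace ℝ (Fin 2)

/-- The space `S₀` of `Q`-tensors: real symmetric traceless `3 × 3` matrices. -/
def S0 : Submodule ℝ (Matrix (Fin 3) (Fin 3) ℝ) where
  carrier := {Q | Qᵀ = Q ∧ Q.trace = 0}
  add_mem' := by
    rintro P Q ⟨hP, hP'⟩ ⟨hQ, hQ'⟩
    exact ⟨by rw [Matrix.transpose_add, hP, hQ], by rw [Matrix.trace_add, hP', hQ', add_zero]⟩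
  zero_mem' := ⟨Matrix.transpose_zero, Matrix.trace_zero _ _⟩
  smul_mem' := by
    rintro t Q ⟨hQ, hQ'⟩
    exact ⟨by rw [Matrix.transpose_smul, hQ], by rw [Matrix.trace_smul, hQ', smul_zero]⟩

/-! ### The Landau-de Gennes potential -/

/-- The quartic potential without its additive constant. -/
def bulk (a b c : ℝ) (Q : S0) : ℝ :=
  -(a / 2) * (Q.1 ^ 2).trace - (b / 3) * (Q.1 ^ 3).trace + (c / 4) * ((Q.1 ^ 2).trace) ^ 2

/-- The Landau-de Gennes potential `f`; the additive constant is chosen so that `inf f = 0`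
(for `c > 0` the infimum below is that of a function bounded from below). -/
def potential (a b c : ℝ) (Q : S0) : ℝ :=
  bulk a b c Q - ⨅ P : S0, bulk a b c P

/-- The vacuum manifold `𝒩 = f⁻¹(0)`, with the topology induced by `S₀`. -/
def vacuum (a b c : ℝ) : Set S0 := {Q | potential a b c Q = 0}

/-- The constant `s_*`. -/
def sStar (a b c : ℝ) : ℝ := (b + √(b ^ 2 + 24 * a * c)) / (4 * c)

/-- The constant `κ_* = (π / 2) s_*²`. -/
def kappaStar (a b c : ℝ) : ℝ := Real.pi / 2 * sStar a b c ^ 2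

/-! ### Eigenvalues, the function `φ` and the retraction `ϱ` -/

theorem isHermitian (Q : S0) : Q.1.IsHermitian := by
  have h := Q.2.1
  rwa [Matrix.IsHermitian, Matrix.conjTranspose_eq_transpose_of_trivial]

/-- The largest eigenvalue (`eigenvalues₀` lists the eigenvalues, with multiplicity,
in decreasing order). -/
def eig1 (Q : S0) : ℝ := (isHermitian Q).eigenvalues₀ ⟨0, by simp⟩

/-- The second largest eigenvalue, counted with multiplicity. -/
def eig2 (Q : S0) : ℝ := (isHermitian Q).eigenvalues₀ ⟨1, by simp⟩

/-- `φ(Q) = (λ₁(Q) - λ₂(Q)) / s_*`. -/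
def phi (a b c : ℝ) (Q : S0) : ℝ := (eig1 Q - eig2 Q) / sStar a b c

theorem exists_leadingEigenvector (Q : S0) :
    ∃ n : Fin 3 → ℝ, n ⬝ᵥ n = 1 ∧ Q.1 *ᵥ n = eig1 Q • n := by
  let e := Fintype.equivOfCardEq (Fintype.card_fin (Fintype.card (Fin 3)))
  let j : Fin 3 := e ⟨0, by simp⟩
  refine ⟨⇑((isHermitian Q).eigenvectorBasis j), ?_, ?_⟩
  · have h := (isHermitian Q).eigenvectorBasis.orthonormal.1 j
    have h2 : inner ℝ ((isHermitian Q).eigenvectorBasis j)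
        ((isHermitian Q).eigenvectorBasis j) = 1 := by
      rw [real_inner_self_eq_norm_sq, h, one_pow]
    rw [EuclideanSpace.inner_eq_star_dotProduct] at h2
    simpa using h2
  · have h := (isHermitian Q).mulVec_eigenvectorBasis j
    have hj : (isHermitian Q).eigenvalues j = eig1 Q := by
      simp [Matrix.IsHermitian.eigenvalues, eig1, j, e]
    rw [hj] at h
    exact h

/-- A unit eigenvector for the largest eigenvalue. It is unique up to its sign when
`λ₁(Q) > λ₂(Q)`. -/
def leadingEigenvector (Q : S0) : Fin 3 → ℝ := (exists_leadingEigenvector Q).choose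

/-- The tensor `s (n ⊗ n - Id / 3)` of a unit vector `n`. -/
def uniaxial (s : ℝ) (n : Fin 3 → ℝ) (hn : n ⬝ᵥ n = 1) : S0 :=
  ⟨s • (Matrix.vecMulVec n n - (1 / 3 : ℝ) • (1 : Matrix (Fin 3) (Fin 3) ℝ)), by
    constructor
    · simp [Matrix.transpose_smul, Matrix.transpose_sub, Matrix.transpose_vecMulVec]
    · rw [Matrix.trace_smul, Matrix.trace_sub, Matrix.trace_vecMulVec, hn, Matrix.trace_smul,
        Matrix.trace_one]
      simp⟩

/-- The retraction `ϱ(Q) = s_* (n(Q) ⊗ n(Q) - Id / 3)`. It does not depend on the choice of the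
unit eigenvector `n(Q)` when `λ₁(Q) > λ₂(Q)`, that is when `φ(Q) > 0`; it is only used there. -/
def rho (a b c : ℝ) (Q : S0) : S0 :=
  uniaxial (sStar a b c) (leadingEigenvector Q) (exists_leadingEigenvector Q).choose_spec.1

/-! ### The Sobolev space `H¹` and the energy -/

/-- `g` is the weak `k`-th partial derivative of `u` in the open set `Ω`. -/
def HasWeakPartial (Ω : Set Plane) (k : Fin 2) (u g : Plane → ℝ) : Prop :=
  ∀ ψ : Plane → ℝ, ContDiff ℝ ∞ ψ → HasCompactSupport ψ → tsupport ψ ⊆ Ω →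
    ∫ x in Ω, u x * fderiv ℝ ψ x (EuclideanSpace.single k 1) = -∫ x in Ω, g x * ψ x

/-- `Q ∈ H¹(Ω, S₀)`, with weak partial derivatives `∂ₖ Q = DQ k`: all the entries of `Q` and of
`DQ k` are in `L²(Ω)`. -/
structure IsH1 (Ω : Set Plane) (Q : Plane → S0) (DQ : Fin 2 → Plane → S0) : Prop where
  memLp : ∀ i j, MemLp (fun x => (Q x).1 i j) 2 (volume.restrict Ω)
  memLp_grad : ∀ k i j, MemLp (fun x => (DQ k x).1 i j) 2 (volume.restrict Ω)
  weak : ∀ k i j, HasWeakPartial Ω k (fun x => (Q x).1 i j) (fun x => (DQ k x).1 i j)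

/-- The energy density `|∇Q|² / 2 + f(Q) / ε²`, which is nonnegative. -/
def energyDensity (a b c ε : ℝ) (Q : Plane → S0) (DQ : Fin 2 → Plane → S0) (x : Plane) : ℝ :=
  (1 / 2) * (∑ k, ∑ i, ∑ j, ((DQ k x).1 i j) ^ 2) + (1 / ε ^ 2) * potential a b c (Q x)

/-- The energy `E_ε(Q, U)`, the integral in `[0, ∞]` of the nonnegative energy density. -/
def energy (a b c ε : ℝ) (Q : Plane → S0) (DQ : Fin 2 → Plane → S0) (U : Set Plane) : ENNReal :=
  ∫⁻ x in U, ENNReal.ofReal (energyDensity a b c ε Q DQ x)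

/-! ### The boundary datum -/

/-- The annulus `A = B₁ ∖ B_{1/2}`. -/
def annulus : Set Plane := Metric.ball 0 1 \ Metric.ball 0 (1 / 2)

/-- `φ₀(Q, A)`, the essential infimum of `φ ∘ Q` on `A`. -/
def phi0 (a b c : ℝ) (Q : Plane → S0) (A : Set Plane) : ℝ :=
  essInf (fun x => phi a b c (Q x)) (volume.restrict A)

/-- The point with polar coordinates `(r, θ)`. -/
def polarPoint (r θ : ℝ) : Plane := !₂[r * Real.cos θ, r * Real.sin θ]

/-- The homotopy class of `ϱ ∘ Q` restricted to the boundary of the unit disk is non-trivial: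
for almost every `r ∈ (1/2, 1)`, the restriction of `ϱ ∘ Q` to the circle of radius `r` agrees
almost everywhere with a continuous loop in `𝒩` that is not homotopic, in `𝒩`, to a constant. -/
def NontrivialBoundaryClass (a b c : ℝ) (Q : Plane → S0) : Prop :=
  ∀ᵐ r ∂(volume.restrict (Set.Ioo (1 / 2 : ℝ) 1)),
    ∃ γ : C(Circle, vacuum a b c),
      (∀ᵐ θ : ℝ, (γ (Circle.exp θ) : S0) = rho a b c (Q (polarPoint r θ))) ∧
      ¬ γ.Nullhomotopic

end QTensor

end

/-! The bound is of Jerrard-Sandier type: a director line making a half turn along a circle of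
radius `τ` costs about `κ_*/τ`, and integrating over the radii from `ε` to a fixed size gives `κ_*
|log ε|`.

Topology. A loop in `𝒩` made of uniaxial tensors is a field of lines. If the lines can be oriented
continuously, the loop factors through the unit sphere of `ℝ³` and contracts
(`nullhomotopic_sphere`, `nullhomotopic_of_orientable`). Homotopy classes are therefore replaced by
the predicate `Orientable`, and a line field that is orientable around each hole of a perforated
disk is orientable on the outer circle (`orientable_of_balls`).

Cost of a circle. If both tensors have gap at least `m`, then `2 m² sin²` of the angle between the
leading lines is at most `|P - Q|²` (`separation`), so a half turn has Dirichlet energy at least `κ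
m²/τ` (`kappa_mul_sq_le`). The potential dominates the square of the negative part of `φ - 1`
(`exists_pen_le_potential`), so taking `m < 1` is penalised; balancing the two gives `κ / (τ + K √(ε
τ))` (`circle_energy_ge`). The primitive `logBound` of this bound, with `L = K √ε`, is at least `κ
|log ε|` minus a constant at a fixed radius.

Ball construction. A map of class `C¹` may have vanishing gap at places of small energy, so the
topology is read on averages over squares of half-width `ε`. These have a good gap wherever the
square carries little energy (`gap_squareAverage_ge`), and they agree topologically with the map on
circles of moderate energy (`nonempty_thresholds`). The centres of the remaining squares form the
singular set, covered by balls that are grown and merged (`HasFamily.step`). If the energy were too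
small, all interior balls would end with an orientable boundary and small total radius, and some
circle avoiding them would be orientable (`exists_energy_ge`).

Sobolev maps are reached by mollification; on circles of bounded energy almost everywhere
convergence becomes uniform along subsequences (`exists_energy_ge_of_tendsto`).

The result `κ_* |log ε| - M` does not involve the size of `φ₀`, whose positivity only makes the
lines well defined near the boundary. It implies the claim when `φ₀ ≤ 1`. When `φ₀ > 1` the
potential on the annulus is at least of order `(φ₀² - 1)²/ε²` (`exists_sq_le_potential`), which
absorbs the excess `κ_* (φ₀² - 1) |log ε|` up to a constant (`mul_log_le`). -/

noncomputable section

namespace QTensor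

open MeasureTheory Metric Set Filter Topology
open scoped ContDiff Matrix RealInnerProductSpace

/-! ### Line fields and their orientations -/

section LineField

variable {F : Type*} [NormedAddCommGroup F] [InnerProductSpace ℝ F]

/-- The orthogonal projection onto the line spanned by the unit vector `u`. -/
def lineProj (u : F) : F →L[ℝ] F := (innerSL ℝ u).smulRight u

@[simp] theorem lineProj_apply (u w : F) : lineProj u w = ⟪u, w⟫ • u := by
  simp [lineProj]

theorem lineProj_neg (u : F) : lineProj (-u) = lineProj u := by
  ext w; simp

theorem lineProj_eq_of_eq_or_neg {u v : F} (h : u = v ∨ u = -v) : lineProj u = lineProj v := by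
  rcases h with rfl | rfl
  · rfl
  · exact lineProj_neg v

theorem continuous_lineProj : Continuous (lineProj : F → F →L[ℝ] F) := by
  have h : Continuous fun u : F => (ContinuousLinearMap.smulRightL ℝ F F) (innerSL ℝ u) u :=
    ((ContinuousLinearMap.smulRightL ℝ F F).continuous.comp (innerSL ℝ).continuous).clm_apply
      continuous_id
  exact h

/-- The projection does not see the sign of `u`, so the inner product may be taken nonnegative; then
`‖u - w‖² = 2 (1 - ⟪u, w⟫)` is at most `2 (1 - ⟪u, w⟫²)`. -/
theorem norm_lineProj_sub_le {u w : F} (hu : ‖u‖ = 1) (hw : ‖w‖ = 1) :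
    ‖lineProj u - lineProj w‖ ≤ 2 * √(2 * (1 - ⟪u, w⟫ ^ 2)) := by
  have key : ∀ u w : F, ‖u‖ = 1 → ‖w‖ = 1 → 0 ≤ ⟪u, w⟫ →
      ‖lineProj u - lineProj w‖ ≤ 2 * √(2 * (1 - ⟪u, w⟫ ^ 2)) := by
    intro u w hu hw h0
    have h1 : ⟪u, w⟫ ≤ 1 := by
      have := real_inner_le_norm u w
      rwa [hu, hw, one_mul] at this
    have h2 : ‖u - w‖ ≤ √(2 * (1 - ⟪u, w⟫ ^ 2)) := by
      apply Real.le_sqrt_of_sq_le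
      rw [norm_sub_sq_real, hu, hw]
      nlinarith
    refine ContinuousLinearMap.opNorm_le_bound _ (by positivity) fun x => ?_
    have h3 : (lineProj u - lineProj w) x = ⟪u - w, x⟫ • u + ⟪w, x⟫ • (u - w) := by
      simp only [_root_.sub_apply, lineProj_apply, inner_sub_left, sub_smul, smul_sub]
      abel
    rw [h3]
    calc _ ≤ ‖⟪u - w, x⟫ • u‖ + ‖⟪w, x⟫ • (u - w)‖ := norm_add_le _ _
      _ ≤ ‖u - w‖ * ‖x‖ + ‖x‖ * ‖u - w‖ := by
          rw [norm_smul, norm_smul, hu, mul_one]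
          have a := norm_inner_le_norm (𝕜 := ℝ) (u - w) x
          have b := norm_inner_le_norm (𝕜 := ℝ) w x
          rw [hw, one_mul] at b
          gcongr
      _ = 2 * ‖u - w‖ * ‖x‖ := by ring
      _ ≤ _ := by gcongr
  rcases le_total 0 ⟪u, w⟫ with h | h
  · exact key u w hu hw h
  · have := key (-u) w (by simpa) hw (by simpa using h)
    simpa [lineProj_neg] using this

theorem eq_or_neg_of_normalize {m : F} (hm : ‖m‖ = 1) {a : ℝ} (ha : a ≠ 0) :
    ‖a • m‖⁻¹ • (a • m) = m ∨ ‖a • m‖⁻¹ • (a • m) = -m := by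
  rw [norm_smul, hm, mul_one, smul_smul]
  rcases lt_or_gt_of_ne ha with h | h
  · right
    rw [Real.norm_eq_abs, abs_of_neg h]
    field_simp
    simp
  · left
    rw [Real.norm_eq_abs, abs_of_pos h]
    field_simp
    simp

/-- Covering homotopy for the double cover of lines by unit vectors. By uniform continuity the time
interval splits into `N` steps during which the projections move by less than one; at each step the
oriented lift is projected to the new line and normalised. -/
theorem exists_lift_of_homotopy {Y : Type*} [PseudoMetricSpace Y] {K : Set Y} (hK : IsCompact K)
    (m : Y → ℝ → F) (hm : ∀ y ∈ K, ∀ t ∈ Icc (0 : ℝ) 1, ‖m y t‖ = 1)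
    (hc : ContinuousOn (fun p : Y × ℝ => lineProj (m p.1 p.2)) (K ×ˢ Icc (0 : ℝ) 1))
    (v₀ : Y → F) (hv₀ : ContinuousOn v₀ K) (h₀ : ∀ y ∈ K, v₀ y = m y 0 ∨ v₀ y = -m y 0) :
    ∃ v : Y → F, ContinuousOn v K ∧ ∀ y ∈ K, v y = m y 1 ∨ v y = -m y 1 := by
  have huc := (hK.prod isCompact_Icc).uniformContinuousOn_of_continuous hc
  rw [Metric.uniformContinuousOn_iff] at huc
  obtain ⟨δ, hδ, huc⟩ := huc 1 one_pos
  obtain ⟨N, hN⟩ := exists_nat_gt (1 / δ)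
  have hN0 : (0 : ℝ) < N := lt_trans (by positivity) hN
  have step : ∀ k : ℕ, k ≤ N → ∃ v : Y → F, ContinuousOn v K ∧
      ∀ y ∈ K, v y = m y (k / N) ∨ v y = -m y (k / N) := by
    intro k
    induction k with
    | zero => intro _; exact ⟨v₀, hv₀, by simpa using h₀⟩
    | succ k ih =>
      intro hk
      obtain ⟨v, hv, hvm⟩ := ih (by omega)
      have hk' : (k : ℝ) + 1 ≤ N := by exact_mod_cast hk
      have ht : ((k + 1 : ℕ) : ℝ) / N ∈ Icc (0 : ℝ) 1 :=
        ⟨by positivity, by rw [div_le_one hN0]; push_cast; exact hk'⟩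
      have ht0 : (k : ℝ) / N ∈ Icc (0 : ℝ) 1 :=
        ⟨by positivity, by rw [div_le_one hN0]; linarith⟩
      set t := ((k + 1 : ℕ) : ℝ) / N with htdef
      -- If `v y` were orthogonal to the new line, the difference of the two projections would fix
      -- the unit vector `v y`, so its norm would be at least one.
      have hne : ∀ y ∈ K, ⟪m y t, v y⟫ ≠ 0 := by
        intro y hy h
        have h1 := huc (y, (k : ℝ) / N) ⟨hy, ht0⟩ (y, t) ⟨hy, ht⟩ (by
          rw [Prod.dist_eq, dist_self, max_eq_right dist_nonneg, Real.dist_eq, abs_sub_comm]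
          rw [abs_of_nonneg, htdef]
          · push_cast
            have : ((k : ℝ) + 1) / N - k / N = 1 / N := by ring
            rw [this, div_lt_iff₀ hN0]
            rw [div_lt_iff₀ hδ] at hN
            linarith
          · rw [htdef]; push_cast
            have : ((k : ℝ) + 1) / N - k / N = 1 / N := by ring
            rw [this]; positivity)
        have hvn : ‖v y‖ = 1 := by
          rcases hvm y hy with h | h <;> rw [h] <;> simp [hm y hy _ ht0]
        have h2 : lineProj (m y (k / N)) (v y) = v y := by
          rw [← lineProj_eq_of_eq_or_neg (hvm y hy), lineProj_apply, real_inner_self_eq_norm_sq,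
            hvn]
          simp
        have h3 : (lineProj (m y (k / N)) - lineProj (m y t)) (v y) = v y := by
          rw [_root_.sub_apply, h2, lineProj_apply, h]; simp
        have h4 := (lineProj (m y (k / N)) - lineProj (m y t)).le_opNorm (v y)
        rw [h3, hvn, mul_one, ← dist_eq_norm] at h4
        linarith
      refine ⟨fun y => ‖lineProj (m y t) (v y)‖⁻¹ • lineProj (m y t) (v y), ?_, ?_⟩
      · have hP : ContinuousOn (fun y => lineProj (m y t)) K :=
          hc.comp (f := fun y => (y, t)) (by fun_prop) fun y hy => ⟨hy, ht⟩
        have hPv : ContinuousOn (fun y => lineProj (m y t) (v y)) K := hP.clm_apply hv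
        refine ContinuousOn.smul (ContinuousOn.inv₀ hPv.norm fun y hy => ?_) hPv
        rw [lineProj_apply, norm_smul, hm y hy t ht, mul_one]
        simpa using hne y hy
      · intro y hy
        have := eq_or_neg_of_normalize (hm y hy t ht) (hne y hy)
        simpa only [lineProj_apply] using this
  obtain ⟨v, hv, hvm⟩ := step N le_rfl
  rw [div_self hN0.ne'] at hvm
  exact ⟨v, hv, hvm⟩

/-- The ball contracts to its centre, where a constant vector orients the field; that orientation is
transported along rays. -/
theorem exists_lift_closedBall {E : Type*} [NormedAddCommGroup E] [NormedSpace ℝ E]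
    [ProperSpace E] (x : E) {r : ℝ}
    (m : E → F) (hm : ∀ z ∈ closedBall x r, ‖m z‖ = 1)
    (hc : ContinuousOn (fun z => lineProj (m z)) (closedBall x r)) :
    ∃ v : E → F, ContinuousOn v (closedBall x r) ∧
      ∀ z ∈ closedBall x r, v z = m z ∨ v z = -m z := by
  have hmap : ∀ y ∈ closedBall x r, ∀ t ∈ Icc (0 : ℝ) 1, x + t • (y - x) ∈ closedBall x r := by
    intro y hy t ht
    rw [mem_closedBall, dist_eq_norm] at hy ⊢
    rw [add_sub_cancel_left, norm_smul, Real.norm_eq_abs, abs_of_nonneg ht.1]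
    nlinarith [norm_nonneg (y - x), ht.2]
  obtain ⟨v, hv, h⟩ := exists_lift_of_homotopy (isCompact_closedBall x r)
    (fun y t => m (x + t • (y - x))) (fun y hy t ht => hm _ (hmap y hy t ht))
    (hc.comp (f := fun p : E × ℝ => x + p.2 • (p.1 - x)) (by fun_prop)
      fun p hp => hmap p.1 hp.1 p.2 hp.2)
    (fun _ => m x) continuousOn_const (by simp)
  exact ⟨v, hv, by simpa using h⟩

end LineField

/-! ### Orientability of line fields on circles. -/

section Orientation

variable {F : Type*} [NormedAddCommGroup F] [InnerProductSpace ℝ F]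

/-- The line field spanned by `n` is orientable on the circle with centre `x` and radius `r`. -/
def Orientable (n : ℂ → F) (x : ℂ) (r : ℝ) : Prop :=
  ∃ v : ℂ → F, ContinuousOn v (sphere 0 1) ∧
    ∀ z ∈ sphere (0 : ℂ) 1, v z = n (x + r * z) ∨ v z = -n (x + r * z)

/-- Lines that are nowhere orthogonal carry the same orientations: an orientation of one field,
projected to the other and normalised, orients the other. -/
theorem Orientable.of_inner_ne_zero {n n' : ℂ → F} {x : ℂ} {r : ℝ} (h : Orientable n x r)
    (hn' : ∀ z, ‖n' z‖ = 1)
    (hc : ContinuousOn (fun z : ℂ => lineProj (n' (x + r * z))) (sphere 0 1))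
    (hne : ∀ z ∈ sphere (0 : ℂ) 1, ⟪n' (x + r * z), n (x + r * z)⟫ ≠ 0) : Orientable n' x r := by
  obtain ⟨v, hv, hvn⟩ := h
  have hne' : ∀ z ∈ sphere (0 : ℂ) 1, ⟪n' (x + r * z), v z⟫ ≠ 0 := by
    intro z hz
    rcases hvn z hz with h | h <;> rw [h]
    · exact hne z hz
    · simpa using hne z hz
  refine ⟨fun z => ‖lineProj (n' (x + r * z)) (v z)‖⁻¹ • lineProj (n' (x + r * z)) (v z), ?_, ?_⟩
  · have hPv := hc.clm_apply hv
    refine ContinuousOn.smul (ContinuousOn.inv₀ hPv.norm fun z hz => ?_) hPv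
    rw [lineProj_apply, norm_smul, hn', mul_one]
    simpa using hne' z hz
  · intro z hz
    simpa only [lineProj_apply] using eq_or_neg_of_normalize (hn' _) (hne' z hz)

/-- The orientation is carried inwards along the radial homotopy between the two circles. -/
theorem Orientable.of_annulus {n : ℂ → F} (hn : ∀ z, ‖n z‖ = 1) {x : ℂ} {r s : ℝ}
    (hrs : r ≤ s) (hr : 0 ≤ r)
    (hc : ContinuousOn (fun z => lineProj (n z)) (closedBall x s \ ball x r))
    (h : Orientable n x s) : Orientable n x r := by
  obtain ⟨v, hv, hvn⟩ := h
  have hmap : ∀ z ∈ sphere (0 : ℂ) 1, ∀ t ∈ Icc (0 : ℝ) 1,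
      x + ((s + t * (r - s) : ℝ) : ℂ) * z ∈ closedBall x s \ ball x r := by
    intro z hz t ht
    rw [mem_sphere_zero_iff_norm] at hz
    have h1 : r ≤ s + t * (r - s) := by nlinarith [ht.1, ht.2]
    have h2 : s + t * (r - s) ≤ s := by nlinarith [ht.1, ht.2]
    have h3 : dist (x + ((s + t * (r - s) : ℝ) : ℂ) * z) x = s + t * (r - s) := by
      rw [dist_eq_norm, add_sub_cancel_left, norm_mul, hz, mul_one, Complex.norm_real,
        Real.norm_eq_abs, abs_of_nonneg (hr.trans h1)]
    rw [Set.mem_sdiff, mem_closedBall, mem_ball, h3]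
    exact ⟨h2, not_lt.2 h1⟩
  obtain ⟨w, hw, h⟩ := exists_lift_of_homotopy (isCompact_sphere (0 : ℂ) 1)
    (fun z t => n (x + ((s + t * (r - s) : ℝ) : ℂ) * z)) (fun y hy t ht => hn _)
    (hc.comp (f := fun p : ℂ × ℝ => x + ((s + p.2 * (r - s) : ℝ) : ℂ) * p.1) (by fun_prop)
      fun p hp => hmap p.1 hp.1 p.2 hp.2)
    v hv (by simpa using hvn)
  exact ⟨w, hw, by simpa using h⟩

/-- The cone over a map from the unit circle to the unit sphere is continuous. -/
theorem continuous_cone {v : ℂ → F} (hv : ContinuousOn v (sphere 0 1))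
    (hv1 : ∀ z ∈ sphere (0 : ℂ) 1, ‖v z‖ = 1) :
    Continuous fun w : ℂ => ‖w‖ • v ((‖w‖⁻¹ : ℝ) * w) := by
  have hmem : ∀ w : ℂ, w ≠ 0 → ((‖w‖⁻¹ : ℝ) : ℂ) * w ∈ sphere (0 : ℂ) 1 := by
    intro w hw
    rw [mem_sphere_zero_iff_norm, norm_mul, Complex.norm_real, norm_inv, norm_norm,
      inv_mul_cancel₀ (norm_ne_zero_iff.2 hw)]
  rw [continuous_iff_continuousAt]
  intro w
  by_cases hw : w = 0
  · subst hw
    rw [ContinuousAt, norm_zero, zero_smul]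
    refine squeeze_zero_norm (a := fun w : ℂ => ‖w‖) (fun w => ?_) ?_
    · by_cases hw : w = 0
      · simp [hw]
      · rw [norm_smul, hv1 _ (hmem w hw), norm_norm, mul_one]
    · simpa using (continuous_norm (E := ℂ)).tendsto 0
  · have h1 : ContinuousOn (fun w : ℂ => ((‖w‖⁻¹ : ℝ) : ℂ) * w) {0}ᶜ := by
      refine ContinuousOn.mul (Complex.continuous_ofReal.comp_continuousOn
        (continuous_norm.continuousOn.inv₀ fun z hz => ?_)) continuousOn_id
      simpa using hz
    have h2 : ContinuousOn (fun w : ℂ => ‖w‖ • v ((‖w‖⁻¹ : ℝ) * w)) {0}ᶜ :=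
      continuous_norm.continuousOn.smul (hv.comp h1 fun w hw => hmem w hw)
    exact h2.continuousAt (isOpen_compl_singleton.mem_nhds hw)

/-- An orientation on the boundary of a hole need not extend as a unit vector field of `F`, but it
does once a coordinate is added: the cone over it, lifted to the upper hemisphere of the unit sphere
of `F × ℝ`, fills the hole. The filled line field lives on a whole disk, where every line field is
orientable, and on the outer circle the extra coordinate vanishes. -/
theorem orientable_of_balls {ι : Type*} [Finite ι] {c : ι → ℂ} {ρ : ι → ℝ} (hρ : ∀ i, 0 < ρ i)
    (hdisj : Pairwise fun i j => Disjoint (ball (c i) (ρ i)) (ball (c j) (ρ j)))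
    {n : ℂ → F} (hn : ∀ z, ‖n z‖ = 1) {x : ℂ} {r : ℝ} (hr : 0 < r)
    (hsub : ∀ i, closedBall (c i) (ρ i) ⊆ closedBall x r)
    (hc : ContinuousOn (fun z => lineProj (n z)) (closedBall x r \ ⋃ i, ball (c i) (ρ i)))
    (hor : ∀ i, Orientable n (c i) (ρ i)) : Orientable n x r := by
  classical
  choose v hv hvn using hor
  have hv1 : ∀ i, ∀ z ∈ sphere (0 : ℂ) 1, ‖v i z‖ = 1 := by
    intro i z hz
    rcases hvn i z hz with h | h <;> rw [h] <;> simp [hn]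
  let w : ι → ℂ → ℂ := fun i z => ((ρ i)⁻¹ : ℝ) * (z - c i)
  have hw : ∀ i, Continuous (w i) := fun i => by fun_prop
  have hwn : ∀ i z, ‖w i z‖ = (ρ i)⁻¹ * dist z (c i) := by
    intro i z
    rw [norm_mul, Complex.norm_real, Real.norm_eq_abs, abs_of_pos (inv_pos.2 (hρ i)),
      dist_eq_norm]
  -- The second component is what makes the vector have length one; it vanishes on the boundary of
  -- the ball, so the cone matches `(n, 0)` there up to sign.
  let cone : ι → ℂ → WithLp 2 (F × ℝ) := fun i z =>
    WithLp.toLp 2 (‖w i z‖ • v i ((‖w i z‖⁻¹ : ℝ) * w i z), √(1 - ‖w i z‖ ^ 2))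
  have hcone : ∀ i, Continuous (cone i) := by
    intro i
    have h1 := (continuous_cone (hv i) (hv1 i)).comp (hw i)
    have h2 : Continuous fun z => √(1 - ‖w i z‖ ^ 2) := by fun_prop
    exact (WithLp.prod_continuous_toLp 2 F ℝ).comp (h1.prodMk h2)
  let m : ℂ → WithLp 2 (F × ℝ) := fun z =>
    if h : ∃ i, z ∈ ball (c i) (ρ i) then cone h.choose z else WithLp.toLp 2 (n z, 0)
  have hnorm : ∀ (a : F) (b : ℝ), ‖(WithLp.toLp 2 (a, b) : WithLp 2 (F × ℝ))‖ ^ 2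
      = ‖a‖ ^ 2 + b ^ 2 := by
    intro a b
    rw [WithLp.prod_norm_sq_eq_of_L2]; simp
  have hcone1 : ∀ i, ∀ z ∈ closedBall (c i) (ρ i), ‖cone i z‖ = 1 := by
    intro i z hz
    have h1 : ‖w i z‖ ≤ 1 := by
      rw [hwn, inv_mul_le_iff₀ (hρ i), mul_one]; exact hz
    have h2 : ‖‖w i z‖ • v i ((‖w i z‖⁻¹ : ℝ) * w i z)‖ = ‖w i z‖ := by
      by_cases h0 : w i z = 0
      · simp [h0]
      · rw [norm_smul, hv1, norm_norm, mul_one]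
        rw [mem_sphere_zero_iff_norm, norm_mul, Complex.norm_real, norm_inv, norm_norm,
          inv_mul_cancel₀ (norm_ne_zero_iff.2 h0)]
    have h3 : ‖cone i z‖ ^ 2 = 1 := by
      rw [hnorm, h2, Real.sq_sqrt (by nlinarith [norm_nonneg (w i z)])]; ring
    exact (pow_eq_one_iff_of_nonneg (norm_nonneg _) two_ne_zero).1 h3
  have huniq : ∀ i j z, z ∈ ball (c i) (ρ i) → z ∈ ball (c j) (ρ j) → i = j := by
    intro i j z hi hj
    by_contra h
    exact Set.disjoint_left.1 (hdisj h) hi hj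
  have hm_ball : ∀ i, ∀ z ∈ ball (c i) (ρ i), m z = cone i z := by
    intro i z hz
    have h : ∃ i, z ∈ ball (c i) (ρ i) := ⟨i, hz⟩
    simp only [m, dif_pos h]
    rw [huniq _ _ z h.choose_spec hz]
  have hm_out : ∀ z, z ∉ ⋃ i, ball (c i) (ρ i) → m z = WithLp.toLp 2 (n z, 0) := by
    intro z hz
    simp only [mem_iUnion] at hz
    simp only [m, dif_neg hz]
  have hm1 : ∀ z, ‖m z‖ = 1 := by
    intro z
    by_cases h : z ∈ ⋃ i, ball (c i) (ρ i)
    · obtain ⟨i, hi⟩ := mem_iUnion.1 h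
      rw [hm_ball i z hi, hcone1 i z (ball_subset_closedBall hi)]
    · rw [hm_out z h]
      have h3 := hnorm (n z) 0
      rw [hn] at h3
      have h4 : ‖(WithLp.toLp 2 (n z, (0 : ℝ)) : WithLp 2 (F × ℝ))‖ ^ 2 = 1 := by rw [h3]; norm_num
      exact (pow_eq_one_iff_of_nonneg (norm_nonneg _) two_ne_zero).1 h4
  have hsphere : ∀ i, ∀ z ∈ sphere (c i) (ρ i), z ∉ ⋃ i, ball (c i) (ρ i) := by
    intro i z hz h
    obtain ⟨j, hj⟩ := mem_iUnion.1 h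
    have hij : i ≠ j := by
      rintro rfl
      rw [mem_ball] at hj; rw [mem_sphere] at hz; linarith
    have hcl : z ∈ closure (ball (c i) (ρ i)) := by
      rw [closure_ball _ (hρ i).ne']; exact sphere_subset_closedBall hz
    obtain ⟨y, hy1, hy2⟩ := mem_closure_iff.1 hcl _ isOpen_ball hj
    exact Set.disjoint_left.1 (hdisj hij) hy2 hy1
  have hproj_cone : ∀ i, ∀ z ∈ closedBall (c i) (ρ i), lineProj (m z) = lineProj (cone i z) := by
    intro i z hz
    rcases (mem_closedBall.1 hz).lt_or_eq with h | h
    · rw [hm_ball i z h]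
    · have hz' : z ∈ sphere (c i) (ρ i) := h
      rw [hm_out z (hsphere i z hz')]
      have hw1 : ‖w i z‖ = 1 := by rw [hwn, h, inv_mul_cancel₀ (hρ i).ne']
      have hz2 : c i + ρ i * w i z = z := by
        have : ((ρ i : ℝ) : ℂ) ≠ 0 := by exact_mod_cast (hρ i).ne'
        simp only [w]
        push_cast
        field_simp
        ring
      have hce : cone i z = WithLp.toLp 2 (v i (w i z), 0) := by
        simp [cone, hw1]
      rw [hce]
      have := hvn i (w i z) (by simpa using hw1)
      rw [hz2] at this
      symm
      apply lineProj_eq_of_eq_or_neg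
      rcases this with h | h
      · left; rw [h]
      · right; rw [h, ← WithLp.toLp_neg]; simp
  have hcont : ContinuousOn (fun z => lineProj (m z)) (closedBall x r) := by
    have h1 : ContinuousOn (fun z => lineProj (m z)) (closedBall x r \ ⋃ i, ball (c i) (ρ i)) := by
      -- Continuity is known only for the projection, not for `n`, so the projection in `F × ℝ` is
      -- written as a composition of fixed linear maps with the one in `F`.
      have e : ∀ a : F, lineProj (WithLp.toLp 2 (a, (0 : ℝ)) : WithLp 2 (F × ℝ)) =
          ((WithLp.prodContinuousLinearEquiv 2 ℝ F ℝ).symm.toContinuousLinearMap ∘L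
            (ContinuousLinearMap.inl ℝ F ℝ)) ∘L lineProj a ∘L
          ((ContinuousLinearMap.fst ℝ F ℝ) ∘L
            (WithLp.prodContinuousLinearEquiv 2 ℝ F ℝ).toContinuousLinearMap) := by
        intro a
        ext y
        simp [WithLp.prod_inner_apply]
      have h2 : ContinuousOn (fun z => lineProj (WithLp.toLp 2 (n z, (0 : ℝ)) : WithLp 2 (F × ℝ)))
          (closedBall x r \ ⋃ i, ball (c i) (ρ i)) := by
        simp only [e]
        exact continuousOn_const.clm_comp (hc.clm_comp continuousOn_const)
      exact h2.congr fun z hz => by rw [hm_out z hz.2]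
    have h2 : ∀ i, ContinuousOn (fun z => lineProj (m z)) (closedBall (c i) (ρ i)) := fun i =>
      (continuous_lineProj.comp (hcone i)).continuousOn.congr (hproj_cone i)
    have h3 : ContinuousOn (fun z => lineProj (m z)) (⋃ i, closedBall (c i) (ρ i)) :=
      (locallyFinite_of_finite _).continuousOn_iUnion (fun i => isClosed_closedBall) h2
    have hcl : IsClosed (closedBall x r \ ⋃ i, ball (c i) (ρ i)) :=
      isClosed_closedBall.sdiff (isOpen_iUnion fun i => isOpen_ball)
    refine (h1.union_of_isClosed h3 hcl (isClosed_iUnion_of_finite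
      fun i => isClosed_closedBall)).mono fun z hz => ?_
    by_cases h : z ∈ ⋃ i, ball (c i) (ρ i)
    · exact Or.inr (iUnion_mono (fun i => ball_subset_closedBall) h)
    · exact Or.inl ⟨hz, h⟩
  obtain ⟨V, hV, hVm⟩ := exists_lift_closedBall x m (fun z _ => hm1 z) hcont
  have hmem : ∀ z ∈ sphere (0 : ℂ) 1, x + r * z ∈ sphere x r := by
    intro z hz
    rw [mem_sphere_zero_iff_norm] at hz
    rw [mem_sphere, dist_eq_norm, add_sub_cancel_left, norm_mul, hz, mul_one, Complex.norm_real,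
      Real.norm_eq_abs, abs_of_pos hr]
  have hout : ∀ z ∈ sphere x r, z ∉ ⋃ i, ball (c i) (ρ i) := by
    intro z hz h
    obtain ⟨i, hi⟩ := mem_iUnion.1 h
    have h1 : ball (c i) (ρ i) ⊆ ball x r := by
      rw [← interior_closedBall x hr.ne']
      exact interior_maximal (ball_subset_closedBall.trans (hsub i)) isOpen_ball
    have := h1 hi
    rw [mem_ball] at this; rw [mem_sphere] at hz; linarith
  refine ⟨fun z => (V (x + r * z)).fst, ?_, fun z hz => ?_⟩
  · have h1 : ContinuousOn (fun z : ℂ => V (x + r * z)) (sphere 0 1) :=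
      hV.comp (by fun_prop) fun z hz => sphere_subset_closedBall (hmem z hz)
    exact (continuous_fst.comp (WithLp.prod_continuous_ofLp 2 F ℝ)).comp_continuousOn h1
  · have h1 := hVm _ (sphere_subset_closedBall (hmem z hz))
    rw [hm_out _ (hout _ (hmem z hz))] at h1
    rcases h1 with h | h
    · left; beta_reduce; rw [h]; rfl
    · right; beta_reduce; rw [h]; simp

end Orientation

/-! ### Loops on spheres of dimension at least two. -/

section Nullhomotopic

variable {F : Type*} [NormedAddCommGroup F] [NormedSpace ℝ F] {X : Type*} [TopologicalSpace X]

/-- The radial projection of a nonvanishing map onto the unit sphere. -/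
def normalizeMap (a : C(X, F)) (ha : ∀ x, a x ≠ 0) : C(X, sphere (0 : F) 1) where
  toFun x := ⟨‖a x‖⁻¹ • a x, by
    rw [mem_sphere_zero_iff_norm, norm_smul, norm_inv, norm_norm,
      inv_mul_cancel₀ (norm_ne_zero_iff.2 (ha x))]⟩
  continuous_toFun := by
    refine Continuous.subtype_mk ?_ _
    exact (a.continuous.norm.inv₀ fun x => norm_ne_zero_iff.2 (ha x)).smul a.continuous

theorem normalizeMap_homotopic (a b : C(X, F)) (ha : ∀ x, a x ≠ 0) (hb : ∀ x, b x ≠ 0)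
    (hab : ∀ x, ∀ t ∈ Icc (0 : ℝ) 1, (1 - t) • a x + t • b x ≠ 0) :
    (normalizeMap a ha).Homotopic (normalizeMap b hb) := by
  refine ⟨⟨normalizeMap (X := unitInterval × X)
    ⟨fun p => (1 - (p.1 : ℝ)) • a p.2 + (p.1 : ℝ) • b p.2, by fun_prop⟩
    fun p => hab p.2 p.1 p.1.2, fun x => ?_, fun x => ?_⟩⟩
  · apply Subtype.ext
    simp [normalizeMap]
  · apply Subtype.ext
    simp [normalizeMap]

/-- The loop is replaced by a nearby `C¹` loop. The plane swept out by its real multiples cannot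
fill a space of dimension above two, and a point `p` that it misses gives a straight homotopy to the
constant `-p` that avoids the origin. -/
theorem nullhomotopic_sphere {F : Type*} [NormedAddCommGroup F] [InnerProductSpace ℝ F]
    [FiniteDimensional ℝ F] (hF : 2 < Module.finrank ℝ F) (w : C(Circle, sphere (0 : F) 1)) :
    w.Nullhomotopic := by
  classical
  let v : ℂ → F := fun z => if h : z ∈ sphere (0 : ℂ) 1 then w ⟨z, by
    rw [← SetLike.mem_coe, Submonoid.coe_unitSphere]; exact h⟩ else 0
  have hvc : ∀ z : Circle, v z = w z := by
    intro z
    have h : (z : ℂ) ∈ sphere (0 : ℂ) 1 := mem_sphere_zero_iff_norm.2 (Circle.norm_coe z)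
    simp only [v, dif_pos h]
    rfl
  have hv : ContinuousOn v (sphere 0 1) := by
    rw [continuousOn_iff_continuous_domRestrict]
    have h : (sphere (0 : ℂ) 1).domRestrict v = fun z : sphere (0 : ℂ) 1 =>
        (w ⟨z.1, by rw [← SetLike.mem_coe, Submonoid.coe_unitSphere]; exact z.2⟩ : F) := by
      funext z
      exact dif_pos z.2
    rw [h]
    exact continuous_subtype_val.comp (w.continuous.comp
      (Continuous.subtype_mk continuous_subtype_val _))
  have hv1 : ∀ z ∈ sphere (0 : ℂ) 1, ‖v z‖ = 1 := by
    intro z hz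
    simp only [v, dif_pos hz]
    exact norm_eq_of_mem_sphere _
  -- The cone is used only as a continuous extension of the loop to `ℂ`, to which smooth
  -- approximation applies.
  obtain ⟨g, hg, hgv, -⟩ := (continuous_cone hv hv1).exists_contDiff_approx 1
    (ε := fun _ => 1 / 2) continuous_const (fun _ => by norm_num)
  have hclose : ∀ z : Circle, ‖g z - w z‖ < 1 / 2 := by
    intro z
    have := hgv z
    rw [dist_eq_norm] at this
    simpa only [Circle.norm_coe, one_smul, inv_one, Complex.ofReal_one, one_mul, hvc] using this
  have hw1 : ∀ z : Circle, ‖(w z : F)‖ = 1 := fun z => norm_eq_of_mem_sphere _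
  obtain ⟨p, hp⟩ : ∃ p : F, p ∉ range fun q : ℝ × ℝ => q.1 • g (Complex.exp (q.2 * Complex.I)) := by
    have hsm : ContDiff ℝ 1 fun q : ℝ × ℝ => q.1 • g (Complex.exp (q.2 * Complex.I)) := by
      refine contDiff_fst.smul (hg.comp ?_)
      exact Complex.contDiff_exp.comp ((Complex.ofRealCLM.contDiff.comp contDiff_snd).mul
        contDiff_const)
    have := hsm.dense_compl_range_of_finrank_lt_finrank (by simpa using hF)
    exact this.nonempty
  have hpg : ∀ (z : Circle) (t : ℝ), t • g z ≠ p := by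
    intro z t h
    apply hp
    refine ⟨(t, Complex.arg z), ?_⟩
    have h1 : Complex.exp (Complex.arg z * Complex.I) = z := by
      rw [← Circle.coe_exp, Circle.exp_arg]
    simp only [h1, h]
  have hp0 : p ≠ 0 := fun h => hpg 1 0 (by simp [h])
  let gm : C(Circle, F) := ⟨fun z => g z, hg.continuous.comp continuous_subtype_val⟩
  let wm : C(Circle, F) := ⟨fun z => w z, by fun_prop⟩
  have hseg : ∀ z, ∀ t ∈ Icc (0 : ℝ) 1, (1 - t) • wm z + t • gm z ≠ 0 := by
    intro z t ht h
    have h1 : (w z : F) = -(t • (g z - w z)) := by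
      have h2 : (1 - t) • (w z : F) + t • g z = 0 := h
      rw [sub_smul, one_smul] at h2
      rw [eq_neg_iff_add_eq_zero, smul_sub]
      refine Eq.trans ?_ h2
      abel
    have h3 := congrArg norm h1
    rw [hw1, norm_neg, norm_smul, Real.norm_eq_abs, abs_of_nonneg ht.1] at h3
    nlinarith [hclose z, ht.2, ht.1, norm_nonneg (g z - w z)]
  have hwm : ∀ z, wm z ≠ 0 := fun z => by simpa using hseg z 0 (by simp)
  have hgm : ∀ z, gm z ≠ 0 := fun z => by simpa using hseg z 1 (by simp)
  have h1 := normalizeMap_homotopic wm gm hwm hgm hseg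
  -- A zero of the segment from `g z` to `-p` at a time `t > 0` would exhibit `p` as a real multiple
  -- of `g z`; at `t = 0` it would be a zero of `g`.
  have h2 := normalizeMap_homotopic gm (.const _ (-p)) hgm (fun _ => by simpa using hp0)
    (by
      intro z t ht h
      rcases ht.1.eq_or_lt with h0 | h0
      · rw [← h0] at h
        exact hgm z (by simpa using h)
      · apply hpg z (t⁻¹ * (1 - t))
        have h3 : (1 - t) • g z + t • (-p) = 0 := h
        rw [smul_neg, ← sub_eq_add_neg, sub_eq_zero] at h3
        rw [mul_smul, h3, smul_smul, inv_mul_cancel₀ h0.ne', one_smul])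
  have h3 : normalizeMap wm hwm = w := by
    ext z
    simp [normalizeMap, wm, hw1]
  rw [h3] at h1
  exact ⟨⟨‖-p‖⁻¹ • -p, by
    rw [mem_sphere_zero_iff_norm, norm_smul, norm_inv, norm_norm,
      inv_mul_cancel₀ (norm_ne_zero_iff.2 (neg_ne_zero.2 hp0))]⟩, h1.trans h2⟩

end Nullhomotopic

/-! ### The length of a half turn. -/

section Length

variable {F : Type*} [NormedAddCommGroup F] [InnerProductSpace ℝ F]

/-- On the interval the field always lifts. The two end values agree up to sign, and if they were
equal the lift would descend to the circle and orient the field. -/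
theorem exists_antiperiodic_lift {n : ℂ → F} (hn : ∀ z, ‖n z‖ = 1) {x : ℂ} {r : ℝ}
    (hc : ContinuousOn (fun z : ℂ => lineProj (n (x + r * z))) (sphere 0 1))
    (h : ¬ Orientable n x r) :
    ∃ v : ℝ → F, ContinuousOn v (Icc 0 (2 * Real.pi)) ∧
      (∀ θ ∈ Icc (0 : ℝ) (2 * Real.pi), v θ = n (circleMap x r θ) ∨ v θ = -n (circleMap x r θ)) ∧
      v (2 * Real.pi) = -v 0 := by
  have hπ := Real.pi_pos
  have hball : closedBall Real.pi Real.pi = Icc 0 (2 * Real.pi) := by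
    rw [Real.closedBall_eq_Icc, sub_self, two_mul]
  have hcm : ∀ θ : ℝ, circleMap x r θ = x + r * circleMap 0 1 θ := fun θ => by simp [circleMap]
  obtain ⟨v, hv, hvn⟩ := exists_lift_closedBall Real.pi (r := Real.pi) (fun θ => n (circleMap x r θ))
    (fun _ _ => hn _) (by
      simp only [hcm]
      exact hc.comp (f := fun θ => circleMap 0 1 θ) (continuous_circleMap 0 1).continuousOn
        fun θ _ => circleMap_mem_sphere _ zero_le_one θ)
  rw [hball] at hv hvn
  refine ⟨v, hv, hvn, ?_⟩
  have h0 := hvn 0 ⟨le_rfl, by positivity⟩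
  have h1 := hvn (2 * Real.pi) ⟨by positivity, le_rfl⟩
  have hper : circleMap x r (2 * Real.pi) = circleMap x r 0 := by simp [circleMap]
  rw [hper] at h1
  by_contra hne
  have heq : v 0 = v (2 * Real.pi) := by
    rcases h0 with h0 | h0 <;> rcases h1 with h1 | h1
    · rw [h0, h1]
    · exact absurd (by rw [h1, h0]) hne
    · exact absurd (by rw [h1, h0, neg_neg]) hne
    · rw [h0, h1]
  have : Fact (0 < 2 * Real.pi) := ⟨by positivity⟩
  let f : AddCircle (2 * Real.pi) → F := AddCircle.liftIco (2 * Real.pi) 0 v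
  have hf : Continuous f := AddCircle.liftIco_continuous (by rwa [zero_add]) (by rwa [zero_add])
  apply h
  classical
  let g : Circle → F := fun z => f (AddCircle.homeomorphCircle'.symm z)
  have hg : Continuous g := hf.comp (Homeomorph.continuous _)
  let W : ℂ → F := fun z => if hz : z ∈ sphere (0 : ℂ) 1 then g ⟨z, by
    rw [← SetLike.mem_coe, Submonoid.coe_unitSphere]; exact hz⟩ else 0
  refine ⟨W, ?_, ?_⟩
  · rw [continuousOn_iff_continuous_domRestrict]
    have hW : (sphere (0 : ℂ) 1).domRestrict W = fun z : sphere (0 : ℂ) 1 =>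
        g ⟨z.1, by rw [← SetLike.mem_coe, Submonoid.coe_unitSphere]; exact z.2⟩ := by
      funext z
      exact dif_pos z.2
    rw [hW]
    exact hg.comp (Continuous.subtype_mk continuous_subtype_val _)
  · intro z hz
    simp only [W, dif_pos hz]
    set z' : Circle := ⟨z, by rw [← SetLike.mem_coe, Submonoid.coe_unitSphere]; exact hz⟩ with hz'
    obtain ⟨θ, hθ, hθz⟩ : ∃ θ ∈ Ico 0 (0 + 2 * Real.pi), Circle.exp θ = z' := by
      refine ⟨toIcoMod (by positivity) 0 (Complex.arg z), toIcoMod_mem_Ico _ _ _, ?_⟩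
      have : Circle.exp (Complex.arg z) = z' := Circle.exp_arg z'
      rw [← this, toIcoMod]
      exact (Circle.periodic_exp.sub_zsmul_eq _)
    have e1 : g z' = v θ := by
      have : AddCircle.homeomorphCircle'.symm z' = (θ : AddCircle (2 * Real.pi)) := by
        rw [Homeomorph.symm_apply_eq, AddCircle.homeomorphCircle'_apply_mk, hθz]
      simp only [g, this, f]
      exact AddCircle.liftIco_coe_apply hθ
    rw [e1]
    have e2 : x + r * z = circleMap x r θ := by
      have : (z' : ℂ) = z := rfl
      rw [← this, ← hθz, Circle.coe_exp, circleMap]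
    rw [e2]
    exact hvn θ ⟨hθ.1, by linarith [hθ.2]⟩

/-- This is `α ≤ tan α`, that is `α cos α ≤ sin α`, with the cosine bounded below by `η`. -/
theorem mul_angle_le_sqrt {u w : F} (hu : ‖u‖ = 1) (hw : ‖w‖ = 1) {η : ℝ}
    (h : η ≤ ⟪u, w⟫) (hη : 0 < η) :
    η * InnerProductGeometry.angle u w ≤ √(1 - ⟪u, w⟫ ^ 2) := by
  set α := InnerProductGeometry.angle u w with hα
  have hcos : Real.cos α = ⟪u, w⟫ := by
    rw [hα, InnerProductGeometry.cos_angle, hu, hw]; simp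
  have h0 : 0 ≤ α := InnerProductGeometry.angle_nonneg _ _
  have hπ : α ≤ Real.pi := InnerProductGeometry.angle_le_pi _ _
  have hlt : α < Real.pi / 2 := by
    by_contra hge
    have := Real.cos_nonpos_of_pi_div_two_le_of_le (not_lt.1 hge) (by linarith)
    linarith
  have hsin : √(1 - ⟪u, w⟫ ^ 2) = Real.sin α := by
    rw [← hcos, Real.sin_eq_sqrt_one_sub_cos_sq h0 hπ]
  rw [hsin]
  have hc : 0 < Real.cos α := by linarith
  have h1 := Real.le_tan h0 hlt
  rw [Real.tan_eq_sin_div_cos, le_div_iff₀ hc] at h1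
  nlinarith

/-- The triangle inequality for angles. The extra term for `N = 0` is needed because the zero vector
makes the angle `π / 2` with itself. -/
theorem angle_le_sum (v : ℕ → F) (N : ℕ) :
    InnerProductGeometry.angle (v 0) (v N) ≤
      (if N = 0 then InnerProductGeometry.angle (v 0) (v 0) else 0) +
      ∑ k ∈ Finset.range N, InnerProductGeometry.angle (v k) (v (k + 1)) := by
  induction N with
  | zero => simp
  | succ N ih =>
    rw [Finset.sum_range_succ]
    have := InnerProductGeometry.angle_le_angle_add_angle (v 0) (v N) (v (N + 1))
    rcases Nat.eq_zero_or_pos N with rfl | hN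
    · simp
    · simp [hN.ne'] at ih ⊢
      linarith

/-- A path on the unit sphere between antipodal points has length at least `π`. The hypothesis
bounds sines of angles only, so the path is cut into pieces on which sine and angle agree up to a
factor `η < 1`, and then `η` tends to one. -/
theorem mul_pi_le_integral {v : ℝ → F} {a b : ℝ} (hab : a < b) (hv : ContinuousOn v (Icc a b))
    (hv1 : ∀ θ ∈ Icc a b, ‖v θ‖ = 1) (hanti : v b = -v a) {w : ℝ → ℝ} (hw : Continuous w) {c : ℝ}
    (hc : 0 ≤ c)
    (hcw : ∀ s ∈ Icc a b, ∀ t ∈ Icc a b, s ≤ t → c * √(1 - ⟪v s, v t⟫ ^ 2) ≤ ∫ θ in s..t, w θ) :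
    c * Real.pi ≤ ∫ θ in a..b, w θ := by
  have key : ∀ η : ℝ, 0 < η → η < 1 → c * (η * Real.pi) ≤ ∫ θ in a..b, w θ := by
    intro η hη hη1
    have huc := isCompact_Icc.uniformContinuousOn_of_continuous hv
    rw [Metric.uniformContinuousOn_iff] at huc
    obtain ⟨δ, hδ, huc⟩ := huc (1 - η) (by linarith)
    obtain ⟨N, hN⟩ := exists_nat_gt ((b - a) / δ)
    have hN0 : (0 : ℝ) < N := lt_trans (div_pos (sub_pos.2 hab) hδ) hN
    have hNne : N ≠ 0 := by rintro rfl; simp at hN0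
    let p : ℕ → ℝ := fun k => a + k * ((b - a) / N)
    have hstep : 0 < (b - a) / N := div_pos (sub_pos.2 hab) hN0
    have hpN : p N = b := by simp only [p]; field_simp; ring
    have hp0 : p 0 = a := by simp [p]
    have hmem : ∀ k ≤ N, p k ∈ Icc a b := by
      intro k hk
      have hk' : (k : ℝ) ≤ N := by exact_mod_cast hk
      refine ⟨by simp only [p]; have := mul_nonneg k.cast_nonneg hstep.le; linarith, ?_⟩
      rw [← hpN]
      simp only [p]
      have := mul_le_mul_of_nonneg_right hk' hstep.le
      linarith
    have hsucc : ∀ k, p (k + 1) = p k + (b - a) / N := by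
      intro k; simp only [p]; push_cast; ring
    have h1 : ∀ k < N, c * (η * InnerProductGeometry.angle (v (p k)) (v (p (k + 1)))) ≤
        ∫ θ in p k..p (k + 1), w θ := by
      intro k hk
      have hm0 := hmem k hk.le
      have hm1 := hmem (k + 1) hk
      have hle : p k ≤ p (k + 1) := by rw [hsucc]; linarith
      refine le_trans (mul_le_mul_of_nonneg_left ?_ hc) (hcw _ hm0 _ hm1 hle)
      refine mul_angle_le_sqrt (hv1 _ hm0) (hv1 _ hm1) ?_ hη
      have h2 := huc _ hm0 _ hm1 (by
        rw [hsucc, dist_self_add_right, Real.norm_eq_abs, abs_of_pos hstep, div_lt_iff₀ hN0]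
        rw [div_lt_iff₀ hδ] at hN
        linarith)
      rw [dist_eq_norm] at h2
      have h3 := norm_sub_sq_real (v (p k)) (v (p (k + 1)))
      rw [hv1 _ hm0, hv1 _ hm1] at h3
      nlinarith [norm_nonneg (v (p k) - v (p (k + 1)))]
    have h2 := angle_le_sum (fun k => v (p k)) N
    have hva : v a ≠ 0 := by
      rw [← norm_ne_zero_iff, hv1 a ⟨le_rfl, hab.le⟩]; exact one_ne_zero
    simp only [hp0, hpN, hanti, hNne, if_false, zero_add,
      InnerProductGeometry.angle_self_neg_of_nonzero hva] at h2
    calc c * (η * Real.pi) ≤ c * (η * ∑ k ∈ Finset.range N,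
          InnerProductGeometry.angle (v (p k)) (v (p (k + 1)))) := by gcongr
      _ = ∑ k ∈ Finset.range N, c * (η * InnerProductGeometry.angle (v (p k)) (v (p (k + 1)))) := by
          rw [Finset.mul_sum, Finset.mul_sum]
      _ ≤ ∑ k ∈ Finset.range N, ∫ θ in p k..p (k + 1), w θ :=
          Finset.sum_le_sum fun k hk => h1 k (Finset.mem_range.1 hk)
      _ = ∫ θ in a..b, w θ := by
          rw [intervalIntegral.sum_integral_adjacent_intervals
            (fun k _ => hw.intervalIntegrable _ _), hp0, hpN]
  have ht : Tendsto (fun η : ℝ => c * (η * Real.pi)) (𝓝[<] 1) (𝓝 (c * (1 * Real.pi))) :=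
    ((continuous_const.mul (continuous_id.mul continuous_const)).tendsto 1).mono_left
      nhdsWithin_le_nhds
  rw [one_mul] at ht
  refine le_of_tendsto ht ?_
  filter_upwards [Ioo_mem_nhdsLT (zero_lt_one' ℝ)] with η hη
  exact key η hη.1 hη.2

end Length

theorem sq_integral_le {f : ℝ → ℝ} (hf : Continuous f) {a b : ℝ} (hab : a ≤ b) :
    (∫ t in a..b, f t) ^ 2 ≤ (b - a) * ∫ t in a..b, f t ^ 2 := by
  rcases hab.eq_or_lt with rfl | hlt
  · simp
  set A := ∫ t in a..b, f t with hA
  have h0 : 0 ≤ ∫ t in a..b, ((b - a) * f t - A) ^ 2 :=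
    intervalIntegral.integral_nonneg hab fun t _ => sq_nonneg _
  have h1 : ∫ t in a..b, ((b - a) * f t - A) ^ 2 =
      (b - a) ^ 2 * (∫ t in a..b, f t ^ 2) - 2 * (b - a) * A * A + (b - a) * A ^ 2 := by
    have : ∀ t, ((b - a) * f t - A) ^ 2 =
        ((b - a) ^ 2 * f t ^ 2 - 2 * (b - a) * A * f t) + A ^ 2 := fun t => by ring
    simp only [this]
    rw [intervalIntegral.integral_add, intervalIntegral.integral_sub,
      intervalIntegral.integral_const_mul, intervalIntegral.integral_const_mul,
      intervalIntegral.integral_const, smul_eq_mul]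
    all_goals exact Continuous.intervalIntegrable (by fun_prop) _ _
  rw [h1] at h0
  have h2 : 0 < b - a := sub_pos.2 hlt
  have h3 : 0 ≤ (b - a) * ((b - a) * (∫ t in a..b, f t ^ 2) - A ^ 2) := by nlinarith
  have := nonneg_of_mul_nonneg_right h3 h2
  linarith

theorem norm_sub_le_integral {V : Type*} [NormedAddCommGroup V] [NormedSpace ℝ V] [CompleteSpace V]
    {u u' : ℝ → V} (hu : ∀ t, HasDerivAt u (u' t) t) (hu' : Continuous u') {a b : ℝ}
    (hab : a ≤ b) : ‖u b - u a‖ ≤ ∫ t in a..b, ‖u' t‖ := by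
  rw [← intervalIntegral.integral_eq_sub_of_hasDerivAt (fun t _ => hu t)
    (hu'.intervalIntegrable _ _)]
  exact intervalIntegral.norm_integral_le_integral_norm hab

theorem sq_norm_sub_le_integral {V : Type*} [NormedAddCommGroup V] [NormedSpace ℝ V]
    [CompleteSpace V]
    {u u' : ℝ → V} (hu : ∀ t, HasDerivAt u (u' t) t) (hu' : Continuous u') {a b : ℝ}
    (hab : a ≤ b) : ‖u b - u a‖ ^ 2 ≤ (b - a) * ∫ t in a..b, ‖u' t‖ ^ 2 :=
  (pow_le_pow_left₀ (norm_nonneg _) (norm_sub_le_integral hu hu' hab) 2).trans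
    (sq_integral_le hu'.norm hab)

/-- A Lipschitz function `gap` on `V` together with a field of unit vectors `dir` whose lines
turn slowly where `gap` is positive. -/
structure GapField (V F : Type*) [NormedAddCommGroup V] [NormedSpace ℝ V]
    [NormedAddCommGroup F] [InnerProductSpace ℝ F] where
  gap : V → ℝ
  dir : V → F
  lip : ℝ
  scale : ℝ
  lip_pos : 0 < lip
  scale_pos : 0 < scale
  gap_sub_le : ∀ u v, gap u - gap v ≤ lip * ‖u - v‖
  norm_dir : ∀ v, ‖dir v‖ = 1
  separation : ∀ m, 0 < m → ∀ u v, m ≤ gap u → m ≤ gap v →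
    2 * scale ^ 2 * m ^ 2 * (1 - ⟪dir u, dir v⟫ ^ 2) ≤ ‖u - v‖ ^ 2

/-- The quadratic penalisation of values below one. -/
def pen (t : ℝ) : ℝ := max 0 (1 - t) ^ 2

theorem pen_nonneg (t : ℝ) : 0 ≤ pen t := sq_nonneg _

theorem continuous_pen : Continuous pen := by unfold pen; fun_prop

theorem le_pen {t δ : ℝ} (hδ : 0 ≤ δ) (h : t ≤ 1 - δ) : δ ^ 2 ≤ pen t := by
  unfold pen
  exact pow_le_pow_left₀ hδ (le_max_of_le_right (by linarith)) 2

/-! ### Line fields with a gap, and the energy of one circle. -/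

namespace GapField

variable {V F : Type*} [NormedAddCommGroup V] [NormedSpace ℝ V]
  [NormedAddCommGroup F] [InnerProductSpace ℝ F] (G : GapField V F)

/-- The energy of a half turn on the unit circle. -/
def kappa : ℝ := Real.pi / 2 * G.scale ^ 2

theorem kappa_pos : 0 < G.kappa := by
  have := Real.pi_pos
  have := G.scale_pos
  unfold kappa; positivity

theorem continuous_gap : Continuous G.gap := by
  refine (LipschitzWith.of_le_add_mul' G.lip fun u v => ?_).continuous
  have := G.gap_sub_le u v
  rw [dist_eq_norm]
  linarith

theorem one_sub_inner_sq_nonneg (u v : V) : 0 ≤ 1 - ⟪G.dir u, G.dir v⟫ ^ 2 := by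
  have h := abs_real_inner_le_norm (G.dir u) (G.dir v)
  rw [G.norm_dir, G.norm_dir, one_mul] at h
  nlinarith [sq_abs ⟪G.dir u, G.dir v⟫, abs_nonneg ⟪G.dir u, G.dir v⟫]

theorem mul_sqrt_le {m : ℝ} (hm : 0 < m) {u v : V} (hu : m ≤ G.gap u) (hv : m ≤ G.gap v) :
    √2 * G.scale * m * √(1 - ⟪G.dir u, G.dir v⟫ ^ 2) ≤ ‖u - v‖ := by
  have h := G.separation m hm u v hu hv
  have hs := G.scale_pos
  apply le_of_sq_le_sq _ (norm_nonneg _)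
  rw [mul_pow, mul_pow, mul_pow, Real.sq_sqrt (by norm_num),
    Real.sq_sqrt (G.one_sub_inner_sq_nonneg u v)]
  exact h

theorem norm_lineProj_sub_le' {m : ℝ} (hm : 0 < m) {u v : V} (hu : m ≤ G.gap u)
    (hv : m ≤ G.gap v) :
    ‖lineProj (G.dir u) - lineProj (G.dir v)‖ ≤ 2 / (G.scale * m) * ‖u - v‖ := by
  have hs := G.scale_pos
  refine (norm_lineProj_sub_le (G.norm_dir u) (G.norm_dir v)).trans ?_
  have h := G.mul_sqrt_le hm hu hv
  rw [Real.sqrt_mul (by norm_num)]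
  rw [div_mul_eq_mul_div, le_div_iff₀ (by positivity)]
  nlinarith

/-- The vector `dir` is chosen up to a sign and need not be continuous; the line it spans is
continuous wherever the gap is positive. -/
theorem continuousOn_lineProj {X : Type*} [TopologicalSpace X] {W : X → V} {s : Set X}
    (hW : ContinuousOn W s) (hpos : ∀ x ∈ s, 0 < G.gap (W x)) :
    ContinuousOn (fun x => lineProj (G.dir (W x))) s := by
  intro x hx
  have hm : 0 < G.gap (W x) / 2 := half_pos (hpos x hx)
  have hWx := hW x hx
  have h1 : ∀ᶠ y in 𝓝[s] x, G.gap (W x) / 2 < G.gap (W y) :=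
    ((G.continuous_gap.tendsto _).comp hWx).eventually_const_lt (by linarith)
  rw [ContinuousWithinAt, tendsto_iff_norm_sub_tendsto_zero]
  have h2 : Tendsto (fun y => 2 / (G.scale * (G.gap (W x) / 2)) * ‖W y - W x‖) (𝓝[s] x) (𝓝 0) := by
    have := (tendsto_iff_norm_sub_tendsto_zero.1 hWx).const_mul (2 / (G.scale * (G.gap (W x) / 2)))
    rwa [mul_zero] at this
  refine squeeze_zero' (Eventually.of_forall fun y => norm_nonneg _) ?_ h2
  filter_upwards [h1] with y hy
  exact G.norm_lineProj_sub_le' hm hy.le (by linarith)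

/-- Orthogonal directions at two points of gap at least `m` would force the distance to be at least
`√2 * scale * m`, which exceeds `δ`. -/
theorem orientable_of_close {W W' : ℂ → V} {x : ℂ} {r m δ : ℝ} (hm : 0 < m)
    (hW' : ContinuousOn (fun z : ℂ => W' (x + r * z)) (sphere 0 1))
    (hgap : ∀ z ∈ sphere (0 : ℂ) 1, m ≤ G.gap (W (x + r * z)))
    (hgap' : ∀ z ∈ sphere (0 : ℂ) 1, m ≤ G.gap (W' (x + r * z)))
    (hclose : ∀ z ∈ sphere (0 : ℂ) 1, ‖W' (x + r * z) - W (x + r * z)‖ ≤ δ)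
    (hδ : δ < G.scale * m) (h : Orientable (G.dir ∘ W) x r) : Orientable (G.dir ∘ W') x r := by
  refine h.of_inner_ne_zero (fun z => G.norm_dir _)
    (G.continuousOn_lineProj hW' fun z hz => hm.trans_le (hgap' z hz)) fun z hz h0 => ?_
  have h1 := G.separation m hm _ _ (hgap' z hz) (hgap z hz)
  have h2 := hclose z hz
  have hs := mul_pos G.scale_pos hm
  simp only [Function.comp_apply] at h0
  rw [h0] at h1
  have h3 := pow_le_pow_left₀ (norm_nonneg _) h2 2
  nlinarith [norm_nonneg (W' (x + r * z) - W (x + r * z))]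

variable [CompleteSpace V]

/-- Along a circle of gap at least `m` the speed of `Q` is at least `√2 * scale * m` times that of
the line, which turns by at least `π`. The Cauchy-Schwarz inequality on an interval of length `2 π`
then gives `π * scale² * m²`. -/
theorem kappa_mul_sq_le {Q : ℂ → V} (hQ : Continuous Q) {x : ℂ} {r m : ℝ} (hm : 0 < m)
    {u' : ℝ → V} (hu : ∀ θ, HasDerivAt (fun θ => Q (circleMap x r θ)) (u' θ) θ)
    (hu' : Continuous u') (hgap : ∀ θ, m ≤ G.gap (Q (circleMap x r θ)))
    (hor : ¬ Orientable (G.dir ∘ Q) x r) :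
    2 * (G.kappa * m ^ 2) ≤ ∫ θ in (0 : ℝ)..2 * Real.pi, ‖u' θ‖ ^ 2 := by
  have hπ := Real.pi_pos
  have hs := G.scale_pos
  have hmem : ∀ z ∈ sphere (0 : ℂ) 1, ∃ θ : ℝ, x + r * z = circleMap x r θ := by
    intro z hz
    refine ⟨Complex.arg z, ?_⟩
    have := Complex.norm_mul_exp_arg_mul_I z
    rw [mem_sphere_zero_iff_norm.1 hz, Complex.ofReal_one, one_mul] at this
    rw [circleMap, this]
  obtain ⟨v, hv, hvn, hanti⟩ := exists_antiperiodic_lift (n := G.dir ∘ Q) (fun z => G.norm_dir _)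
    (G.continuousOn_lineProj (by fun_prop) fun z hz => by
      obtain ⟨θ, hθ⟩ := hmem z hz
      rw [hθ]; exact hm.trans_le (hgap θ)) hor
  have h1 := mul_pi_le_integral (c := √2 * G.scale * m) (w := fun θ => ‖u' θ‖)
    (mul_pos two_pos hπ) hv (fun θ hθ => by
      rcases hvn θ hθ with h | h <;> rw [h] <;> simp [G.norm_dir]) hanti hu'.norm (by positivity)
    (fun s hs t ht hst => by
      refine le_trans ?_ (norm_sub_le_integral hu hu' hst)
      refine le_trans (le_of_eq ?_) (G.mul_sqrt_le hm (hgap t) (hgap s))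
      have : ⟪v s, v t⟫ ^ 2 =
          ⟪G.dir (Q (circleMap x r t)), G.dir (Q (circleMap x r s))⟫ ^ 2 := by
        rcases hvn s hs with h | h <;> rcases hvn t ht with h' | h' <;> rw [h, h'] <;>
          simp [real_inner_comm]
      rw [this])
  have h2 := sq_integral_le hu'.norm (mul_pos two_pos hπ).le
  have h3 := (pow_le_pow_left₀ (by positivity) h1 2).trans h2
  rw [mul_pow, mul_pow, mul_pow, Real.sq_sqrt (by norm_num), sub_zero] at h3
  unfold kappa
  have h4 : Real.pi * (Real.pi * G.scale ^ 2 * m ^ 2) ≤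
      Real.pi * ∫ θ in (0 : ℝ)..2 * Real.pi, ‖u' θ‖ ^ 2 := by linarith
  have := le_of_mul_le_mul_left h4 hπ
  linarith


end GapField

namespace GapField

variable {V F : Type*} [NormedAddCommGroup V] [NormedSpace ℝ V]
  [NormedAddCommGroup F] [InnerProductSpace ℝ F] (G : GapField V F) [CompleteSpace V]

/-- The price of a value of the gap below one, on an interval of length `2π` (the circle of radius
`τ` in angular coordinates). -/
theorem penalty_le {u u' : ℝ → V} (hu : ∀ θ, HasDerivAt u (u' θ) θ) (hu' : Continuous u')
    {c₀ ε τ δ η : ℝ} (hc₀ : 0 < c₀) (hε : 0 < ε) (hτ : ε ≤ τ) (hδ : 0 < δ) (hη : 0 ≤ η)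
    (hη1 : η ≤ 1) {θ₁ : ℝ} (hθ₁ : θ₁ ∈ Icc (0 : ℝ) (2 * Real.pi)) (hgap : G.gap (u θ₁) = 1 - δ) :
    η * (min c₀ (√c₀ / (4 * G.lip)) * δ ^ 2 / ε) ≤
      η * (∫ θ in (0 : ℝ)..2 * Real.pi, ‖u' θ‖ ^ 2 / (2 * τ)) +
      ∫ θ in (0 : ℝ)..2 * Real.pi, c₀ / ε ^ 2 * pen (G.gap (u θ)) * τ := by
  have hπ := Real.pi_gt_three
  have hL := G.lip_pos
  have hτ0 : 0 < τ := hε.trans_le hτ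
  have huc : Continuous u := continuous_iff_continuousAt.2 fun θ => (hu θ).continuousAt
  have hgc : Continuous fun θ => G.gap (u θ) := G.continuous_gap.comp huc
  have hpc : Continuous fun θ => c₀ / ε ^ 2 * pen (G.gap (u θ)) * τ :=
    (continuous_const.mul (continuous_pen.comp hgc)).mul continuous_const
  have hdc : Continuous fun θ => ‖u' θ‖ ^ 2 / (2 * τ) := by fun_prop
  have hDnn : 0 ≤ ∫ θ in (0 : ℝ)..2 * Real.pi, ‖u' θ‖ ^ 2 / (2 * τ) :=
    intervalIntegral.integral_nonneg (by positivity) fun θ _ => by positivity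
  have hpnn : ∀ θ, 0 ≤ c₀ / ε ^ 2 * pen (G.gap (u θ)) * τ := fun θ => by
    have := pen_nonneg (G.gap (u θ)); positivity
  -- a subinterval on which the penalty is bounded below
  have hsub : ∀ a b : ℝ, 0 ≤ a → a ≤ b → b ≤ 2 * Real.pi →
      (∀ θ ∈ Ioo a b, G.gap (u θ) ≤ 1 - δ / 2) →
      c₀ / ε ^ 2 * (δ / 2) ^ 2 * τ * (b - a) ≤
        ∫ θ in (0 : ℝ)..2 * Real.pi, c₀ / ε ^ 2 * pen (G.gap (u θ)) * τ := by
    intro a b ha hab hb hle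
    calc c₀ / ε ^ 2 * (δ / 2) ^ 2 * τ * (b - a)
        = ∫ θ in a..b, c₀ / ε ^ 2 * (δ / 2) ^ 2 * τ := by
          rw [intervalIntegral.integral_const, smul_eq_mul]; ring
      _ ≤ ∫ θ in a..b, c₀ / ε ^ 2 * pen (G.gap (u θ)) * τ := by
          refine intervalIntegral.integral_mono_on_of_le_Ioo hab
            (continuous_const.intervalIntegrable _ _) (hpc.intervalIntegrable _ _) fun θ hθ => ?_
          have := le_pen (by positivity) (hle θ hθ)
          gcongr
      _ ≤ _ := intervalIntegral.integral_mono_interval ha hab hb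
          (Eventually.of_forall hpnn) (hpc.intervalIntegrable _ _)
  -- Either the gap recovers half of its deficit somewhere, and the nearest such angle `θ₂` bounds
  -- an interval on which both the penalty and a jump of size `δ / 2` are paid, or the penalty is
  -- paid on the whole circle.
  by_cases hS : ∃ θ ∈ Icc (0 : ℝ) (2 * Real.pi), 1 - δ / 2 ≤ G.gap (u θ)
  · let S := Icc (0 : ℝ) (2 * Real.pi) ∩ {θ | 1 - δ / 2 ≤ G.gap (u θ)}
    have hSc : IsCompact S := isCompact_Icc.inter_right (isClosed_le continuous_const hgc)
    obtain ⟨θ₂, hθ₂, hmin⟩ := hSc.exists_isMinOn (f := fun θ => |θ - θ₁|)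
      (by obtain ⟨θ, h1, h2⟩ := hS; exact ⟨θ, h1, h2⟩) (by fun_prop)
    have hθ₂0 : θ₂ ∈ Icc (0 : ℝ) (2 * Real.pi) := hθ₂.1
    have hθ₂g : 1 - δ / 2 ≤ G.gap (u θ₂) := hθ₂.2
    have hlt : ∀ θ ∈ Icc (0 : ℝ) (2 * Real.pi), |θ - θ₁| < |θ₂ - θ₁| →
        G.gap (u θ) ≤ 1 - δ / 2 := by
      intro θ hθ h
      by_contra hcon
      have : θ ∈ S := ⟨hθ, (not_le.1 hcon).le⟩
      exact absurd (hmin this) (not_le.2 h)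
    have hne : θ₁ ≠ θ₂ := by rintro rfl; linarith
    obtain ⟨a, b, hab, ha, hb, hle, hjump⟩ : ∃ a b : ℝ, a < b ∧ 0 ≤ a ∧ b ≤ 2 * Real.pi ∧
        (∀ θ ∈ Ioo a b, G.gap (u θ) ≤ 1 - δ / 2) ∧ δ / 2 ≤ G.lip * ‖u b - u a‖ := by
      rcases lt_or_gt_of_ne hne with h | h
      · refine ⟨θ₁, θ₂, h, hθ₁.1, hθ₂0.2, fun θ hθ => hlt θ ⟨hθ₁.1.trans hθ.1.le,
          hθ.2.le.trans hθ₂0.2⟩ ?_, ?_⟩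
        · rw [abs_of_pos (by linarith [hθ.1]), abs_of_pos (by linarith)]; linarith [hθ.2]
        · have := G.gap_sub_le (u θ₂) (u θ₁); linarith
      · refine ⟨θ₂, θ₁, h, hθ₂0.1, hθ₁.2, fun θ hθ => hlt θ ⟨hθ₂0.1.trans hθ.1.le,
          hθ.2.le.trans hθ₁.2⟩ ?_, ?_⟩
        · rw [abs_of_neg (by linarith [hθ.2]), abs_of_neg (by linarith)]; linarith [hθ.1]
        · have := G.gap_sub_le (u θ₂) (u θ₁); rw [norm_sub_rev]; linarith
    have hpen := hsub a b ha hab.le hb hle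
    have hder : (δ / (2 * G.lip)) ^ 2 ≤ (b - a) * (2 * τ *
        ∫ θ in (0 : ℝ)..2 * Real.pi, ‖u' θ‖ ^ 2 / (2 * τ)) := by
      have h1 : δ / (2 * G.lip) ≤ ‖u b - u a‖ := by
        rw [div_le_iff₀ (by positivity)]; linarith
      have h2 := (pow_le_pow_left₀ (by positivity) h1 2).trans
        (sq_norm_sub_le_integral hu hu' hab.le)
      refine h2.trans (mul_le_mul_of_nonneg_left ?_ (by linarith))
      rw [← intervalIntegral.integral_const_mul]
      calc ∫ θ in a..b, ‖u' θ‖ ^ 2 ≤ ∫ θ in (0 : ℝ)..2 * Real.pi, ‖u' θ‖ ^ 2 :=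
            intervalIntegral.integral_mono_interval ha hab.le hb
              (Eventually.of_forall fun θ => sq_nonneg _)
              ((hu'.norm.pow 2).intervalIntegrable _ _)
        _ = _ := by
            congr 1; funext θ; field_simp
    set D := ∫ θ in (0 : ℝ)..2 * Real.pi, ‖u' θ‖ ^ 2 / (2 * τ)
    set B := ∫ θ in (0 : ℝ)..2 * Real.pi, c₀ / ε ^ 2 * pen (G.gap (u θ)) * τ
    set X := τ * (b - a) with hX
    have hX0 : 0 < X := mul_pos hτ0 (sub_pos.2 hab)
    have hD : δ ^ 2 / (8 * G.lip ^ 2 * X) ≤ D := by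
      rw [div_le_iff₀ (by positivity)]
      rw [div_pow, div_le_iff₀ (by positivity)] at hder
      calc δ ^ 2 ≤ _ := hder
        _ = _ := by rw [hX]; ring
    have hB : c₀ * δ ^ 2 * X / (4 * ε ^ 2) ≤ B := by
      refine le_trans (le_of_eq ?_) hpen
      rw [hX]; field_simp; ring
    have hB0 : 0 ≤ c₀ * δ ^ 2 * X / (4 * ε ^ 2) := by positivity
    -- The arithmetic-geometric inequality: the derivative cost decreases and the penalty increases
    -- with the length `X` of the interval, so the sum is bounded below whatever `X` is.
    have ham : √c₀ / (4 * G.lip) * δ ^ 2 / ε ≤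
        δ ^ 2 / (8 * G.lip ^ 2 * X) + c₀ * δ ^ 2 * X / (4 * ε ^ 2) := by
      have hsq : √c₀ ^ 2 = c₀ := Real.sq_sqrt hc₀.le
      have hs0 : 0 < √c₀ := Real.sqrt_pos.2 hc₀
      set k := √c₀
      rw [← hsq]
      have e1 : k / (4 * G.lip) * δ ^ 2 / ε =
          δ ^ 2 * (2 * (k * G.lip * X) * ε) / (8 * G.lip ^ 2 * X * ε ^ 2) := by field_simp; ring
      have e2 : δ ^ 2 / (8 * G.lip ^ 2 * X) + k ^ 2 * δ ^ 2 * X / (4 * ε ^ 2) =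
          δ ^ 2 * (ε ^ 2 + 2 * (k * G.lip * X) ^ 2) / (8 * G.lip ^ 2 * X * ε ^ 2) := by
        field_simp; ring
      rw [e1, e2]
      gcongr
      linarith [sq_nonneg (ε - k * G.lip * X), sq_nonneg (k * G.lip * X)]
    calc η * (min c₀ (√c₀ / (4 * G.lip)) * δ ^ 2 / ε)
        ≤ η * (√c₀ / (4 * G.lip) * δ ^ 2 / ε) := by gcongr; exact min_le_right _ _
      _ ≤ η * (δ ^ 2 / (8 * G.lip ^ 2 * X) + c₀ * δ ^ 2 * X / (4 * ε ^ 2)) := by gcongr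
      _ = η * (δ ^ 2 / (8 * G.lip ^ 2 * X)) + η * (c₀ * δ ^ 2 * X / (4 * ε ^ 2)) := by ring
      _ ≤ η * D + B := add_le_add (by gcongr) ((mul_le_of_le_one_left hB0 hη1).trans hB)
  · push Not at hS
    have hpen := hsub 0 (2 * Real.pi) le_rfl (by positivity) le_rfl
      fun θ hθ => (hS θ ⟨hθ.1.le, hθ.2.le⟩).le
    -- Here `ε ≤ τ` and `2 π / 4 ≥ 1` are enough.
    have h1 : c₀ * δ ^ 2 / ε ≤ c₀ / ε ^ 2 * (δ / 2) ^ 2 * τ * (2 * Real.pi - 0) := by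
      have : c₀ * δ ^ 2 / ε = c₀ * δ ^ 2 / ε ^ 2 * ε := by field_simp
      rw [this]
      calc c₀ * δ ^ 2 / ε ^ 2 * ε ≤ c₀ * δ ^ 2 / ε ^ 2 * (τ * (2 * Real.pi / 4)) := by
            gcongr
            nlinarith
        _ = _ := by ring
    have hm : 0 ≤ min c₀ (√c₀ / (4 * G.lip)) := le_min hc₀.le (by positivity)
    calc η * (min c₀ (√c₀ / (4 * G.lip)) * δ ^ 2 / ε)
        ≤ min c₀ (√c₀ / (4 * G.lip)) * δ ^ 2 / ε := mul_le_of_le_one_left (by positivity) hη1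
      _ ≤ c₀ * δ ^ 2 / ε := by gcongr; exact min_le_left _ _
      _ ≤ _ := h1.trans hpen
      _ ≤ _ := le_add_of_nonneg_left (mul_nonneg hη hDnn)

set_option maxHeartbeats 400000 in
/-- Lower bound for the energy on a circle of radius `τ` with a non-orientable line field. -/
theorem circle_energy_ge {c₀ : ℝ} (hc₀ : 0 < c₀) : ∃ K₀ : ℝ, 0 < K₀ ∧ ∀ K, K₀ ≤ K →
    ∀ {Q : ℂ → V}, Continuous Q → ∀ {x : ℂ} {τ ε : ℝ}, 0 < ε → ε ≤ τ → ∀ {u' : ℝ → V},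
    (∀ θ, HasDerivAt (fun θ => Q (circleMap x τ θ)) (u' θ) θ) → Continuous u' →
    (∀ θ, 1 / 2 ≤ G.gap (Q (circleMap x τ θ))) → ¬ Orientable (G.dir ∘ Q) x τ →
    G.kappa / (τ + K * √(ε * τ)) ≤ ∫ θ in (0 : ℝ)..2 * Real.pi,
      (‖u' θ‖ ^ 2 / (2 * τ) + c₀ / ε ^ 2 * pen (G.gap (Q (circleMap x τ θ))) * τ) := by
  have hL := G.lip_pos
  have hκ := G.kappa_pos
  set C := min c₀ (√c₀ / (4 * G.lip)) with hC
  have hC0 : 0 < C := lt_min hc₀ (by have := Real.sqrt_pos.2 hc₀; positivity)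
  set C' := 1 + G.kappa / C with hC'
  have hC'1 : 0 < C' := by positivity
  refine ⟨6 * C', by positivity, ?_⟩
  intro K hK Q hQ x τ ε hε hετ u' hu hu' hgap hor
  have hπ := Real.pi_pos
  have hτ : 0 < τ := hε.trans_le hετ
  have hgc : Continuous fun θ => G.gap (Q (circleMap x τ θ)) :=
    G.continuous_gap.comp (hQ.comp (continuous_circleMap x τ))
  have hpc : Continuous fun θ => c₀ / ε ^ 2 * pen (G.gap (Q (circleMap x τ θ))) * τ :=
    (continuous_const.mul (continuous_pen.comp hgc)).mul continuous_const
  have hdc : Continuous fun θ => ‖u' θ‖ ^ 2 / (2 * τ) := by fun_prop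
  rw [intervalIntegral.integral_add (hdc.intervalIntegrable _ _) (hpc.intervalIntegrable _ _)]
  -- The part `y` of the Dirichlet energy is spent with the penalty in `penalty_le`, and the part `1
  -- - y` pays for the half turn. With this choice both losses turn out to be of relative size `y`.
  set y := √(ε / τ) with hy
  have hy0 : 0 < y := Real.sqrt_pos.2 (by positivity)
  have hy1 : y ≤ 1 := Real.sqrt_le_one.2 ((div_le_one hτ).2 hετ)
  have hy2 : y ^ 2 = ε / τ := Real.sq_sqrt (by positivity)
  have hετy : ε = y ^ 2 * τ := by rw [hy2]; field_simp
  have hsq : √(ε * τ) = y * τ := by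
    rw [hετy, show y ^ 2 * τ * τ = (y * τ) ^ 2 by ring, Real.sqrt_sq (by positivity)]
  have hden : τ + K * √(ε * τ) = τ * (1 + K * y) := by rw [hsq]; ring
  have hK0 : 0 < K := by linarith
  rw [hden]
  have hBnn : 0 ≤ ∫ θ in (0 : ℝ)..2 * Real.pi,
      c₀ / ε ^ 2 * pen (G.gap (Q (circleMap x τ θ))) * τ :=
    intervalIntegral.integral_nonneg (by positivity) fun θ _ => by
      have := pen_nonneg (G.gap (Q (circleMap x τ θ))); positivity
  have hA : ∀ m, 0 < m → (∀ θ, m ≤ G.gap (Q (circleMap x τ θ))) →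
      G.kappa * m ^ 2 / τ ≤ ∫ θ in (0 : ℝ)..2 * Real.pi, ‖u' θ‖ ^ 2 / (2 * τ) := by
    intro m hm hmg
    have h1 := G.kappa_mul_sq_le hQ hm hu hu' hmg hor
    rw [intervalIntegral.integral_div, div_le_div_iff₀ hτ (by positivity)]
    nlinarith
  set A := ∫ θ in (0 : ℝ)..2 * Real.pi, ‖u' θ‖ ^ 2 / (2 * τ) with hAdef
  set B := ∫ θ in (0 : ℝ)..2 * Real.pi, c₀ / ε ^ 2 * pen (G.gap (Q (circleMap x τ θ))) * τ
  obtain ⟨θ₁, hθ₁, hmin⟩ := (isCompact_Icc (a := (0 : ℝ)) (b := 2 * Real.pi)).exists_isMinOn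
    ⟨0, le_rfl, by positivity⟩ hgc.continuousOn
  set m := G.gap (Q (circleMap x τ θ₁)) with hm
  have hmle : ∀ θ, m ≤ G.gap (Q (circleMap x τ θ)) := by
    intro θ
    obtain ⟨θ', hθ', he⟩ := (periodic_circleMap x τ).exists_mem_Ico₀ (by positivity) θ
    rw [he]
    exact hmin ⟨hθ'.1, hθ'.2.le⟩
  have hmhalf : 1 / 2 ≤ m := hgap θ₁
  by_cases hm1 : 1 ≤ m
  · have := hA 1 one_pos fun θ => hm1.trans (hmle θ)
    have h2 : G.kappa / (τ * (1 + K * y)) ≤ G.kappa * 1 ^ 2 / τ := by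
      rw [one_pow, mul_one]
      apply div_le_div_of_nonneg_left hκ.le hτ
      nlinarith [mul_pos hK0 hy0]
    linarith
  push Not at hm1
  have hAm := hA m (by linarith) hmle
  -- When `y` is not small the denominator `1 + K y` is at least four, and the crude bound `m ≥ 1 /
  -- 2` suffices.
  by_cases hyC : 1 / 2 < C' * y
  · have h2 : G.kappa / (τ * (1 + K * y)) ≤ G.kappa * m ^ 2 / τ := by
      rw [div_le_div_iff₀ (by positivity) hτ]
      have h3 : 1 ≤ m ^ 2 * (1 + K * y) := by
        have : 6 * (C' * y) ≤ K * y := by nlinarith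
        nlinarith
      calc G.kappa * τ = G.kappa * τ * 1 := by ring
        _ ≤ G.kappa * τ * (m ^ 2 * (1 + K * y)) := by gcongr
        _ = _ := by ring
    linarith
  push Not at hyC
  have hp := G.penalty_le hu hu' hc₀ hε hετ (δ := 1 - m) (by linarith) hy0.le hy1 hθ₁
    (by rw [← hm]; ring)
  rw [← hC, ← hAdef] at hp
  have h1 : (1 - y) * (G.kappa * m ^ 2 / τ) + y * (C * (1 - m) ^ 2 / ε) ≤ A + B := by
    have := mul_le_mul_of_nonneg_left hAm (sub_nonneg.2 hy1)
    linarith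
  refine le_trans ?_ h1
  have h2 : (1 - y) * (G.kappa * m ^ 2 / τ) + y * (C * (1 - m) ^ 2 / ε) =
      ((1 - y) * (G.kappa * m ^ 2) + C * (1 - m) ^ 2 / y) / τ := by
    rw [hετy]; field_simp
  rw [h2, ← div_div, div_right_comm, div_le_div_iff_of_pos_right hτ]
  -- Minimisation over the unknown minimal gap `m`: using `m² ≥ 1 - 2 (1 - m)`, the loss is linear
  -- in `1 - m` and the penalty quadratic, so completing the square leaves `κ² y / C`. This explains
  -- `C' = 1 + κ / C`.
  have h3 : G.kappa * (1 - C' * y) ≤ (1 - y) * (G.kappa * m ^ 2) + C * (1 - m) ^ 2 / y := by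
    have h4 : C * (1 - m) ^ 2 / y - 2 * G.kappa * (1 - m) + G.kappa ^ 2 * y / C =
        (C * (1 - m) - G.kappa * y) ^ 2 / (C * y) := by
      field_simp; ring
    have h5 : 0 ≤ (C * (1 - m) - G.kappa * y) ^ 2 / (C * y) := by positivity
    have h6 : G.kappa * (1 - C' * y) = G.kappa - G.kappa * y - G.kappa ^ 2 * y / C := by
      rw [hC']; field_simp; ring
    have h7 : (1 - y) * G.kappa * (1 - 2 * (1 - m)) ≤ (1 - y) * G.kappa * m ^ 2 := by
      have : 0 ≤ (1 - y) * G.kappa := mul_nonneg (sub_nonneg.2 hy1) hκ.le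
      nlinarith [sq_nonneg (1 - m)]
    have h8 : 0 ≤ y * G.kappa * (1 - m) := by
      have : 0 ≤ 1 - m := by linarith
      positivity
    rw [h6]
    linarith
  refine le_trans ?_ h3
  rw [div_le_iff₀ (by positivity)]
  have h9 : 1 ≤ (1 - C' * y) * (1 + K * y) := by
    have h10 : C' * y * (K * y) ≤ 1 / 2 * (K * y) := by gcongr
    nlinarith
  calc G.kappa = G.kappa * 1 := by ring
    _ ≤ G.kappa * ((1 - C' * y) * (1 + K * y)) := by gcongr
    _ = _ := by ring

end GapField

/-! ### Merging and growing balls -/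

/-- The centre divides the segment from `a` to `b` in the ratio `s : r`, so that it lies within `s`
of `a` and within `r` of `b`. -/
theorem exists_closedBall_superset {a b : ℂ} {r s : ℝ} (hr : 0 < r) (hs : 0 < s)
    (h : ¬ Disjoint (closedBall a r) (closedBall b s)) :
    ∃ c, closedBall a r ⊆ closedBall c (r + s) ∧ closedBall b s ⊆ closedBall c (r + s) := by
  rw [disjoint_closedBall_closedBall_iff hr.le hs.le, not_lt] at h
  have hrs : 0 < r + s := by positivity
  rw [dist_eq_norm] at h
  refine ⟨a + (s / (r + s) : ℝ) • (b - a), ?_, ?_⟩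
  · apply closedBall_subset_closedBall'
    have : dist a (a + (s / (r + s) : ℝ) • (b - a)) ≤ s := by
      rw [dist_self_add_right, norm_smul, Real.norm_eq_abs, abs_of_pos (by positivity),
        norm_sub_rev, div_mul_eq_mul_div, div_le_iff₀ hrs]
      gcongr
    linarith
  · apply closedBall_subset_closedBall'
    have : dist b (a + (s / (r + s) : ℝ) • (b - a)) ≤ r := by
      have e : b - (a + (s / (r + s) : ℝ) • (b - a)) = (r / (r + s) : ℝ) • (b - a) := by
        have : (r / (r + s) : ℝ) = 1 - s / (r + s) := by field_simp; ring
        rw [this, sub_smul, one_smul]; abel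
      rw [dist_eq_norm, e, norm_smul, Real.norm_eq_abs, abs_of_pos (by positivity),
        norm_sub_rev, div_mul_eq_mul_div, div_le_iff₀ hrs]
      gcongr
    linarith

/-- Among the ways `π` of grouping the balls so that each group fits in a ball whose radius is the
sum of the radii, one with the fewest groups is taken: two intersecting enclosing balls could be
merged further. The map `π` sends each index to a label of its group. -/
theorem exists_disjoint_merge {ι : Type} [Fintype ι] (c : ι → ℂ) {r : ι → ℝ}
    (hr : ∀ i, 0 < r i) : ∃ (π : ι → ι) (c' : ι → ℂ) (r' : ι → ℝ),
      (∀ i, 0 < r' (π i)) ∧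
      (∀ k (J : Finset ι), (∀ i, i ∈ J ↔ π i = k) → r' k = ∑ i ∈ J, r i) ∧
      (∀ i, closedBall (c i) (r i) ⊆ closedBall (c' (π i)) (r' (π i))) ∧
      (∀ i j, π i ≠ π j →
        Disjoint (closedBall (c' (π i)) (r' (π i))) (closedBall (c' (π j)) (r' (π j)))) := by
  classical
  let R : (ι → ι) → ι → ℝ := fun π k => ∑ i with π i = k, r i
  let S : Set (ι → ι) := {π | ∃ c' : ι → ℂ,
    ∀ i, closedBall (c i) (r i) ⊆ closedBall (c' (π i)) (R π (π i))}
  have hid : id ∈ S := ⟨c, fun i => by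
    have : R id i = r i := by
      simp only [R, id]
      rw [Finset.filter_eq' Finset.univ i, if_pos (Finset.mem_univ i), Finset.sum_singleton]
    rw [id, this]⟩
  obtain ⟨π, ⟨c', hc'⟩, hmin⟩ := S.exists_min_image (fun π => (Finset.univ.image π).card)
    S.toFinite ⟨id, hid⟩
  have hpos : ∀ i, 0 < R π (π i) := fun i =>
    Finset.sum_pos (fun j _ => hr j) ⟨i, by simp⟩
  refine ⟨π, c', R π, hpos, ?_, hc', ?_⟩
  · intro k J hJ
    refine Finset.sum_congr ?_ fun _ _ => rfl
    ext i; simp [hJ]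
  · intro i j hij
    by_contra hdis
    obtain ⟨d, hd1, hd2⟩ := exists_closedBall_superset (hpos i) (hpos j) hdis
    let π' : ι → ι := fun l => if π l = π j then π i else π l
    have hR : R π' (π i) = R π (π i) + R π (π j) := by
      simp only [R]
      rw [← Finset.sum_union]
      · refine Finset.sum_congr ?_ fun _ _ => rfl
        ext l
        by_cases hl : π l = π j <;> simp [π', hl]
      · rw [Finset.disjoint_left]
        intro l h1 h2
        simp only [Finset.mem_filter, Finset.mem_univ, true_and] at h1 h2
        exact hij (h1.symm.trans h2)
    have hmem : π' ∈ S := by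
      refine ⟨fun k => if k = π i then d else c' k, fun l => ?_⟩
      by_cases hl : π l = π j
      · have : π' l = π i := by simp [π', hl]
        rw [this, hR]
        beta_reduce
        rw [if_pos rfl]
        refine (hc' l).trans ?_
        rw [hl]; exact hd2
      · have hl' : π' l = π l := by simp [π', hl]
        rw [hl']
        beta_reduce
        by_cases hl2 : π l = π i
        · rw [if_pos hl2, hl2, hR]
          refine (hc' l).trans ?_
          rw [hl2]; exact hd1
        · rw [if_neg hl2]
          have : R π' (π l) = R π (π l) := by
            simp only [R]
            refine Finset.sum_congr ?_ fun _ _ => rfl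
            ext p
            by_cases hp : π p = π j
            · simp only [π', hp, if_true, Finset.mem_filter, Finset.mem_univ, true_and]
              exact ⟨fun h => absurd h.symm hl2, fun h => absurd h.symm hl⟩
            · simp [π', hp]
          rw [this]
          exact hc' l
    have hlt : (Finset.univ.image π').card < (Finset.univ.image π).card := by
      apply Finset.card_lt_card
      rw [Finset.ssubset_iff_of_subset]
      · refine ⟨π j, by simp, ?_⟩
        simp only [Finset.mem_image, Finset.mem_univ, true_and, not_exists]
        intro l hl
        by_cases h : π l = π j
        · simp only [π', h, if_true] at hl; exact hij hl
        · simp only [π', h, if_false] at hl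
      · intro k hk
        simp only [Finset.mem_image, Finset.mem_univ, true_and] at hk ⊢
        obtain ⟨l, rfl⟩ := hk
        by_cases h : π l = π j
        · exact ⟨i, by simp [π', h]⟩
        · exact ⟨l, by simp [π', h]⟩
    exact absurd (hmin π' hmem) (not_le.2 hlt)

theorem ball_subset_ball_of_closedBall_subset {a b : ℂ} {r s : ℝ} (hr : 0 < r)
    (h : closedBall a r ⊆ closedBall b s) : ball a r ⊆ ball b s := by
  have hs : s ≠ 0 := by
    rintro rfl
    have h1 : a ∈ closedBall b 0 := h (mem_closedBall_self hr.le)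
    have h2 : a + (r : ℂ) ∈ closedBall b 0 := h (by simp [abs_of_pos hr])
    simp only [closedBall_zero, mem_singleton_iff] at h1 h2
    rw [h1] at h2
    have : (r : ℂ) = 0 := by simpa using h2
    exact hr.ne' (by exact_mod_cast this)
  rw [← interior_closedBall b hs]
  exact interior_maximal (ball_subset_closedBall.trans h) isOpen_ball

/-- Data for the ball construction: the energy `μ`, the lower bound `Λ` for the energy of a ball
of nontrivial type, the set `Z` of singular points, the radius `ρ` of the domain, and the
predicate `nontriv` telling the balls of nontrivial type. -/
structure BallGrowth where
  μ : Measure ℂ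
  Λ : ℝ → ℝ
  Z : Set ℂ
  ρ : ℝ
  nontriv : ℂ → ℝ → Prop
  s₀ : ℝ
  s₁ : ℝ
  s₀_pos : 0 < s₀
  Λ_nonneg : ∀ s, s₀ ≤ s → 0 ≤ Λ s
  Λ_mono : ∀ s t, s₀ ≤ s → s ≤ t → Λ s ≤ Λ t
  Λ_div : ∀ s t, s₀ ≤ s → s ≤ t → Λ t / t ≤ Λ s / s
  nontriv_lt : ∀ x r, nontriv x r → ‖x‖ + r < ρ
  exists_nontriv : ∀ {ι : Type} [Finite ι] (c : ι → ℂ) (r : ι → ℝ) (x : ℂ) (R : ℝ),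
    (∀ i, 0 < r i) → (Pairwise fun i j => Disjoint (ball (c i) (r i)) (ball (c j) (r j))) →
    (∀ i, closedBall (c i) (r i) ⊆ closedBall x R) → 0 < R →
    Z ∩ closedBall x R ⊆ ⋃ i, ball (c i) (r i) → nontriv x R → ∃ i, nontriv (c i) (r i)
  growth : ∀ x s t, s₀ ≤ s → s ≤ t → t ≤ s₁ → nontriv x s → ‖x‖ + t ≤ ρ →
    Z ∩ (ball x t \ ball x s) = ∅ → ENNReal.ofReal (Λ t - Λ s) ≤ μ (ball x t \ ball x s)

namespace BallGrowth

variable (B : BallGrowth)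

/-- A family of balls with disjoint interiors that covers the singular set, at parameter `s`. -/
structure IsFamily {ι : Type} (s : ℝ) (c : ι → ℂ) (r : ι → ℝ) : Prop where
  pos : ∀ i, 0 < r i
  disj : Pairwise fun i j => Disjoint (ball (c i) (r i)) (ball (c j) (r j))
  cover : B.Z ⊆ ⋃ i, ball (c i) (r i)
  energy : ∀ i, ENNReal.ofReal (r i / s * B.Λ s) ≤ B.μ (ball (c i) (r i))
  le_radius : ∀ i, B.nontriv (c i) (r i) → s ≤ r i

/-- There is a family of `n` disjoint closed balls at parameter `s`. -/
def HasFamily (s : ℝ) (n : ℕ) : Prop :=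
  ∃ (ι : Type) (_ : Fintype ι) (c : ι → ℂ) (r : ι → ℝ), Fintype.card ι = n ∧ B.IsFamily s c r ∧
    Pairwise fun i j => Disjoint (closedBall (c i) (r i)) (closedBall (c j) (r j))

variable {B}

theorem sum_le_measure {ι : Type} (J : Finset ι) {A : ι → Set ℂ} (hA : ∀ i, MeasurableSet (A i))
    {E : Set ℂ} (hdisj : Pairwise fun i j => Disjoint (A i) (A j)) (hsub : ∀ i ∈ J, A i ⊆ E)
    {μ : Measure ℂ} {f : ι → ℝ} (hf : ∀ i, 0 ≤ f i) (h : ∀ i, ENNReal.ofReal (f i) ≤ μ (A i)) :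
    ENNReal.ofReal (∑ i ∈ J, f i) ≤ μ E := by
  rw [ENNReal.ofReal_sum_of_nonneg fun i _ => hf i]
  calc ∑ i ∈ J, ENNReal.ofReal (f i) ≤ ∑ i ∈ J, μ (A i) := Finset.sum_le_sum fun i _ => h i
    _ = μ (⋃ i ∈ J, A i) := (measure_biUnion_finset (fun i _ j _ hij => hdisj hij)
        fun i _ => hA i).symm
    _ ≤ μ E := measure_mono (iUnion₂_subset hsub)

/-- Radii and energies both add under merging, so the bound `r / s * Λ s`, linear in the radius,
survives. A merged ball of nontrivial type contains an old one of nontrivial type, whose radius was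
already at least `s`. -/
theorem IsFamily.exists_merge {ι : Type} [Fintype ι] {s : ℝ} (hs : B.s₀ ≤ s) {c : ι → ℂ}
    {r : ι → ℝ} (h : B.IsFamily s c r) : ∃ m, m ≤ Fintype.card ι ∧
      ((∃ i j, i ≠ j ∧ ¬ Disjoint (closedBall (c i) (r i)) (closedBall (c j) (r j))) →
        m < Fintype.card ι) ∧ B.HasFamily s m := by
  classical
  have hs0 : 0 < s := B.s₀_pos.trans_le hs
  obtain ⟨π, c', r', hpos, hsum, hsub, hdis⟩ := exists_disjoint_merge c h.pos
  have hball : ∀ i, ball (c i) (r i) ⊆ ball (c' (π i)) (r' (π i)) := fun i =>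
    ball_subset_ball_of_closedBall_subset (h.pos i) (hsub i)
  refine ⟨Fintype.card (range π), Fintype.card_range_le π, ?_, range π, inferInstance,
    fun k => c' k, fun k => r' k, rfl, ⟨?_, ?_, ?_, ?_, ?_⟩, ?_⟩
  · rintro ⟨i, j, hij, hd⟩
    refine lt_of_le_of_ne (Fintype.card_range_le π) fun heq => hij ?_
    have hinj : Function.Injective π := by
      rw [← Set.rangeFactorization_injective]
      exact ((Fintype.bijective_iff_surjective_and_card _).2
        ⟨Set.rangeFactorization_surjective, heq.symm⟩).1
    apply hinj
    by_contra hne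
    exact hd ((hdis i j hne).mono (hsub i) (hsub j))
  · rintro ⟨_, i, rfl⟩; exact hpos i
  · rintro ⟨_, i, rfl⟩ ⟨_, j, rfl⟩ hij
    have : π i ≠ π j := fun e => hij (Subtype.ext e)
    exact (hdis i j this).mono ball_subset_closedBall ball_subset_closedBall
  · intro z hz
    obtain ⟨i, hi⟩ := mem_iUnion.1 (h.cover hz)
    exact mem_iUnion.2 ⟨⟨π i, i, rfl⟩, hball i hi⟩
  · rintro ⟨_, i, rfl⟩
    have e : r' (π i) / s * B.Λ s = ∑ j with π j = π i, r j / s * B.Λ s := by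
      rw [hsum (π i) (Finset.univ.filter fun j => π j = π i) (by simp), Finset.sum_div,
        Finset.sum_mul]
    simp only [e]
    refine sum_le_measure _ (fun j => measurableSet_ball) h.disj (fun j hj => ?_)
      (fun j => ?_) h.energy
    · simp only [Finset.mem_filter, Finset.mem_univ, true_and] at hj
      rw [← hj]; exact hball j
    · have := h.pos j; have := B.Λ_nonneg s hs; positivity
  · rintro ⟨_, i, rfl⟩ hN
    obtain ⟨⟨j, hj⟩, hNj⟩ := B.exists_nontriv (ι := {j // π j = π i}) (fun j => c j)
      (fun j => r j) _ _ (fun j => h.pos j) (fun j k hjk => h.disj fun e => hjk (Subtype.ext e))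
      (fun j => by
        have := hsub j
        rwa [j.2] at this)
      (hpos i) (by
        rintro z ⟨hzZ, hz⟩
        obtain ⟨j, hj⟩ := mem_iUnion.1 (h.cover hzZ)
        have : π j = π i := by
          by_contra hne
          exact Set.disjoint_left.1 (hdis j i hne) (ball_subset_closedBall (hball j hj)) hz
        exact mem_iUnion.2 ⟨⟨j, this⟩, hj⟩) hN
    refine (h.le_radius j hNj).trans ?_
    rw [hsum (π i) (Finset.univ.filter fun j => π j = π i) (by simp)]
    exact Finset.single_le_sum (f := r) (fun l _ => (h.pos l).le) (by simpa using hj)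
  · rintro ⟨_, i, rfl⟩ ⟨_, j, rfl⟩ hij
    exact hdis i j fun e => hij (Subtype.ext e)

open Classical in
/-- The radii of the balls grown up to the parameter `t`. -/
def grown {ι : Type} (B : BallGrowth) (c : ι → ℂ) (r : ι → ℝ) (i : ι) (t : ℝ) : ℝ :=
  if B.nontriv (c i) (r i) then max (r i) (min t (B.ρ - ‖c i‖)) else r i

theorem le_grown {ι : Type} (c : ι → ℂ) (r : ι → ℝ) (i : ι) (t : ℝ) :
    r i ≤ B.grown c r i t := by
  unfold grown; split_ifs
  · exact le_max_left _ _
  · exact le_rfl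

theorem continuous_grown {ι : Type} (c : ι → ℂ) (r : ι → ℝ) (i : ι) :
    Continuous (B.grown c r i) := by
  unfold grown; split_ifs <;> fun_prop

theorem IsFamily.grown_self {ι : Type} {s : ℝ} {c : ι → ℂ} {r : ι → ℝ} (h : B.IsFamily s c r)
    (i : ι) : B.grown c r i s = r i := by
  unfold grown; split_ifs with hN
  · exact max_eq_left ((min_le_left _ _).trans (h.le_radius i hN))
  · rfl

/-- A ball that does not grow keeps its bound because `Λ t / t` decreases. A ball that grows from `r
i` to `τ` adds the energy `Λ τ - Λ (r i)` of the annulus, which contains no singular point since the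
old balls cover the singular set. -/
theorem IsFamily.grow {ι : Type} {s t : ℝ} (hs : B.s₀ ≤ s) (hst : s ≤ t) (ht : t ≤ B.s₁)
    {c : ι → ℂ} {r : ι → ℝ} (h : B.IsFamily s c r)
    (hdisj : Pairwise fun i j => Disjoint (ball (c i) (B.grown c r i t))
      (ball (c j) (B.grown c r j t))) : B.IsFamily t c (fun i => B.grown c r i t) := by
  have hs0 : 0 < s := B.s₀_pos.trans_le hs
  have ht0 : 0 < t := hs0.trans_le hst
  have hsub : ∀ i, ball (c i) (r i) ⊆ ball (c i) (B.grown c r i t) := fun i =>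
    ball_subset_ball (le_grown c r i t)
  refine ⟨fun i => (h.pos i).trans_le (le_grown c r i t), hdisj,
    h.cover.trans (iUnion_mono hsub), fun i => ?_, fun i hN => ?_⟩
  · rcases (le_grown c r i t).eq_or_lt with heq | hlt
    · rw [← heq]
      refine le_trans (ENNReal.ofReal_le_ofReal ?_) (h.energy i)
      have := mul_le_mul_of_nonneg_left (B.Λ_div s t hs hst) (h.pos i).le
      calc r i / t * B.Λ t = r i * (B.Λ t / t) := by ring
        _ ≤ _ := this
        _ = _ := by ring
    · have hN : B.nontriv (c i) (r i) := by
        by_contra hN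
        simp [grown, hN] at hlt
      have hg : B.grown c r i t = min t (B.ρ - ‖c i‖) := by
        have e : B.grown c r i t = max (r i) (min t (B.ρ - ‖c i‖)) := by simp [grown, hN]
        rw [e] at hlt ⊢
        exact max_eq_right (lt_max_iff.1 hlt |>.resolve_left (lt_irrefl _)).le
      set τ := B.grown c r i t with hτ
      have hτt : τ ≤ t := hg ▸ min_le_left _ _
      have hτρ : ‖c i‖ + τ ≤ B.ρ := by
        have : τ ≤ B.ρ - ‖c i‖ := hg ▸ min_le_right _ _
        linarith
      have hsr := h.le_radius i hN
      have hempty : B.Z ∩ (ball (c i) τ \ ball (c i) (r i)) = ∅ := by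
        rw [Set.eq_empty_iff_forall_notMem]
        rintro z ⟨hzZ, hz1, hz2⟩
        obtain ⟨j, hj⟩ := mem_iUnion.1 (h.cover hzZ)
        have hij : i ≠ j := by rintro rfl; exact hz2 hj
        exact Set.disjoint_left.1 (hdisj hij) hz1 (hsub j hj)
      have h1 := B.growth (c i) (r i) τ (hs.trans hsr) hlt.le (hτt.trans ht) hN hτρ hempty
      have h2 := h.energy i
      have hr0 := h.pos i
      have h3 : B.Λ (r i) ≤ r i / s * B.Λ s := by
        have := B.Λ_div s (r i) hs hsr
        rw [div_le_iff₀ hr0] at this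
        calc B.Λ (r i) ≤ B.Λ s / s * r i := this
          _ = _ := by ring
      have h4 : τ / t * B.Λ t ≤ B.Λ τ := by
        have := B.Λ_div τ t (hs.trans (hsr.trans hlt.le)) hτt
        rw [le_div_iff₀ (hr0.trans hlt)] at this
        calc τ / t * B.Λ t = B.Λ t / t * τ := by ring
          _ ≤ _ := this
      calc ENNReal.ofReal (τ / t * B.Λ t) ≤ ENNReal.ofReal (B.Λ (r i) + (B.Λ τ - B.Λ (r i))) :=
            ENNReal.ofReal_le_ofReal (by linarith)
        _ = ENNReal.ofReal (B.Λ (r i)) + ENNReal.ofReal (B.Λ τ - B.Λ (r i)) :=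
            ENNReal.ofReal_add (B.Λ_nonneg _ (hs.trans hsr))
              (sub_nonneg.2 (B.Λ_mono _ _ (hs.trans hsr) hlt.le))
        _ ≤ B.μ (ball (c i) (r i)) + B.μ (ball (c i) τ \ ball (c i) (r i)) :=
            add_le_add ((ENNReal.ofReal_le_ofReal h3).trans h2) h1
        _ = B.μ (ball (c i) τ) := by
            rw [← measure_union disjoint_sdiff_right
              (measurableSet_ball.diff measurableSet_ball),
              Set.union_sdiff_cancel (ball_subset_ball hlt.le)]
  -- A ball stopped at the boundary of the domain does not count as nontrivial, by `nontriv_lt`; so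
  -- a ball still nontrivial after growing has reached the radius `t`.
  · have hN0 : B.nontriv (c i) (r i) := by
      by_contra hN0
      rw [show B.grown c r i t = r i by simp [grown, hN0]] at hN
      exact hN0 hN
    have h1 := B.nontriv_lt _ _ hN
    have h2 : min t (B.ρ - ‖c i‖) ≤ B.grown c r i t := by simp [grown, hN0]
    rcases min_choice t (B.ρ - ‖c i‖) with h3 | h3 <;> rw [h3] at h2
    · exact h2
    · linarith

/-- The balls grow until the final parameter or until the first contact, at which two of them merge
and the number of balls drops. -/
theorem HasFamily.step {s : ℝ} (hs : B.s₀ ≤ s) (hs1 : s ≤ B.s₁) {n : ℕ} (h : B.HasFamily s n) :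
    (∃ m, B.HasFamily B.s₁ m) ∨ ∃ t m, s ≤ t ∧ t ≤ B.s₁ ∧ m < n ∧ B.HasFamily t m := by
  classical
  obtain ⟨ι, _, c, r, rfl, hf, hd⟩ := h
  have hpos : ∀ i t, 0 < B.grown c r i t := fun i t => (hf.pos i).trans_le (le_grown c r i t)
  let T : Set ℝ := Icc s B.s₁ ∩
    ⋃ p : {p : ι × ι // p.1 ≠ p.2}, {t | dist (c p.1.1) (c p.1.2) ≤
      B.grown c r p.1.1 t + B.grown c r p.1.2 t}
  have hTc : IsCompact T := isCompact_Icc.inter_right (isClosed_iUnion_of_finite fun p =>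
    isClosed_le continuous_const ((continuous_grown c r _).add (continuous_grown c r _)))
  by_cases hT : T.Nonempty
  · obtain ⟨t, ht, hmin⟩ := hTc.exists_isLeast hT
    have hdisj : Pairwise fun i j => Disjoint (ball (c i) (B.grown c r i t))
        (ball (c j) (B.grown c r j t)) := by
      intro i j hij
      have hbefore : ∀ τ ∈ Ico s t, B.grown c r i τ + B.grown c r j τ < dist (c i) (c j) := by
        intro τ hτ
        by_contra hcon
        have : τ ∈ T := ⟨⟨hτ.1, hτ.2.le.trans ht.1.2⟩,
          mem_iUnion.2 ⟨⟨(i, j), hij⟩, not_lt.1 hcon⟩⟩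
        exact absurd (hmin this) (not_le.2 hτ.2)
      rw [disjoint_ball_ball_iff (hpos i t) (hpos j t)]
      rcases ht.1.1.eq_or_lt with heq | hlt
      · rw [← heq, hf.grown_self, hf.grown_self]
        have : Disjoint (closedBall (c i) (r i)) (closedBall (c j) (r j)) := hd hij
        rw [disjoint_closedBall_closedBall_iff (hf.pos i).le (hf.pos j).le] at this
        exact this.le
      -- Before the first contact the closed balls are disjoint; by continuity from the left the
      -- open ones still are at the contact.
      · have hten : Tendsto (fun τ => B.grown c r i τ + B.grown c r j τ) (𝓝[<] t)
            (𝓝 (B.grown c r i t + B.grown c r j t)) :=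
          (((continuous_grown c r i).add (continuous_grown c r j)).tendsto t).mono_left
            nhdsWithin_le_nhds
        refine le_of_tendsto hten ?_
        filter_upwards [Ico_mem_nhdsLT hlt] with τ hτ
        exact (hbefore τ hτ).le
    obtain ⟨m, -, hm, hfam⟩ := (hf.grow hs ht.1.1 ht.1.2 hdisj).exists_merge (hs.trans ht.1.1)
    right
    refine ⟨t, m, ht.1.1, ht.1.2, hm ?_, hfam⟩
    obtain ⟨⟨⟨i, j⟩, hij⟩, hp⟩ := mem_iUnion.1 ht.2
    refine ⟨i, j, hij, ?_⟩
    rw [disjoint_closedBall_closedBall_iff (hpos i t).le (hpos j t).le, not_lt]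
    exact hp
  · left
    have hdisj : Pairwise fun i j => Disjoint (ball (c i) (B.grown c r i B.s₁))
        (ball (c j) (B.grown c r j B.s₁)) := by
      intro i j hij
      rw [disjoint_ball_ball_iff (hpos _ _) (hpos _ _)]
      by_contra hcon
      exact hT ⟨B.s₁, ⟨hs1, le_rfl⟩, mem_iUnion.2 ⟨⟨(i, j), hij⟩, (not_le.1 hcon).le⟩⟩
    obtain ⟨m, -, -, hfam⟩ := (hf.grow hs hs1 le_rfl hdisj).exists_merge (hs.trans hs1)
    exact ⟨m, hfam⟩

theorem HasFamily.exists_final {s : ℝ} (hs : B.s₀ ≤ s) (hs1 : s ≤ B.s₁) {n : ℕ}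
    (h : B.HasFamily s n) : ∃ m, B.HasFamily B.s₁ m := by
  induction n using Nat.strong_induction_on generalizing s with
  | _ n ih =>
    rcases h.step hs hs1 with h | ⟨t, m, hst, ht, hm, hfam⟩
    · exact h
    · exact ih m hm (hs.trans hst) ht hfam

end BallGrowth

/-! ### Averages over squares -/

section Average

variable {V : Type*} [NormedAddCommGroup V] [NormedSpace ℝ V] [CompleteSpace V]

/-- Each point of the square is joined to `(a, b)` by a horizontal segment and a piece of the
vertical line through `a`. Averaging the horizontal part costs the energy of the square; the
vertical part costs the energy of that single line, which can be chosen well. -/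
theorem norm_average_sub_le {ε : ℝ} (hε : 0 < ε) {f f₁ f₂ : ℝ → ℝ → V}
    (hf : Continuous (Function.uncurry f)) (hf₁ : Continuous (Function.uncurry f₁))
    (hf₂ : Continuous (Function.uncurry f₂)) (h₁ : ∀ s t, HasDerivAt (fun s => f s t) (f₁ s t) s)
    (h₂ : ∀ s t, HasDerivAt (fun t => f s t) (f₂ s t) t) {a b : ℝ} (ha : a ∈ Icc (-ε) ε)
    (hb : b ∈ Icc (-ε) ε) :
    ‖(4 * ε ^ 2)⁻¹ • (∫ t in -ε..ε, ∫ s in -ε..ε, f s t) - f a b‖ ≤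
      √(2 * ε * ∫ t in -ε..ε, ‖f₂ a t‖ ^ 2) + √(∫ t in -ε..ε, ∫ s in -ε..ε, ‖f₁ s t‖ ^ 2) := by
  have hεε : -ε ≤ ε := by linarith
  set A := √(2 * ε * ∫ t in -ε..ε, ‖f₂ a t‖ ^ 2) with hA
  have hf1a : ∀ t, Continuous fun s => f₁ s t := fun t =>
    hf₁.comp (continuous_id.prodMk continuous_const)
  have hf2a : ∀ s, Continuous fun t => f₂ s t := fun s =>
    hf₂.comp (continuous_const.prodMk continuous_id)
  have hfa : ∀ t, Continuous fun s => f s t := fun t =>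
    hf.comp (continuous_id.prodMk continuous_const)
  -- the integral over a horizontal line
  let g : ℝ → ℝ := fun t => ∫ σ in -ε..ε, ‖f₁ σ t‖
  have hg : Continuous g := intervalIntegral.continuous_parametric_intervalIntegral_of_continuous'
    (hf₁.comp continuous_swap).norm _ _
  have hsub : ∀ {V : Type _} [NormedAddCommGroup V] [NormedSpace ℝ V] [CompleteSpace V]
      {u u' : ℝ → V}, (∀ t, HasDerivAt u (u' t) t) → Continuous u' →
      ∀ {x y : ℝ}, x ∈ Icc (-ε) ε → y ∈ Icc (-ε) ε → ‖u x - u y‖ ≤ ∫ t in -ε..ε, ‖u' t‖ := by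
    intro V _ _ _ u u' hu hu' x y hx hy
    have key : ∀ x y : ℝ, x ∈ Icc (-ε) ε → y ∈ Icc (-ε) ε → x ≤ y →
        ‖u y - u x‖ ≤ ∫ t in -ε..ε, ‖u' t‖ := fun x y hx hy hxy =>
      (norm_sub_le_integral hu hu' hxy).trans (intervalIntegral.integral_mono_interval hx.1 hxy
        hy.2 (Eventually.of_forall fun t => norm_nonneg _) (hu'.norm.intervalIntegrable _ _))
    rcases le_total x y with h | h
    · rw [norm_sub_rev]; exact key x y hx hy h
    · exact key y x hy hx h
  have hpt : ∀ s ∈ Icc (-ε) ε, ∀ t ∈ Icc (-ε) ε, ‖f s t - f a b‖ ≤ g t + A := by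
    intro s hs t ht
    have e1 : ‖f s t - f a t‖ ≤ g t := hsub (fun s => h₁ s t) (hf1a t) hs ha
    have e2 : ‖f a t - f a b‖ ≤ A := by
      refine (hsub (h₂ a) (hf2a a) ht hb).trans (Real.le_sqrt_of_sq_le ?_)
      refine (sq_integral_le (hf2a a).norm hεε).trans (le_of_eq ?_)
      ring
    calc ‖f s t - f a b‖ = ‖(f s t - f a t) + (f a t - f a b)‖ := by congr 1; abel
      _ ≤ _ := (norm_add_le _ _).trans (add_le_add e1 e2)
  have hF : Continuous fun t => ∫ s in -ε..ε, f s t :=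
    intervalIntegral.continuous_parametric_intervalIntegral_of_continuous'
      (f := fun t s => f s t) (hf.comp continuous_swap) _ _
  have hdiff : (4 * ε ^ 2)⁻¹ • (∫ t in -ε..ε, ∫ s in -ε..ε, f s t) - f a b =
      (4 * ε ^ 2)⁻¹ • ∫ t in -ε..ε, ∫ s in -ε..ε, (f s t - f a b) := by
    have e1 : ∀ t, ∫ s in -ε..ε, (f s t - f a b) = (∫ s in -ε..ε, f s t) - (2 * ε) • f a b := by
      intro t
      rw [intervalIntegral.integral_sub ((hfa t).intervalIntegrable _ _)
        (continuous_const.intervalIntegrable _ _), intervalIntegral.integral_const]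
      congr 2; ring
    simp only [e1]
    rw [intervalIntegral.integral_sub (hF.intervalIntegrable _ _)
      (continuous_const.intervalIntegrable _ _), intervalIntegral.integral_const, smul_sub,
      smul_smul, smul_smul]
    congr 1
    rw [show (4 * ε ^ 2)⁻¹ * (ε - -ε) * (2 * ε) = 1 by field_simp; ring, one_smul]
  have hinner : ∀ t ∈ Icc (-ε) ε, ‖∫ s in -ε..ε, (f s t - f a b)‖ ≤ 2 * ε * (g t + A) := by
    intro t ht
    have := intervalIntegral.norm_integral_le_of_norm_le_const (a := -ε) (b := ε)
      (f := fun s => f s t - f a b) (C := g t + A) fun s hs => by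
        rw [uIoc_of_le hεε] at hs
        exact hpt s ⟨hs.1.le, hs.2⟩ t ht
    refine this.trans (le_of_eq ?_)
    rw [abs_of_pos (by linarith)]; ring
  have houter : ‖∫ t in -ε..ε, ∫ s in -ε..ε, (f s t - f a b)‖ ≤
      2 * ε * (∫ t in -ε..ε, g t) + 4 * ε ^ 2 * A := by
    calc _ ≤ ∫ t in -ε..ε, 2 * ε * (g t + A) := by
          refine intervalIntegral.norm_integral_le_of_norm_le hεε
            (Eventually.of_forall fun t ht => hinner t ⟨ht.1.le, ht.2⟩)
            (Continuous.intervalIntegrable (by fun_prop) _ _)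
      _ = _ := by
          rw [intervalIntegral.integral_const_mul, intervalIntegral.integral_add
            (hg.intervalIntegrable _ _) (continuous_const.intervalIntegrable _ _),
            intervalIntegral.integral_const, smul_eq_mul]
          ring
  have hgsq : (∫ t in -ε..ε, g t) ≤ 2 * ε * √(∫ t in -ε..ε, ∫ s in -ε..ε, ‖f₁ s t‖ ^ 2) := by
    have hG : Continuous fun t => ∫ s in -ε..ε, ‖f₁ s t‖ ^ 2 :=
      intervalIntegral.continuous_parametric_intervalIntegral_of_continuous'
        ((hf₁.comp continuous_swap).norm.pow 2) _ _
    have e1 := sq_integral_le hg hεε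
    have e2 : ∫ t in -ε..ε, g t ^ 2 ≤ ∫ t in -ε..ε, 2 * ε * ∫ s in -ε..ε, ‖f₁ s t‖ ^ 2 := by
      refine intervalIntegral.integral_mono_on hεε ((hg.pow 2).intervalIntegrable _ _)
        ((continuous_const.mul hG).intervalIntegrable _ _) fun t _ => ?_
      refine (sq_integral_le (hf1a t).norm hεε).trans (le_of_eq ?_)
      ring
    rw [intervalIntegral.integral_const_mul] at e2
    have e3 : (∫ t in -ε..ε, g t) ^ 2 ≤
        (2 * ε) ^ 2 * ∫ t in -ε..ε, ∫ s in -ε..ε, ‖f₁ s t‖ ^ 2 := by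
      nlinarith
    calc _ ≤ √((2 * ε) ^ 2 * ∫ t in -ε..ε, ∫ s in -ε..ε, ‖f₁ s t‖ ^ 2) := Real.le_sqrt_of_sq_le e3
      _ = _ := by rw [Real.sqrt_mul (by positivity), Real.sqrt_sq (by positivity)]
  rw [hdiff, norm_smul, norm_inv, Real.norm_eq_abs, abs_of_pos (by positivity),
    inv_mul_le_iff₀ (by positivity)]
  nlinarith

theorem norm_average_sub_le_of_density {ε : ℝ} (hε : 0 < ε) {f f₁ f₂ : ℝ → ℝ → V}
    {e : ℝ → ℝ → ℝ} (he : Continuous (Function.uncurry e))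
    (hf : Continuous (Function.uncurry f)) (hf₁ : Continuous (Function.uncurry f₁))
    (hf₂ : Continuous (Function.uncurry f₂)) (h₁ : ∀ s t, HasDerivAt (fun s => f s t) (f₁ s t) s)
    (h₂ : ∀ s t, HasDerivAt (fun t => f s t) (f₂ s t) t) (h₁e : ∀ s t, ‖f₁ s t‖ ^ 2 ≤ 2 * e s t)
    (h₂e : ∀ s t, ‖f₂ s t‖ ^ 2 ≤ 2 * e s t) {a b K : ℝ} (ha : a ∈ Icc (-ε) ε)
    (hb : b ∈ Icc (-ε) ε) (hK : ε * ∫ t in -ε..ε, e a t ≤ K) :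
    ‖(4 * ε ^ 2)⁻¹ • (∫ t in -ε..ε, ∫ s in -ε..ε, f s t) - f a b‖ ≤
      √(4 * K) + √(2 * ∫ t in -ε..ε, ∫ s in -ε..ε, e s t) := by
  have hεε : -ε ≤ ε := by linarith
  have he1 : ∀ t, Continuous fun s => e s t := fun t =>
    he.comp (continuous_id.prodMk continuous_const)
  have he2 : ∀ s, Continuous fun t => e s t := fun s =>
    he.comp (continuous_const.prodMk continuous_id)
  have hf1a : ∀ t, Continuous fun s => f₁ s t := fun t =>
    hf₁.comp (continuous_id.prodMk continuous_const)
  have hf2a : ∀ s, Continuous fun t => f₂ s t := fun s =>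
    hf₂.comp (continuous_const.prodMk continuous_id)
  refine (norm_average_sub_le hε hf hf₁ hf₂ h₁ h₂ ha hb).trans
    (add_le_add (Real.sqrt_le_sqrt ?_) (Real.sqrt_le_sqrt ?_))
  · have e1 : ∫ t in -ε..ε, ‖f₂ a t‖ ^ 2 ≤ ∫ t in -ε..ε, 2 * e a t :=
      intervalIntegral.integral_mono_on hεε (((hf2a a).norm.pow 2).intervalIntegrable _ _)
        ((continuous_const.mul (he2 a)).intervalIntegrable _ _) fun t _ => h₂e a t
    rw [intervalIntegral.integral_const_mul] at e1
    nlinarith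
  · have c1 : Continuous fun t => ∫ s in -ε..ε, ‖f₁ s t‖ ^ 2 :=
      intervalIntegral.continuous_parametric_intervalIntegral_of_continuous'
        ((hf₁.comp continuous_swap).norm.pow 2) _ _
    have c2 : Continuous fun t => ∫ s in -ε..ε, e s t :=
      intervalIntegral.continuous_parametric_intervalIntegral_of_continuous'
        (f := fun t s => e s t) (he.comp continuous_swap) _ _
    rw [← intervalIntegral.integral_const_mul]
    refine intervalIntegral.integral_mono_on hεε (c1.intervalIntegrable _ _)
      ((continuous_const.mul c2).intervalIntegrable _ _) fun t _ => ?_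
    rw [← intervalIntegral.integral_const_mul]
    exact intervalIntegral.integral_mono_on hεε (((hf1a t).norm.pow 2).intervalIntegrable _ _)
      ((continuous_const.mul (he1 t)).intervalIntegrable _ _) fun s _ => h₁e s t

end Average

theorem exists_mul_le_integral {g : ℝ → ℝ} (hg : Continuous g) (hg0 : ∀ t, 0 ≤ g t) {a b α β : ℝ}
    (ha : a ≤ α) (hαβ : α ≤ β) (hb : β ≤ b) :
    ∃ t ∈ Icc α β, (β - α) * g t ≤ ∫ s in a..b, g s := by
  obtain ⟨t, ht, hmin⟩ := isCompact_Icc.exists_isMinOn ⟨α, le_rfl, hαβ⟩ hg.continuousOn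
  refine ⟨t, ht, ?_⟩
  calc (β - α) * g t = ∫ s in α..β, g t := by rw [intervalIntegral.integral_const, smul_eq_mul]
    _ ≤ ∫ s in α..β, g s := intervalIntegral.integral_mono_on hαβ
        (continuous_const.intervalIntegrable _ _) (hg.intervalIntegrable _ _) fun s hs => hmin hs
    _ ≤ _ := intervalIntegral.integral_mono_interval ha hαβ hb (Eventually.of_forall hg0)
        (hg.intervalIntegrable _ _)

/-- The square integrals of a continuous function can be computed in either order. -/
theorem square_integral_swap {V : Type*} [NormedAddCommGroup V] [NormedSpace ℝ V]
    {f : ℝ → ℝ → V} (hf : Continuous (Function.uncurry f)) (a b : ℝ) :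
    ∫ s in a..b, ∫ t in a..b, f s t = ∫ t in a..b, ∫ s in a..b, f s t := by
  apply intervalIntegral_intervalIntegral_swap
  exact (hf.continuousOn.integrableOn_compact (isCompact_uIcc.prod isCompact_uIcc)).mono_set
    (prod_mono uIoc_subset_uIcc uIoc_subset_uIcc)

namespace GapField

variable {V F : Type*} [NormedAddCommGroup V] [NormedSpace ℝ V]
  [NormedAddCommGroup F] [InnerProductSpace ℝ F] (G : GapField V F)

/-- The energy density of a map of class `C¹` on the complex plane. -/
def density (c₀ ε : ℝ) (Q : ℂ → V) (z : ℂ) : ℝ :=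
  (‖fderiv ℝ Q z 1‖ ^ 2 + ‖fderiv ℝ Q z Complex.I‖ ^ 2) / 2 + c₀ / ε ^ 2 * pen (G.gap (Q z))

/-- The energy on the square with centre `p` and half-width `ε`. -/
def squareEnergy (c₀ ε : ℝ) (Q : ℂ → V) (p : ℂ) : ℝ :=
  ∫ s in -ε..ε, ∫ t in -ε..ε, G.density c₀ ε Q (p + (s + t * Complex.I))

/-- The energy on a circle. -/
def circleEnergy (c₀ ε : ℝ) (Q : ℂ → V) (x : ℂ) (τ : ℝ) : ℝ :=
  ∫ θ in (0 : ℝ)..2 * Real.pi, G.density c₀ ε Q (circleMap x τ θ) * τ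

/-- The average on the square with centre `p` and half-width `ε`. -/
def squareAverage (ε : ℝ) (Q : ℂ → V) (p : ℂ) : V :=
  (4 * ε ^ 2)⁻¹ • ∫ t in -ε..ε, ∫ s in -ε..ε, Q (p + (s + t * Complex.I))

variable {G} {c₀ ε : ℝ} {Q : ℂ → V}

theorem continuous_fderiv_apply (hQ : ContDiff ℝ 1 Q) (w : ℂ) :
    Continuous fun z => fderiv ℝ Q z w :=
  (hQ.continuous_fderiv one_ne_zero).clm_apply continuous_const

theorem continuous_density (hQ : ContDiff ℝ 1 Q) : Continuous (G.density c₀ ε Q) := by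
  unfold density
  have h1 := continuous_fderiv_apply hQ 1
  have h2 := continuous_fderiv_apply hQ Complex.I
  have h3 := continuous_pen.comp (G.continuous_gap.comp hQ.continuous)
  exact (((h1.norm.pow 2).add (h2.norm.pow 2)).div_const 2).add (continuous_const.mul h3)

theorem density_nonneg (hc₀ : 0 < c₀) (z : ℂ) : 0 ≤ G.density c₀ ε Q z := by
  unfold density
  have := pen_nonneg (G.gap (Q z))
  positivity

theorem continuous_squareAverage (hQ : ContDiff ℝ 1 Q) : Continuous (squareAverage ε Q) := by
  unfold squareAverage
  refine continuous_const.smul ?_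
  refine intervalIntegral.continuous_parametric_intervalIntegral_of_continuous' ?_ _ _
  refine intervalIntegral.continuous_parametric_intervalIntegral_of_continuous'
    (f := fun (p : ℂ × ℝ) (s : ℝ) => Q (p.1 + (s + p.2 * Complex.I))) ?_ _ _
  exact hQ.continuous.comp (by fun_prop)

theorem norm_fderiv_one_sq_le (hc₀ : 0 < c₀) (z : ℂ) :
    ‖fderiv ℝ Q z 1‖ ^ 2 ≤ 2 * G.density c₀ ε Q z := by
  have := pen_nonneg (G.gap (Q z))
  have h0 : 0 ≤ c₀ / ε ^ 2 * pen (G.gap (Q z)) := by positivity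
  unfold density
  linarith [sq_nonneg ‖fderiv ℝ Q z Complex.I‖]

theorem norm_fderiv_I_sq_le (hc₀ : 0 < c₀) (z : ℂ) :
    ‖fderiv ℝ Q z Complex.I‖ ^ 2 ≤ 2 * G.density c₀ ε Q z := by
  have := pen_nonneg (G.gap (Q z))
  have h0 : 0 ≤ c₀ / ε ^ 2 * pen (G.gap (Q z)) := by positivity
  unfold density
  linarith [sq_nonneg ‖fderiv ℝ Q z 1‖]

theorem pen_le_density (z : ℂ) : c₀ / ε ^ 2 * pen (G.gap (Q z)) ≤ G.density c₀ ε Q z := by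
  unfold density
  linarith [sq_nonneg ‖fderiv ℝ Q z 1‖, sq_nonneg ‖fderiv ℝ Q z Complex.I‖]

theorem hasDerivAt_re (hQ : ContDiff ℝ 1 Q) (p : ℂ) (s t : ℝ) :
    HasDerivAt (fun s : ℝ => Q (p + (s + t * Complex.I)))
      (fderiv ℝ Q (p + (s + t * Complex.I)) 1) s := by
  have h1 : HasDerivAt (fun s : ℝ => p + (s + t * Complex.I)) 1 s := by
    have := ((Complex.ofRealCLM.hasDerivAt (x := s)).add_const (t * Complex.I)).const_add p
    simpa using this
  exact (hQ.differentiable one_ne_zero _).hasFDerivAt.comp_hasDerivAt s h1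

theorem hasDerivAt_im (hQ : ContDiff ℝ 1 Q) (p : ℂ) (s t : ℝ) :
    HasDerivAt (fun t : ℝ => Q (p + (s + t * Complex.I)))
      (fderiv ℝ Q (p + (s + t * Complex.I)) Complex.I) t := by
  have h1 : HasDerivAt (fun t : ℝ => p + (s + t * Complex.I)) Complex.I t := by
    have := (((Complex.ofRealCLM.hasDerivAt (x := t)).mul_const Complex.I).const_add
      (s : ℂ)).const_add p
    simpa using this
  exact (hQ.differentiable one_ne_zero _).hasFDerivAt.comp_hasDerivAt t h1

variable [CompleteSpace V]

theorem norm_squareAverage_sub_le_vertical (hε : 0 < ε) (hc₀ : 0 < c₀) (hQ : ContDiff ℝ 1 Q)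
    {p : ℂ} {a b K : ℝ} (ha : a ∈ Icc (-ε) ε) (hb : b ∈ Icc (-ε) ε)
    (hK : ε * ∫ t in -ε..ε, G.density c₀ ε Q (p + (a + t * Complex.I)) ≤ K) :
    ‖squareAverage ε Q p - Q (p + (a + b * Complex.I))‖ ≤
      √(4 * K) + √(2 * G.squareEnergy c₀ ε Q p) := by
  have hdc : Continuous (Function.uncurry fun s t : ℝ =>
      G.density c₀ ε Q (p + (s + t * Complex.I))) := (continuous_density hQ).comp (by fun_prop)
  have hQc : Continuous (Function.uncurry fun s t : ℝ => Q (p + (s + t * Complex.I))) :=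
    hQ.continuous.comp (by fun_prop)
  have hD : ∀ w : ℂ, Continuous (Function.uncurry fun s t : ℝ =>
      fderiv ℝ Q (p + (s + t * Complex.I)) w) := fun w =>
    (continuous_fderiv_apply hQ w).comp (by fun_prop)
  unfold squareEnergy
  rw [square_integral_swap hdc]
  exact norm_average_sub_le_of_density hε hdc hQc (hD 1) (hD Complex.I)
    (hasDerivAt_re hQ p) (hasDerivAt_im hQ p) (fun _ _ => norm_fderiv_one_sq_le hc₀ _)
    (fun _ _ => norm_fderiv_I_sq_le hc₀ _) ha hb hK

theorem norm_squareAverage_sub_le_horizontal (hε : 0 < ε) (hc₀ : 0 < c₀) (hQ : ContDiff ℝ 1 Q)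
    {p : ℂ} {a b K : ℝ} (ha : a ∈ Icc (-ε) ε) (hb : b ∈ Icc (-ε) ε)
    (hK : ε * ∫ s in -ε..ε, G.density c₀ ε Q (p + (s + b * Complex.I)) ≤ K) :
    ‖squareAverage ε Q p - Q (p + (a + b * Complex.I))‖ ≤
      √(4 * K) + √(2 * G.squareEnergy c₀ ε Q p) := by
  have hQc : Continuous (Function.uncurry fun t s : ℝ => Q (p + (s + t * Complex.I))) :=
    hQ.continuous.comp (by fun_prop)
  have hdc : Continuous (Function.uncurry fun t s : ℝ =>
      G.density c₀ ε Q (p + (s + t * Complex.I))) := (continuous_density hQ).comp (by fun_prop)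
  have hD : ∀ w : ℂ, Continuous (Function.uncurry fun t s : ℝ =>
      fderiv ℝ Q (p + (s + t * Complex.I)) w) := fun w =>
    (continuous_fderiv_apply hQ w).comp (by fun_prop)
  unfold squareEnergy squareAverage
  rw [square_integral_swap hQc]
  exact norm_average_sub_le_of_density hε hdc hQc (hD Complex.I) (hD 1)
    (fun t s => hasDerivAt_im hQ p s t) (fun t s => hasDerivAt_re hQ p s t)
    (fun _ _ => norm_fderiv_I_sq_le hc₀ _) (fun _ _ => norm_fderiv_one_sq_le hc₀ _) hb ha hK

end GapField

/-! ### Comparison of a map with its square averages along circles. -/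

namespace GapField

variable {V F : Type*} [NormedAddCommGroup V] [NormedSpace ℝ V]
  [NormedAddCommGroup F] [InnerProductSpace ℝ F] {G : GapField V F} {c₀ ε : ℝ} {Q : ℂ → V}

theorem squareEnergy_nonneg (hε : 0 < ε) (hc₀ : 0 < c₀) (p : ℂ) :
    0 ≤ G.squareEnergy c₀ ε Q p :=
  intervalIntegral.integral_nonneg (by linarith) fun _ _ =>
    intervalIntegral.integral_nonneg (by linarith) fun _ _ => density_nonneg hc₀ _

/-- The derivative of `Q` along a circle. -/
def circleDeriv (Q : ℂ → V) (x : ℂ) (τ θ : ℝ) : V :=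
  fderiv ℝ Q (circleMap x τ θ) (circleMap 0 τ θ * Complex.I)

theorem hasDerivAt_circle (hQ : ContDiff ℝ 1 Q) (x : ℂ) (τ θ : ℝ) :
    HasDerivAt (fun θ => Q (circleMap x τ θ)) (circleDeriv Q x τ θ) θ :=
  (hQ.differentiable one_ne_zero _).hasFDerivAt.comp_hasDerivAt θ (hasDerivAt_circleMap x τ θ)

theorem continuous_circleDeriv (hQ : ContDiff ℝ 1 Q) (x : ℂ) (τ : ℝ) :
    Continuous (circleDeriv Q x τ) :=
  ((hQ.continuous_fderiv one_ne_zero).comp (continuous_circleMap x τ)).clm_apply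
    ((continuous_circleMap 0 τ).mul continuous_const)

theorem norm_circleDeriv_sq_le {τ : ℝ} (hτ : 0 < τ) (x : ℂ) (θ : ℝ) :
    ‖circleDeriv Q x τ θ‖ ^ 2 ≤ τ ^ 2 * (‖fderiv ℝ Q (circleMap x τ θ) 1‖ ^ 2 +
      ‖fderiv ℝ Q (circleMap x τ θ) Complex.I‖ ^ 2) := by
  have h1 : circleMap 0 τ θ * Complex.I =
      (-(τ * Real.sin θ)) • (1 : ℂ) + (τ * Real.cos θ) • Complex.I := by
    rw [circleMap, Complex.exp_mul_I]
    apply Complex.ext <;> simp [Complex.cos_ofReal_re, Complex.sin_ofReal_re]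
  unfold circleDeriv
  rw [h1, map_add, map_smul, map_smul]
  set X := fderiv ℝ Q (circleMap x τ θ) 1
  set Y := fderiv ℝ Q (circleMap x τ θ) Complex.I
  have h2 : ‖(-(τ * Real.sin θ)) • X + (τ * Real.cos θ) • Y‖ ≤
      τ * (|Real.sin θ| * ‖X‖ + |Real.cos θ| * ‖Y‖) := by
    refine (norm_add_le _ _).trans (le_of_eq ?_)
    rw [norm_smul, norm_smul, norm_neg, norm_mul, norm_mul, Real.norm_eq_abs, Real.norm_eq_abs,
      Real.norm_eq_abs, abs_of_pos hτ]
    ring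
  refine (pow_le_pow_left₀ (norm_nonneg _) h2 2).trans ?_
  rw [mul_pow]
  gcongr
  have h3 := Real.sin_sq_add_cos_sq θ
  rw [← sq_abs, ← sq_abs (Real.cos θ)] at h3
  have h4 : (|Real.sin θ| * ‖X‖ + |Real.cos θ| * ‖Y‖) ^ 2 =
      (|Real.sin θ| ^ 2 + |Real.cos θ| ^ 2) * (‖X‖ ^ 2 + ‖Y‖ ^ 2) -
        (|Real.sin θ| * ‖Y‖ - |Real.cos θ| * ‖X‖) ^ 2 := by ring
  rw [h4, h3]
  linarith [sq_nonneg (|Real.sin θ| * ‖Y‖ - |Real.cos θ| * ‖X‖)]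

theorem norm_circleDeriv_sq_le_density {τ : ℝ} (hτ : 0 < τ) (hc₀ : 0 < c₀) (x : ℂ) (θ : ℝ) :
    ‖circleDeriv Q x τ θ‖ ^ 2 ≤ 2 * τ ^ 2 * G.density c₀ ε Q (circleMap x τ θ) := by
  refine (norm_circleDeriv_sq_le hτ x θ).trans ?_
  have := pen_nonneg (G.gap (Q (circleMap x τ θ)))
  have h0 : 0 ≤ c₀ / ε ^ 2 * pen (G.gap (Q (circleMap x τ θ))) := by positivity
  rw [mul_comm 2, mul_assoc]
  unfold density
  gcongr
  linarith

theorem exists_vertical_le (hε : 0 < ε) (hc₀ : 0 < c₀) (hQ : ContDiff ℝ 1 Q) (p : ℂ) {α β : ℝ}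
    (hα : -ε ≤ α) (hαβ : α ≤ β) (hβ : β ≤ ε) :
    ∃ a ∈ Icc α β, (β - α) * ∫ t in -ε..ε, G.density c₀ ε Q (p + (a + t * Complex.I)) ≤
      G.squareEnergy c₀ ε Q p := by
  have hdc : Continuous (Function.uncurry fun s t : ℝ =>
      G.density c₀ ε Q (p + (s + t * Complex.I))) := (continuous_density hQ).comp (by fun_prop)
  have hg := intervalIntegral.continuous_parametric_intervalIntegral_of_continuous'
      (μ := volume) hdc (-ε) ε
  exact exists_mul_le_integral
    (g := fun s : ℝ => ∫ t in -ε..ε, G.density c₀ ε Q (p + (s + t * Complex.I))) hg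
    (fun s => intervalIntegral.integral_nonneg (by linarith) fun _ _ => density_nonneg hc₀ _)
    hα hαβ hβ

theorem exists_horizontal_le (hε : 0 < ε) (hc₀ : 0 < c₀) (hQ : ContDiff ℝ 1 Q) (p : ℂ) {α β : ℝ}
    (hα : -ε ≤ α) (hαβ : α ≤ β) (hβ : β ≤ ε) :
    ∃ b ∈ Icc α β, (β - α) * ∫ s in -ε..ε, G.density c₀ ε Q (p + (s + b * Complex.I)) ≤
      G.squareEnergy c₀ ε Q p := by
  have hdc : Continuous (Function.uncurry fun s t : ℝ =>
      G.density c₀ ε Q (p + (s + t * Complex.I))) := (continuous_density hQ).comp (by fun_prop)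
  have hdc' : Continuous (Function.uncurry fun t s : ℝ =>
      G.density c₀ ε Q (p + (s + t * Complex.I))) := (continuous_density hQ).comp (by fun_prop)
  have hg := intervalIntegral.continuous_parametric_intervalIntegral_of_continuous'
      (μ := volume) hdc' (-ε) ε
  obtain ⟨b, hb, h⟩ := exists_mul_le_integral
    (g := fun t : ℝ => ∫ s in -ε..ε, G.density c₀ ε Q (p + (s + t * Complex.I))) hg
    (fun s => intervalIntegral.integral_nonneg (by linarith) fun _ _ => density_nonneg hc₀ _)
    hα hαβ hβ
  refine ⟨b, hb, h.trans (le_of_eq ?_)⟩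
  unfold squareEnergy
  exact (square_integral_swap hdc _ _).symm

theorem line_integral_nonneg (hε : 0 < ε) (hc₀ : 0 < c₀) (f : ℝ → ℂ) :
    0 ≤ ∫ t in -ε..ε, G.density c₀ ε Q (f t) :=
  intervalIntegral.integral_nonneg (by linarith) fun _ _ => density_nonneg hc₀ _

theorem sqrt_four_mul (x : ℝ) : √(4 * x) = 2 * √x := by
  rw [Real.sqrt_mul (by norm_num), show (4 : ℝ) = 2 ^ 2 by norm_num, Real.sqrt_sq (by norm_num)]

theorem sqrt_two_mul_le {x : ℝ} (hx : 0 ≤ x) : √(2 * x) ≤ 2 * √x := by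
  rw [← sqrt_four_mul]
  exact Real.sqrt_le_sqrt (by linarith)

variable [CompleteSpace V]

/-- The oscillation along an arc of length at most `ε`. -/
theorem norm_sub_le_circleEnergy (hε : 0 < ε) (hc₀ : 0 < c₀) (hQ : ContDiff ℝ 1 Q)
    {x : ℂ} {τ : ℝ} (hτ : ε ≤ τ) {θ₀ θ : ℝ} (hθ : θ ∈ Icc θ₀ (θ₀ + ε / τ)) :
    ‖Q (circleMap x τ θ) - Q (circleMap x τ θ₀)‖ ≤ √(2 * ε * G.circleEnergy c₀ ε Q x τ) := by
  have hτ0 : 0 < τ := hε.trans_le hτ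
  have hπ := Real.pi_gt_three
  have hΔ1 : ε / τ ≤ 1 := (div_le_one hτ0).2 hτ
  have hu := hasDerivAt_circle hQ x τ
  have hu' := continuous_circleDeriv hQ x τ
  have hdens : Continuous fun θ => G.density c₀ ε Q (circleMap x τ θ) * τ :=
    ((continuous_density hQ).comp (continuous_circleMap x τ)).mul continuous_const
  apply Real.le_sqrt_of_sq_le
  refine (sq_norm_sub_le_integral hu hu' hθ.1).trans ?_
  have hper : ∫ θ in θ₀..θ₀ + 2 * Real.pi, G.density c₀ ε Q (circleMap x τ θ) * τ =
      G.circleEnergy c₀ ε Q x τ := by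
    have : Function.Periodic (fun θ => G.density c₀ ε Q (circleMap x τ θ) * τ)
        (2 * Real.pi) := fun θ => by
      simp only [periodic_circleMap x τ θ]
    have h := this.intervalIntegral_add_eq θ₀ 0
    rw [zero_add] at h
    exact h
  have h1 : ∫ t in θ₀..θ, ‖circleDeriv Q x τ t‖ ^ 2 ≤ 2 * τ * G.circleEnergy c₀ ε Q x τ := by
    rw [← hper, ← intervalIntegral.integral_const_mul]
    calc ∫ t in θ₀..θ, ‖circleDeriv Q x τ t‖ ^ 2
        ≤ ∫ t in θ₀..θ₀ + 2 * Real.pi, ‖circleDeriv Q x τ t‖ ^ 2 :=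
          intervalIntegral.integral_mono_interval le_rfl hθ.1 (by linarith [hθ.2])
            (Eventually.of_forall fun _ => sq_nonneg _)
            ((hu'.norm.pow 2).intervalIntegrable _ _)
      _ ≤ _ := by
          refine intervalIntegral.integral_mono_on (by linarith)
            ((hu'.norm.pow 2).intervalIntegrable _ _)
            ((continuous_const.mul hdens).intervalIntegrable _ _) fun t _ => ?_
          refine (norm_circleDeriv_sq_le_density (G := G) (ε := ε) hτ0 hc₀ x t).trans
            (le_of_eq ?_)
          ring
  have hE0 : 0 ≤ ∫ t in θ₀..θ, ‖circleDeriv Q x τ t‖ ^ 2 :=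
    intervalIntegral.integral_nonneg hθ.1 fun _ _ => sq_nonneg _
  calc _ ≤ ε / τ * (2 * τ * G.circleEnergy c₀ ε Q x τ) :=
        mul_le_mul (by linarith [hθ.2]) h1 hE0 (by positivity)
    _ = _ := by field_simp

theorem circleMap_sub_circleMap (x : ℂ) (τ θ δ : ℝ) :
    ‖circleMap x τ (θ + δ) - circleMap x τ θ‖ = |τ| * ‖Complex.exp (Complex.I * δ) - 1‖ := by
  have : circleMap x τ (θ + δ) - circleMap x τ θ =
      τ * Complex.exp (θ * Complex.I) * (Complex.exp (Complex.I * δ) - 1) := by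
    simp only [circleMap]
    push_cast
    rw [add_mul, Complex.exp_add]
    ring_nf
  rw [this, norm_mul, norm_mul, Complex.norm_exp_ofReal_mul_I, Complex.norm_real,
    Real.norm_eq_abs, mul_one]

theorem norm_circleMap_sub_le (hε : 0 < ε) {x : ℂ} {τ : ℝ} (hτ : ε ≤ τ) {θ₀ θ : ℝ}
    (hθ : θ ∈ Icc θ₀ (θ₀ + ε / τ)) : ‖circleMap x τ θ - circleMap x τ θ₀‖ ≤ ε := by
  have hτ0 : 0 < τ := hε.trans_le hτ
  have h1 := circleMap_sub_circleMap x τ θ₀ (θ - θ₀)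
  rw [add_sub_cancel, abs_of_pos hτ0] at h1
  rw [h1]
  calc τ * _ ≤ τ * ‖θ - θ₀‖ := by gcongr; exact Real.norm_exp_I_mul_ofReal_sub_one_le
    _ ≤ τ * (ε / τ) := by
        gcongr
        rw [Real.norm_eq_abs, abs_of_nonneg (by linarith [hθ.1])]; linarith [hθ.2]
    _ = ε := by field_simp

/-- Jordan's inequality for the sine: an arc of length `ε` on a circle of radius at least `ε` has a
chord of length at least `ε / 2`. -/
theorem le_norm_circleMap_sub (hε : 0 < ε) {x : ℂ} {τ : ℝ} (hτ : ε ≤ τ) (θ₀ : ℝ) :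
    ε / 2 ≤ ‖circleMap x τ (θ₀ + ε / τ) - circleMap x τ θ₀‖ := by
  have hτ0 : 0 < τ := hε.trans_le hτ
  have hπ := Real.pi_gt_three
  have hΔ1 : ε / τ ≤ 1 := (div_le_one hτ0).2 hτ
  have hΔ0 : 0 < ε / τ := by positivity
  rw [circleMap_sub_circleMap, abs_of_pos hτ0, Complex.norm_exp_I_mul_ofReal_sub_one,
    Real.norm_eq_abs]
  have h1 := Real.mul_le_sin (x := ε / τ / 2) (by positivity) (by linarith)
  have h2 : ε / τ / 2 ≤ 2 * Real.sin (ε / τ / 2) := by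
    have h3 : 2 / Real.pi ≥ 1 / 2 := by
      rw [ge_iff_le, div_le_div_iff₀ (by norm_num) Real.pi_pos]; linarith [Real.pi_le_four]
    nlinarith
  rw [abs_of_nonneg (by linarith)]
  calc ε / 2 = τ * (ε / τ / 2) := by field_simp
    _ ≤ _ := by gcongr

/-- A line of controlled energy in the square centred at the circle meets the next arc. -/
theorem exists_norm_squareAverage_sub_le (hε : 0 < ε) (hc₀ : 0 < c₀) (hQ : ContDiff ℝ 1 Q)
    {x : ℂ} {τ : ℝ} (hτ : ε ≤ τ) (θ₀ : ℝ) : ∃ θ ∈ Icc θ₀ (θ₀ + ε / τ),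
      ‖squareAverage ε Q (circleMap x τ θ₀) - Q (circleMap x τ θ)‖ ≤
        6 * √(G.squareEnergy c₀ ε Q (circleMap x τ θ₀)) := by
  have hτ0 : 0 < τ := hε.trans_le hτ
  have hΔ0 : 0 < ε / τ := by positivity
  have hwle : ∀ θ ∈ Icc θ₀ (θ₀ + ε / τ), ‖circleMap x τ θ - circleMap x τ θ₀‖ ≤ ε :=
    fun θ hθ => norm_circleMap_sub_le hε hτ hθ
  have hend := le_norm_circleMap_sub hε (x := x) hτ θ₀
  obtain ⟨p, hp⟩ : ∃ p, p = circleMap x τ θ₀ := ⟨_, rfl⟩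
  obtain ⟨w, hwdef⟩ : ∃ w : ℝ → ℂ, w = fun θ => circleMap x τ θ - p := ⟨_, rfl⟩
  obtain ⟨I, hI⟩ : ∃ I, I = G.squareEnergy c₀ ε Q p := ⟨_, rfl⟩
  have hI0 : 0 ≤ I := hI ▸ squareEnergy_nonneg hε hc₀ p
  have hw : Continuous w := hwdef ▸ (continuous_circleMap x τ).sub continuous_const
  have hw0 : w θ₀ = 0 := by rw [hwdef, hp]; exact sub_self _
  have hcoord : ∀ θ, circleMap x τ θ = p + ((w θ).re + (w θ).im * Complex.I) := by
    intro θ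
    rw [Complex.re_add_im]; simp [hwdef]
  replace hwle : ∀ θ ∈ Icc θ₀ (θ₀ + ε / τ), ‖w θ‖ ≤ ε := by
    rw [hwdef, hp]; exact hwle
  replace hend : ε / 2 ≤ ‖w (θ₀ + ε / τ)‖ := by rw [hwdef, hp]; exact hend
  have hmemI : ∀ θ ∈ Icc θ₀ (θ₀ + ε / τ), (w θ).re ∈ Icc (-ε) ε ∧ (w θ).im ∈ Icc (-ε) ε :=
    fun θ hθ => ⟨abs_le.1 ((Complex.abs_re_le_norm _).trans (hwle θ hθ)),
      abs_le.1 ((Complex.abs_im_le_norm _).trans (hwle θ hθ))⟩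
  have huIcc : uIcc θ₀ (θ₀ + ε / τ) = Icc θ₀ (θ₀ + ε / τ) := uIcc_of_le (by linarith)
  have hendmem : θ₀ + ε / τ ∈ Icc θ₀ (θ₀ + ε / τ) := ⟨by linarith, le_rfl⟩
  have hzero : (0 : ℝ) ∈ Icc (-ε) ε := ⟨by linarith, hε.le⟩
  have hsq : √(4 * (4 * I)) + √(2 * I) ≤ 6 * √I := by
    rw [sqrt_four_mul, sqrt_four_mul]
    linarith [sqrt_two_mul_le hI0]
  have hlen : ∀ y : ℝ, ε / 4 ≤ |y| → ∀ m, (max 0 y - min 0 y) * m ≤ I → 0 ≤ m →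
      ε * m ≤ 4 * I := by
    intro y hy m hm hm0
    rw [max_sub_min_eq_abs', zero_sub, abs_neg] at hm
    nlinarith
  have hsum := Complex.norm_le_abs_re_add_abs_im (w (θ₀ + ε / τ))
  rw [← hp, ← hI]
  -- The chord of the arc has length at least `ε / 2`, so one coordinate moves by at least `ε / 4`.
  -- Among the lines with that coordinate in the range swept, one has energy at most `4 I / ε`, and
  -- the arc meets it by the intermediate value theorem.
  rcases le_total (ε / 4) |(w (θ₀ + ε / τ)).re| with hre | hre
  · obtain ⟨hm1, -⟩ := hmemI _ hendmem
    obtain ⟨a, ha, hga⟩ := exists_vertical_le (G := G) hε hc₀ hQ p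
      (α := min 0 (w (θ₀ + ε / τ)).re) (β := max 0 (w (θ₀ + ε / τ)).re)
      (le_min hzero.1 hm1.1) min_le_max (max_le hzero.2 hm1.2)
    have hK := hlen _ hre _ (hga.trans_eq hI.symm) (line_integral_nonneg hε hc₀ _)
    obtain ⟨θ, hθ, hθa⟩ := intermediate_value_uIcc (f := fun θ => (w θ).re) (a := θ₀)
      (b := θ₀ + ε / τ) (Complex.continuous_re.comp hw).continuousOn
      (show a ∈ uIcc (w θ₀).re (w (θ₀ + ε / τ)).re by rw [hw0]; exact ha)
    rw [huIcc] at hθ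
    refine ⟨θ, hθ, ?_⟩
    obtain ⟨h1, h2⟩ := hmemI θ hθ
    simp only at hθa
    rw [hcoord, hθa]
    rw [hθa] at h1
    have := norm_squareAverage_sub_le_vertical hε hc₀ hQ h1 h2 hK
    rw [← hI] at this
    exact this.trans hsq
  · have him : ε / 4 ≤ |(w (θ₀ + ε / τ)).im| := by linarith
    obtain ⟨-, hm1⟩ := hmemI _ hendmem
    obtain ⟨b, hb, hgb⟩ := exists_horizontal_le (G := G) hε hc₀ hQ p
      (α := min 0 (w (θ₀ + ε / τ)).im) (β := max 0 (w (θ₀ + ε / τ)).im)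
      (le_min hzero.1 hm1.1) min_le_max (max_le hzero.2 hm1.2)
    have hK := hlen _ him _ (hgb.trans_eq hI.symm) (line_integral_nonneg hε hc₀ _)
    obtain ⟨θ, hθ, hθb⟩ := intermediate_value_uIcc (f := fun θ => (w θ).im) (a := θ₀)
      (b := θ₀ + ε / τ) (Complex.continuous_im.comp hw).continuousOn
      (show b ∈ uIcc (w θ₀).im (w (θ₀ + ε / τ)).im by rw [hw0]; exact hb)
    rw [huIcc] at hθ
    refine ⟨θ, hθ, ?_⟩
    obtain ⟨h1, h2⟩ := hmemI θ hθ
    simp only at hθb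
    rw [hcoord, hθb]
    rw [hθb] at h2
    have := norm_squareAverage_sub_le_horizontal hε hc₀ hQ h1 h2 hK
    rw [← hI] at this
    exact this.trans hsq

theorem norm_squareAverage_sub_le_circle (hε : 0 < ε) (hc₀ : 0 < c₀) (hQ : ContDiff ℝ 1 Q)
    {x : ℂ} {τ : ℝ} (hτ : ε ≤ τ) (θ₀ : ℝ) :
    ‖squareAverage ε Q (circleMap x τ θ₀) - Q (circleMap x τ θ₀)‖ ≤
      √(2 * ε * G.circleEnergy c₀ ε Q x τ) +
        6 * √(G.squareEnergy c₀ ε Q (circleMap x τ θ₀)) := by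
  obtain ⟨θ, hθ, h⟩ := exists_norm_squareAverage_sub_le (G := G) hε hc₀ hQ (x := x) hτ θ₀
  have h2 := norm_sub_le_circleEnergy (G := G) hε hc₀ hQ (x := x) hτ hθ
  rw [← sub_add_sub_cancel _ (Q (circleMap x τ θ))]
  exact (norm_add_le _ _).trans (by linarith)

theorem exists_norm_squareAverage_sub_le_density (hε : 0 < ε) (hc₀ : 0 < c₀)
    (hQ : ContDiff ℝ 1 Q) (p : ℂ) : ∃ z,
      ‖squareAverage ε Q p - Q z‖ ≤ 4 * √(G.squareEnergy c₀ ε Q p) ∧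
      4 * ε ^ 2 * G.density c₀ ε Q z ≤ G.squareEnergy c₀ ε Q p := by
  obtain ⟨a, ha, hga⟩ := exists_vertical_le (G := G) hε hc₀ hQ p (α := -ε) (β := ε) le_rfl
    (by linarith) le_rfl
  have hdc : Continuous fun t : ℝ => G.density c₀ ε Q (p + (a + t * Complex.I)) :=
    (continuous_density hQ).comp (by fun_prop)
  obtain ⟨b, hb, hgb⟩ := exists_mul_le_integral hdc (fun t => density_nonneg hc₀ _)
    (a := -ε) (b := ε) le_rfl (by linarith) le_rfl
  have hI0 := squareEnergy_nonneg (G := G) (Q := Q) hε hc₀ p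
  refine ⟨p + (a + b * Complex.I), ?_, ?_⟩
  · have hav := norm_squareAverage_sub_le_vertical (G := G) (p := p) (K := G.squareEnergy c₀ ε Q p / 2)
      hε hc₀ hQ ha hb (by linarith)
    rw [show 4 * (G.squareEnergy c₀ ε Q p / 2) = 2 * G.squareEnergy c₀ ε Q p by ring] at hav
    linarith [sqrt_two_mul_le hI0]
  · have := mul_le_mul_of_nonneg_left hgb (show 0 ≤ ε - -ε by linarith)
    nlinarith

/-- Some point of the square has both small energy density and a value close to the average. The
density bounds the penalty there, hence the gap, and the Lipschitz property carries the bound to the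
average. -/
theorem gap_squareAverage_ge (hε : 0 < ε) (hc₀ : 0 < c₀) (hQ : ContDiff ℝ 1 Q) (p : ℂ) :
    1 - √(G.squareEnergy c₀ ε Q p) / (2 * √c₀) - G.lip * (4 * √(G.squareEnergy c₀ ε Q p)) ≤
      G.gap (squareAverage ε Q p) := by
  obtain ⟨z, hz, h6⟩ := exists_norm_squareAverage_sub_le_density (G := G) hε hc₀ hQ p
  have hI0 := squareEnergy_nonneg (G := G) (Q := Q) hε hc₀ p
  generalize G.squareEnergy c₀ ε Q p = I at *
  have h3 : G.gap (Q z) ≤ G.gap (squareAverage ε Q p) + G.lip * (4 * √I) := by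
    have := G.gap_sub_le (Q z) (squareAverage ε Q p)
    rw [norm_sub_rev] at this
    have h4 : G.lip * ‖squareAverage ε Q p - Q z‖ ≤ G.lip * (4 * √I) :=
      mul_le_mul_of_nonneg_left hz G.lip_pos.le
    linarith
  have h4 : 4 * c₀ * pen (G.gap (Q z)) ≤ I := by
    have h5 := pen_le_density (G := G) (c₀ := c₀) (ε := ε) (Q := Q) z
    have h7 : c₀ * pen (G.gap (Q z)) ≤ ε ^ 2 * G.density c₀ ε Q z := by
      have := mul_le_mul_of_nonneg_left h5 (sq_nonneg ε)
      calc c₀ * pen (G.gap (Q z)) = ε ^ 2 * (c₀ / ε ^ 2 * pen (G.gap (Q z))) := by field_simp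
        _ ≤ _ := this
    linarith
  have h5 : 1 - G.gap (Q z) ≤ √I / (2 * √c₀) := by
    by_cases hneg : 1 - G.gap (Q z) ≤ 0
    · exact hneg.trans (by positivity)
    · rw [le_div_iff₀ (by have := Real.sqrt_pos.2 hc₀; positivity)]
      apply Real.le_sqrt_of_sq_le
      have : max 0 (1 - G.gap (Q z)) = 1 - G.gap (Q z) := max_eq_right (not_le.1 hneg).le
      unfold pen at h4
      rw [this] at h4
      rw [mul_pow, mul_pow, Real.sq_sqrt hc₀.le]
      linarith
  linarith

end GapField

/-! ### Thresholds for small energy. -/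

namespace GapField

variable {V F : Type*} [NormedAddCommGroup V] [NormedSpace ℝ V] [CompleteSpace V]
  [NormedAddCommGroup F] [InnerProductSpace ℝ F]

/-- Two positive numbers for which circles on which all squares have energy below the first one
satisfy a sharp lower bound whenever the averages turn by a half turn. -/
structure Thresholds (G : GapField V F) (c₀ : ℝ) where
  c : ℝ
  K : ℝ
  c_pos : 0 < c
  K_pos : 0 < K
  -- The factor six is the one used in `logBound_le`, where `2 κ * (3 / 16)` has to be at most `K c
  -- / 16`; the energy of the initial balls needs only four.
  kappa_le : 6 * G.kappa ≤ K * c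
  gap_average : ∀ {Q : ℂ → V} {ε : ℝ}, ContDiff ℝ 1 Q → 0 < ε → ∀ p,
    G.squareEnergy c₀ ε Q p < c → 1 / 2 ≤ G.gap (squareAverage ε Q p)
  orientable_iff : ∀ {Q : ℂ → V} {ε : ℝ}, ContDiff ℝ 1 Q → 0 < ε → ∀ {x : ℂ} {τ : ℝ}, ε ≤ τ →
    (∀ θ, G.squareEnergy c₀ ε Q (circleMap x τ θ) < c) → G.circleEnergy c₀ ε Q x τ < c / ε →
    (Orientable (G.dir ∘ squareAverage ε Q) x τ ↔ Orientable (G.dir ∘ Q) x τ)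
  le_circleEnergy : ∀ {Q : ℂ → V} {ε : ℝ}, ContDiff ℝ 1 Q → 0 < ε → ∀ {x : ℂ} {τ : ℝ}, ε ≤ τ →
    (∀ θ, G.squareEnergy c₀ ε Q (circleMap x τ θ) < c) →
    ¬ Orientable (G.dir ∘ squareAverage ε Q) x τ →
    G.kappa / (τ + K * √(ε * τ)) ≤ G.circleEnergy c₀ ε Q x τ

theorem exists_circleMap_eq {x z : ℂ} {τ : ℝ} (hz : z ∈ sphere (0 : ℂ) 1) :
    ∃ θ, x + τ * z = circleMap x τ θ := by
  refine ⟨z.arg, ?_⟩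
  rw [circleMap, ← Complex.norm_mul_exp_arg_mul_I z, mem_sphere_zero_iff_norm.1 hz]
  simp [Complex.arg_exp_mul_I]

theorem nonempty_thresholds (G : GapField V F) {c₀ : ℝ} (hc₀ : 0 < c₀) :
    Nonempty (G.Thresholds c₀) := by
  have hlip := G.lip_pos
  have hscale := G.scale_pos
  have hsc := Real.sqrt_pos.2 hc₀
  -- The threshold is `c = q²`. The first and third conditions make the gap of the average at least
  -- `3 / 4`; the first also bounds by `1 / 4` the loss in passing to `Q` at distance `8 q`; the
  -- second gives `8 q < scale / 2` for `orientable_of_close`.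
  obtain ⟨q, hq, hq1, hq2, hq3⟩ : ∃ q : ℝ, 0 < q ∧ q * (32 * G.lip) ≤ 1 ∧ q * 17 ≤ G.scale ∧
      q * 4 ≤ √c₀ := by
    refine ⟨min (1 / (32 * G.lip)) (min (G.scale / 17) (√c₀ / 4)), by positivity, ?_, ?_, ?_⟩
    · rw [← le_div_iff₀ (by positivity)]; exact min_le_left _ _
    · rw [← le_div_iff₀ (by positivity)]; exact (min_le_right _ _).trans (min_le_left _ _)
    · rw [← le_div_iff₀ (by positivity)]; exact (min_le_right _ _).trans (min_le_right _ _)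
  obtain ⟨K₀, hK₀, hcirc⟩ := G.circle_energy_ge hc₀
  have hκ := G.kappa_pos
  obtain ⟨K, hK, hKc⟩ : ∃ K, K₀ ≤ K ∧ 6 * G.kappa ≤ K * q ^ 2 :=
    ⟨max K₀ (6 * G.kappa / q ^ 2), le_max_left _ _, by
      rw [← div_le_iff₀ (by positivity)]; exact le_max_right _ _⟩
  have hKpos : 0 < K := hK₀.trans_le hK
  have hsqrt : ∀ {I : ℝ}, I < q ^ 2 → √I ≤ q := fun h =>
    (Real.sqrt_le_sqrt h.le).trans_eq (Real.sqrt_sq hq.le)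
  have havg : ∀ {Q : ℂ → V} {ε : ℝ}, ContDiff ℝ 1 Q → 0 < ε → ∀ p,
      G.squareEnergy c₀ ε Q p < q ^ 2 → 3 / 4 ≤ G.gap (squareAverage ε Q p) := by
    intro Q ε hQ hε p hp
    have h := gap_squareAverage_ge (G := G) hε hc₀ hQ p
    have h1 := hsqrt hp
    have h2 : √(G.squareEnergy c₀ ε Q p) / (2 * √c₀) ≤ 1 / 8 := by
      rw [div_le_iff₀ (by positivity)]; linarith
    have h3 : G.lip * (4 * √(G.squareEnergy c₀ ε Q p)) ≤ G.lip * (4 * q) := by gcongr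
    linarith
  have hclose : ∀ {Q : ℂ → V} {ε : ℝ}, ContDiff ℝ 1 Q → 0 < ε → ∀ {x : ℂ} {τ : ℝ}, ε ≤ τ →
      (∀ θ, G.squareEnergy c₀ ε Q (circleMap x τ θ) < q ^ 2) →
      G.circleEnergy c₀ ε Q x τ < q ^ 2 / ε →
      ∀ θ, ‖squareAverage ε Q (circleMap x τ θ) - Q (circleMap x τ θ)‖ ≤ 8 * q := by
    intro Q ε hQ hε x τ hτ hlow hcE θ
    have h := norm_squareAverage_sub_le_circle (G := G) hε hc₀ hQ (x := x) hτ θ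
    have h1 := hsqrt (hlow θ)
    have h2 : √(2 * ε * G.circleEnergy c₀ ε Q x τ) ≤ 2 * q := by
      rw [← Real.sqrt_sq (show 0 ≤ 2 * q by positivity)]
      apply Real.sqrt_le_sqrt
      rw [lt_div_iff₀ hε] at hcE
      nlinarith
    linarith
  have hgapc : ∀ {Q : ℂ → V} {ε : ℝ}, ContDiff ℝ 1 Q → 0 < ε → ∀ {x : ℂ} {τ : ℝ}, ε ≤ τ →
      (∀ θ, G.squareEnergy c₀ ε Q (circleMap x τ θ) < q ^ 2) →
      G.circleEnergy c₀ ε Q x τ < q ^ 2 / ε →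
      ∀ θ, 1 / 2 ≤ G.gap (Q (circleMap x τ θ)) := by
    intro Q ε hQ hε x τ hτ hlow hcE θ
    have h1 := hclose hQ hε hτ hlow hcE θ
    have h2 := havg hQ hε _ (hlow θ)
    have h3 := G.gap_sub_le (squareAverage ε Q (circleMap x τ θ)) (Q (circleMap x τ θ))
    have h4 := mul_le_mul_of_nonneg_left h1 hlip.le
    linarith
  have horient : ∀ {Q : ℂ → V} {ε : ℝ}, ContDiff ℝ 1 Q → 0 < ε → ∀ {x : ℂ} {τ : ℝ}, ε ≤ τ →
      (∀ θ, G.squareEnergy c₀ ε Q (circleMap x τ θ) < q ^ 2) →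
      G.circleEnergy c₀ ε Q x τ < q ^ 2 / ε →
      (Orientable (G.dir ∘ squareAverage ε Q) x τ ↔ Orientable (G.dir ∘ Q) x τ) := by
    intro Q ε hQ hε x τ hτ hlow hcE
    have hc1 : ContinuousOn (fun z : ℂ => squareAverage ε Q (x + τ * z)) (sphere 0 1) :=
      ((continuous_squareAverage hQ).comp (by fun_prop)).continuousOn
    have hc2 : ContinuousOn (fun z : ℂ => Q (x + τ * z)) (sphere 0 1) :=
      (hQ.continuous.comp (by fun_prop)).continuousOn
    have hg1 : ∀ z ∈ sphere (0 : ℂ) 1, 1 / 2 ≤ G.gap (squareAverage ε Q (x + τ * z)) := by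
      intro z hz
      obtain ⟨θ, hθ⟩ := exists_circleMap_eq (x := x) (τ := τ) hz
      rw [hθ]
      linarith [havg hQ hε _ (hlow θ)]
    have hg2 : ∀ z ∈ sphere (0 : ℂ) 1, 1 / 2 ≤ G.gap (Q (x + τ * z)) := by
      intro z hz
      obtain ⟨θ, hθ⟩ := exists_circleMap_eq (x := x) (τ := τ) hz
      rw [hθ]
      exact hgapc hQ hε hτ hlow hcE θ
    have hcl : ∀ z ∈ sphere (0 : ℂ) 1,
        ‖squareAverage ε Q (x + τ * z) - Q (x + τ * z)‖ ≤ 8 * q := by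
      intro z hz
      obtain ⟨θ, hθ⟩ := exists_circleMap_eq (x := x) (τ := τ) hz
      rw [hθ]
      exact hclose hQ hε hτ hlow hcE θ
    have hδ : 8 * q < G.scale * (1 / 2) := by linarith
    exact ⟨G.orientable_of_close (by norm_num) hc2 hg1 hg2
      (fun z hz => by rw [norm_sub_rev]; exact hcl z hz) hδ,
      G.orientable_of_close (by norm_num) hc1 hg2 hg1 hcl hδ⟩
  refine ⟨⟨q ^ 2, K, by positivity, hKpos, hKc, fun hQ hε p hp => ?_, horient, ?_⟩⟩
  · linarith [havg hQ hε p hp]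
  · intro Q ε hQ hε x τ hτ hlow hnon
    have hτ0 : 0 < τ := hε.trans_le hτ
    rcases lt_or_ge (G.circleEnergy c₀ ε Q x τ) (q ^ 2 / ε) with hlt | hge
    · refine (hcirc K hK hQ.continuous hε hτ (hasDerivAt_circle hQ x τ)
        (continuous_circleDeriv hQ x τ) (hgapc hQ hε hτ hlow hlt)
        (mt (horient hQ hε hτ hlow hlt).2 hnon)).trans ?_
      have hd := (continuous_density (G := G) (c₀ := c₀) (ε := ε) hQ).comp
        (continuous_circleMap x τ)
      have hp := continuous_pen.comp (G.continuous_gap.comp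
        (hQ.continuous.comp (continuous_circleMap x τ)))
      have hu := continuous_circleDeriv hQ x τ
      refine intervalIntegral.integral_mono_on (by positivity)
        (Continuous.intervalIntegrable ?_ _ _) (Continuous.intervalIntegrable ?_ _ _)
        fun θ _ => ?_
      · exact ((hu.norm.pow 2).div_const _).add
          ((continuous_const.mul hp).mul continuous_const)
      · exact hd.mul continuous_const
      · have h := norm_circleDeriv_sq_le (Q := Q) hτ0 x θ
        unfold density
        rw [add_mul]
        gcongr
        rw [div_le_iff₀ (by positivity)]
        linarith
    -- A circle of energy at least `q² / ε` needs no topology: the claimed bound is at most `κ / (K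
    -- ε)`, because `√(ε τ) ≥ ε`.
    · refine le_trans ?_ hge
      have h1 : ε ≤ √(ε * τ) := by
        apply Real.le_sqrt_of_sq_le; nlinarith
      have h2 : K * ε ≤ τ + K * √(ε * τ) := by nlinarith
      rw [div_le_div_iff₀ (by positivity) hε]
      nlinarith [sq_nonneg q]

end GapField

/-! ### Polar coordinates -/

theorem lintegral_annulus {d : ℂ → ℝ} (hd : Continuous d) (hd0 : ∀ z, 0 ≤ d z) (x : ℂ) {s t : ℝ}
    (hs : 0 < s) : ∫⁻ z in ball x t \ ball x s, ENNReal.ofReal (d z) =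
      ∫⁻ τ in Ico s t, ENNReal.ofReal (∫ θ in (0 : ℝ)..2 * Real.pi, d (circleMap x τ θ) * τ) := by
  have hA : MeasurableSet (ball x t \ ball x s) := measurableSet_ball.diff measurableSet_ball
  have hπ := Real.pi_pos
  rw [← lintegral_indicator hA, ← lintegral_add_left_eq_self _ x,
    ← Complex.lintegral_comp_polarCoord_symm, polarCoord_target, Measure.volume_eq_prod,
    ← Measure.prod_restrict]
  have hcirc : ∀ p : ℝ × ℝ, x + Complex.polarCoord.symm p = circleMap x p.1 p.2 := by
    intro p
    rw [Complex.polarCoord_symm_apply, circleMap, Complex.exp_mul_I, Complex.ofReal_cos,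
      Complex.ofReal_sin]
  simp only [hcirc]
  have hmeas : Measurable fun p : ℝ × ℝ => ENNReal.ofReal p.1 • (ball x t \ ball x s).indicator
      (fun z => ENNReal.ofReal (d z)) (circleMap x p.1 p.2) := by
    have hc : Continuous fun p : ℝ × ℝ => circleMap x p.1 p.2 := by unfold circleMap; fun_prop
    exact (ENNReal.measurable_ofReal.comp measurable_fst).smul
      (((ENNReal.measurable_ofReal.comp hd.measurable).indicator hA).comp hc.measurable)
  rw [lintegral_prod _ hmeas.aemeasurable]
  rw [← lintegral_indicator measurableSet_Ioi, ← lintegral_indicator measurableSet_Ico]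
  congr 1
  ext τ
  by_cases hτ : τ ∈ Ico s t
  · have hτ0 : 0 < τ := hs.trans_le hτ.1
    rw [indicator_of_mem (show τ ∈ Ioi 0 from hτ0), indicator_of_mem hτ]
    have hin : ∀ θ, circleMap x τ θ ∈ ball x t \ ball x s := by
      intro θ
      simp only [Set.mem_sdiff, mem_ball, dist_eq_norm, circleMap_sub_center, norm_circleMap_zero,
        abs_of_pos hτ0, not_lt]
      exact ⟨hτ.2, hτ.1⟩
    simp only [indicator_of_mem (hin _), smul_eq_mul, ← ENNReal.ofReal_mul hτ0.le]
    have hc : Continuous fun θ => d (circleMap x τ θ) * τ :=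
      (hd.comp (continuous_circleMap x τ)).mul continuous_const
    have hper : Function.Periodic (fun θ => d (circleMap x τ θ) * τ) (2 * Real.pi) := fun θ => by
      simp only [periodic_circleMap x τ θ]
    have h := hper.intervalIntegral_add_eq 0 (-Real.pi)
    rw [zero_add, show -Real.pi + 2 * Real.pi = Real.pi by ring] at h
    rw [h, intervalIntegral.integral_of_le (by linarith), ofReal_integral_eq_lintegral_ofReal]
    · rw [restrict_Ioo_eq_restrict_Ioc]
      simp only [mul_comm]
    · exact (hc.integrableOn_Icc (a := -Real.pi) (b := Real.pi)).mono_set Ioc_subset_Icc_self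
    · exact Eventually.of_forall fun θ => mul_nonneg (hd0 _) hτ0.le
  · rw [indicator_of_notMem hτ]
    by_cases hτ0 : τ ∈ Ioi (0 : ℝ)
    · rw [indicator_of_mem hτ0]
      have hτ0' : 0 < τ := hτ0
      have hin : ∀ θ, circleMap x τ θ ∉ ball x t \ ball x s := by
        intro θ
        simp only [Set.mem_sdiff, mem_ball, dist_eq_norm, circleMap_sub_center, norm_circleMap_zero,
          abs_of_pos hτ0', not_lt]
        exact fun h => hτ ⟨h.2, h.1⟩
      simp [indicator_of_notMem (hin _)]
    · rw [indicator_of_notMem hτ0]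

/-! ### The logarithmic lower bound -/

/-- The energy accumulated by a vortex up to the radius `s`, with core length `L ^ 2`. -/
def logBound (κ L s : ℝ) : ℝ := 2 * κ * Real.log (1 + √s / L)

section logBound

variable {κ L : ℝ}

theorem logBound_nonneg (hκ : 0 < κ) (hL : 0 < L) (s : ℝ) : 0 ≤ logBound κ L s := by
  have : 0 ≤ √s / L := by positivity
  have := Real.log_nonneg (show 1 ≤ 1 + √s / L by linarith)
  unfold logBound; positivity

theorem logBound_mono (hκ : 0 < κ) (hL : 0 < L) {s t : ℝ} (hst : s ≤ t) :
    logBound κ L s ≤ logBound κ L t := by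
  unfold logBound
  gcongr

/-- By Bernoulli's inequality `1 + p y ≤ (1 + y) ^ p` with `p = √t / √s`, the logarithm grows at
most by the factor `√t / √s`, which is at most `t / s`. -/
theorem logBound_div (hκ : 0 < κ) (hL : 0 < L) {s t : ℝ} (hs : 0 < s) (hst : s ≤ t) :
    logBound κ L t / t ≤ logBound κ L s / s := by
  have ht : 0 < t := hs.trans_le hst
  have hss := Real.sqrt_pos.2 hs
  have hp : 1 ≤ √t / √s := (one_le_div hss).2 (Real.sqrt_le_sqrt hst)
  have hy : 0 < √s / L := by positivity
  have hb := one_add_mul_self_le_rpow_one_add (s := √s / L) (by linarith) hp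
  have h0 : 1 + √t / √s * (√s / L) = 1 + √t / L := by field_simp
  rw [h0] at hb
  have h1 : Real.log (1 + √t / L) ≤ √t / √s * Real.log (1 + √s / L) := by
    rw [← Real.log_rpow (by positivity)]
    exact Real.log_le_log (by positivity) hb
  have h2 : 0 ≤ Real.log (1 + √s / L) := Real.log_nonneg (by linarith)
  have h3 : √t / √s ≤ t / s := by
    have : t / s = (√t / √s) ^ 2 := by rw [div_pow, Real.sq_sqrt ht.le, Real.sq_sqrt hs.le]
    rw [this]; nlinarith
  have h4 : Real.log (1 + √t / L) ≤ t / s * Real.log (1 + √s / L) :=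
    h1.trans (mul_le_mul_of_nonneg_right h3 h2)
  rw [div_le_div_iff₀ ht hs]
  unfold logBound
  rw [div_mul_eq_mul_div, le_div_iff₀ hs] at h4
  nlinarith

/-- With `L = K √ε` this derivative is the lower bound for the energy of one circle, so increments
of `logBound` bound the energy of annuli. -/
theorem hasDerivAt_logBound (hL : 0 < L) {s : ℝ} (hs : 0 < s) :
    HasDerivAt (logBound κ L) (κ / (s + L * √s)) s := by
  have hss := Real.sqrt_pos.2 hs
  have h := ((((Real.hasDerivAt_sqrt hs.ne').div_const L).const_add 1).log
    (show (1 + √s / L) ≠ 0 by positivity)).const_mul (2 * κ)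
  refine h.congr_deriv ?_
  have : s = √s ^ 2 := (Real.sq_sqrt hs.le).symm
  have h1 : s + L * √s = √s * (√s + L) := by nlinarith
  rw [h1]
  have : L + √s ≠ 0 := by positivity
  have : √s + L ≠ 0 := by positivity
  field_simp
  ring

theorem logBound_sub_le_lintegral (hκ : 0 < κ) (hL : 0 < L) {s t : ℝ} (hs : 0 < s) (hst : s ≤ t)
    {e : ℝ → ℝ} (he : ∀ τ ∈ Ico s t, κ / (τ + L * √τ) ≤ e τ) :
    ENNReal.ofReal (logBound κ L t - logBound κ L s) ≤
      ∫⁻ τ in Ico s t, ENNReal.ofReal (e τ) := by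
  have hpos : ∀ τ ∈ Icc s t, 0 < τ + L * √τ := fun τ hτ => by
    have : 0 < τ := hs.trans_le hτ.1
    positivity
  have hcont : ContinuousOn (fun τ => κ / (τ + L * √τ)) (Icc s t) :=
    continuousOn_const.div (by fun_prop) fun τ hτ => (hpos τ hτ).ne'
  have hint := (hcont.integrableOn_Icc (μ := volume)).mono_set Ico_subset_Icc_self
  have h := intervalIntegral.integral_eq_sub_of_hasDerivAt (f := logBound κ L)
    (a := s) (b := t) (f' := fun τ => κ / (τ + L * √τ)) (fun τ hτ => by
      rw [uIcc_of_le hst] at hτ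
      exact hasDerivAt_logBound hL (hs.trans_le hτ.1))
    (hcont.intervalIntegrable_of_Icc hst)
  rw [← h, intervalIntegral.integral_of_le hst, ← integral_Ico_eq_integral_Ioc,
    ofReal_integral_eq_lintegral_ofReal hint]
  · exact setLIntegral_mono' measurableSet_Ico fun τ hτ => ENNReal.ofReal_le_ofReal (he τ hτ)
  · refine (ae_restrict_iff' measurableSet_Ico).2 (Eventually.of_forall fun τ hτ => ?_)
    exact (div_pos hκ (hpos τ (Ico_subset_Icc_self hτ))).le

end logBound

/-- The point of the inner ball farthest from `b` is tested; when the centres coincide any direction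
will do. -/
theorem dist_add_le_of_closedBall_subset {a b : ℂ} {r s : ℝ} (hr : 0 ≤ r)
    (h : closedBall a r ⊆ closedBall b s) : dist a b + r ≤ s := by
  by_cases hab : a = b
  · subst hab
    have h1 : a + (r : ℂ) ∈ closedBall a s := h (by simp [abs_of_nonneg hr])
    simpa [abs_of_nonneg hr] using h1
  · have hd : 0 < ‖a - b‖ := norm_pos_iff.2 (sub_ne_zero.2 hab)
    have h1 : a + (r / ‖a - b‖) • (a - b) ∈ closedBall b s := by
      apply h
      rw [mem_closedBall, dist_self_add_left, norm_smul, Real.norm_eq_abs,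
        abs_of_nonneg (by positivity), div_mul_cancel₀ _ hd.ne']
    have e : a + (r / ‖a - b‖) • (a - b) - b = (1 + r / ‖a - b‖) • (a - b) := by
      rw [add_smul, one_smul]; abel
    rw [mem_closedBall, dist_eq_norm, e, norm_smul, Real.norm_eq_abs,
      abs_of_nonneg (by positivity), add_mul, div_mul_cancel₀ _ hd.ne'] at h1
    rw [dist_eq_norm]; linarith

theorem exists_maximal_separated {X : Type*} [PseudoMetricSpace X] (Z : Set X) {δ : ℝ}
    (hδ : 0 < δ) : ∃ S ⊆ Z, (S.Pairwise fun x y => δ ≤ dist x y) ∧ Z ⊆ ⋃ x : S, ball (x : X) δ := by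
  obtain ⟨S, hS⟩ := zorn_subset {S | S ⊆ Z ∧ S.Pairwise fun x y => δ ≤ dist x y} (by
    intro C hC hchain
    refine ⟨⋃₀ C, ⟨sUnion_subset fun s hs => (hC hs).1, ?_⟩, fun s hs => subset_sUnion_of_mem hs⟩
    exact (pairwise_sUnion hchain.directedOn).2 fun s hs => (hC hs).2)
  refine ⟨S, hS.prop.1, hS.prop.2, fun z hz => ?_⟩
  by_contra hcov
  simp only [mem_iUnion, mem_ball, not_exists, not_lt] at hcov
  have hins : insert z S ∈ {S | S ⊆ Z ∧ S.Pairwise fun x y => δ ≤ dist x y} := by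
    exact ⟨insert_subset hz hS.prop.1, Set.pairwise_insert.2 ⟨hS.prop.2, fun y hy _ =>
      ⟨hcov ⟨y, hy⟩, by rw [dist_comm]; exact hcov ⟨y, hy⟩⟩⟩⟩
  have := hS.le_of_ge hins (subset_insert z S) (mem_insert z S)
  have h2 := hcov ⟨z, this⟩
  simp at h2
  linarith

/-- A set of points around which a finite measure is concentrated is covered by finitely many
balls. -/
theorem exists_finite_cover {X : Type*} [PseudoMetricSpace X] [MeasurableSpace X]
    [OpensMeasurableSpace X] {μ : Measure X} [IsFiniteMeasure μ] {Z : Set X} {δ c : ℝ}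
    (hδ : 0 < δ) (hc : 0 < c) (hZ : ∀ x ∈ Z, ENNReal.ofReal c ≤ μ (ball x (δ / 2))) :
    ∃ S : Set X, S.Finite ∧ S ⊆ Z ∧ (Pairwise fun x y : S =>
      Disjoint (ball (x : X) (δ / 2)) (ball (y : X) (δ / 2))) ∧ Z ⊆ ⋃ x : S, ball (x : X) δ := by
  obtain ⟨S, hSZ, hsep, hcov⟩ := exists_maximal_separated Z hδ
  have hdis : Pairwise fun x y : S =>
      Disjoint (ball (x : X) (δ / 2)) (ball (y : X) (δ / 2)) := fun x y hxy =>
    ball_disjoint_ball (by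
      have := hsep x.2 y.2 fun e => hxy (Subtype.ext e)
      linarith)
  refine ⟨S, ?_, hSZ, hdis, hcov⟩
  have h := Measure.finite_const_le_meas_of_disjoint_iUnion μ (ENNReal.ofReal_pos.2 hc)
    (As := fun x : S => ball (x : X) (δ / 2)) (fun _ => measurableSet_ball) hdis
    (measure_ne_top _ _)
  have huniv : {i : S | ENNReal.ofReal c ≤ μ (ball (i : X) (δ / 2))} = univ :=
    eq_univ_of_forall fun x => hZ x (hSZ x.2)
  rw [huniv] at h
  have := Set.finite_univ_iff.1 h
  exact S.toFinite

/-! ### The beginning and the end of the ball construction. -/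

namespace BallGrowth

variable {B : BallGrowth}

/-- The initial family of balls. -/
theorem exists_hasFamily_initial {ι : Type} [Fintype ι] {x : ι → ℂ} {A : ι → Set ℂ}
    (hA : ∀ i, MeasurableSet (A i)) (hdis : Pairwise fun i j => Disjoint (A i) (A j))
    (hsub : ∀ i, A i ⊆ ball (x i) B.s₀) (hμ : ∀ i, ENNReal.ofReal (B.Λ B.s₀) ≤ B.μ (A i))
    (hcov : B.Z ⊆ ⋃ i, ball (x i) B.s₀) : ∃ n, B.HasFamily B.s₀ n := by
  classical
  have hs0 := B.s₀_pos
  have hΛ := B.Λ_nonneg _ le_rfl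
  obtain ⟨π, c', r', hpos, hsum, hsubc, hd⟩ := exists_disjoint_merge x (r := fun _ => B.s₀)
    fun _ => hs0
  have hball : ∀ i, ball (x i) B.s₀ ⊆ ball (c' (π i)) (r' (π i)) := fun i =>
    ball_subset_ball_of_closedBall_subset hs0 (hsubc i)
  have hdisj : Pairwise fun i j : range π =>
      Disjoint (closedBall (c' i) (r' i)) (closedBall (c' j) (r' j)) := by
    rintro ⟨_, i, rfl⟩ ⟨_, j, rfl⟩ hij
    exact hd i j fun e => hij (Subtype.ext e)
  refine ⟨_, range π, inferInstance, fun k => c' k, fun k => r' k, rfl,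
    ⟨?_, fun i j hij => (hdisj hij).mono ball_subset_closedBall ball_subset_closedBall, ?_, ?_, ?_⟩,
    hdisj⟩
  · rintro ⟨_, i, rfl⟩; exact hpos i
  · intro z hz
    obtain ⟨i, hi⟩ := mem_iUnion.1 (hcov hz)
    exact mem_iUnion.2 ⟨⟨π i, i, rfl⟩, hball i hi⟩
  · rintro ⟨_, i, rfl⟩
    have e : r' (π i) / B.s₀ * B.Λ B.s₀ = ∑ j with π j = π i, B.Λ B.s₀ := by
      rw [hsum (π i) (Finset.univ.filter fun j => π j = π i) (by simp), Finset.sum_div,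
        Finset.sum_mul]
      simp [div_self hs0.ne']
    simp only [e]
    refine sum_le_measure _ hA hdis (fun j hj => ?_) (fun _ => hΛ) hμ
    simp only [Finset.mem_filter, Finset.mem_univ, true_and] at hj
    exact (hsub j).trans (hj ▸ hball j)
  · rintro ⟨_, i, rfl⟩ _
    simp only
    rw [hsum (π i) (Finset.univ.filter fun j => π j = π i) (by simp)]
    exact Finset.single_le_sum (f := fun _ => B.s₀) (fun _ _ => hs0.le) (a := i) (by simp)

/-- If the energy is small then the sum of the radii is small and all balls are trivial. -/
theorem HasFamily.sum_radius_lt {n : ℕ} (hs : B.s₀ ≤ B.s₁) (h : B.HasFamily B.s₁ n)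
    (hμ : B.μ univ < ENNReal.ofReal (B.Λ B.s₁)) :
    ∃ (ι : Type) (_ : Fintype ι) (c : ι → ℂ) (r : ι → ℝ), (∀ i, 0 < r i) ∧
      (Pairwise fun i j => Disjoint (ball (c i) (r i)) (ball (c j) (r j))) ∧
      (B.Z ⊆ ⋃ i, ball (c i) (r i)) ∧ ∑ i, r i < B.s₁ ∧ ∀ i, ¬ B.nontriv (c i) (r i) := by
  obtain ⟨ι, _, c, r, -, hf, -⟩ := h
  have hs1 : 0 < B.s₁ := B.s₀_pos.trans_le hs
  have hΛ0 := B.Λ_nonneg _ hs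
  have hΛ : 0 < B.Λ B.s₁ := by
    by_contra hneg
    rw [ENNReal.ofReal_of_nonpos (not_lt.1 hneg)] at hμ
    exact not_lt_zero hμ
  -- The energies of disjoint balls add up to at least `Λ s₁` times the sum of the radii over `s₁`.
  -- Once this sum is below `s₁`, no single radius reaches `s₁`, so no ball is of nontrivial type.
  have hsum : ∑ i, r i < B.s₁ := by
    have h1 : ENNReal.ofReal (∑ i, r i / B.s₁ * B.Λ B.s₁) ≤ B.μ univ :=
      sum_le_measure _ (fun _ => measurableSet_ball) hf.disj (fun _ _ => subset_univ _)
        (fun i => by have := hf.pos i; positivity) hf.energy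
    have h2 := (ENNReal.ofReal_lt_ofReal_iff hΛ).1 (h1.trans_lt hμ)
    rw [← Finset.sum_mul, ← Finset.sum_div, div_mul_eq_mul_div, div_lt_iff₀ hs1] at h2
    nlinarith
  refine ⟨ι, inferInstance, c, r, hf.pos, hf.disj, hf.cover, hsum, fun i hN => ?_⟩
  have := Finset.single_le_sum (f := r) (fun j _ => (hf.pos j).le) (Finset.mem_univ i)
  linarith [hf.le_radius i hN]

end BallGrowth

/-! ### The ball construction applied to a map of class `C¹`. -/

namespace GapField

variable {V F : Type*} [NormedAddCommGroup V] [NormedSpace ℝ V]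
  [NormedAddCommGroup F] [InnerProductSpace ℝ F] {G : GapField V F} {c₀ ε : ℝ} {Q : ℂ → V}

/-- The energy as a measure on the disk of radius `R`. -/
def energyMeasure (G : GapField V F) (c₀ ε : ℝ) (Q : ℂ → V) (R : ℝ) : Measure ℂ :=
  (volume.restrict (ball 0 R)).withDensity fun z => ENNReal.ofReal (G.density c₀ ε Q z)

theorem energyMeasure_apply {R : ℝ} {A : Set ℂ} (hA : MeasurableSet A) (hAR : A ⊆ ball 0 R) :
    energyMeasure G c₀ ε Q R A = ∫⁻ z in A, ENNReal.ofReal (G.density c₀ ε Q z) := by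
  rw [energyMeasure, withDensity_apply _ hA, Measure.restrict_restrict hA,
    inter_eq_left.2 hAR]

theorem energyMeasure_univ (R : ℝ) : energyMeasure G c₀ ε Q R univ =
    ∫⁻ z in ball 0 R, ENNReal.ofReal (G.density c₀ ε Q z) := by
  rw [energyMeasure, withDensity_apply _ MeasurableSet.univ, Measure.restrict_univ]

/-- The singular set: the points around which the energy is not small. -/
def singularSet (G : GapField V F) (c₀ ε : ℝ) (Q : ℂ → V) (c ρ : ℝ) : Set ℂ :=
  {x | x ∈ ball (0 : ℂ) ρ ∧ c ≤ G.squareEnergy c₀ ε Q x}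

theorem continuousOn_lineProj_average (T : G.Thresholds c₀) (hQ : ContDiff ℝ 1 Q) (hε : 0 < ε)
    {s : Set ℂ} {ρ : ℝ} (hs : s ⊆ ball 0 ρ)
    (hZ : ∀ z ∈ s, z ∉ G.singularSet c₀ ε Q T.c ρ) :
    ContinuousOn (fun z => lineProj (G.dir (squareAverage ε Q z))) s :=
  G.continuousOn_lineProj (continuous_squareAverage hQ).continuousOn fun z hz => by
    have : G.squareEnergy c₀ ε Q z < T.c := by
      by_contra hneg
      exact hZ z hz ⟨hs hz, not_lt.1 hneg⟩
    linarith [T.gap_average hQ hε z this]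

theorem orientable_average_of_balls (T : G.Thresholds c₀) (hQ : ContDiff ℝ 1 Q) (hε : 0 < ε)
    {ι : Type*} [Finite ι] {c : ι → ℂ} {r : ι → ℝ} {x : ℂ} {R ρ : ℝ} (hr : ∀ i, 0 < r i)
    (hdis : Pairwise fun i j => Disjoint (ball (c i) (r i)) (ball (c j) (r j)))
    (hsub : ∀ i, closedBall (c i) (r i) ⊆ closedBall x R) (hR : 0 < R) (hxR : ‖x‖ + R < ρ)
    (hZ : G.singularSet c₀ ε Q T.c ρ ∩ closedBall x R ⊆ ⋃ i, ball (c i) (r i))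
    (hor : ∀ i, Orientable (G.dir ∘ squareAverage ε Q) (c i) (r i)) :
    Orientable (G.dir ∘ squareAverage ε Q) x R := by
  refine orientable_of_balls hr hdis (fun z => G.norm_dir _) hR hsub ?_ hor
  refine continuousOn_lineProj_average T hQ hε (ρ := ρ) (fun z hz => ?_) fun z hz hzZ =>
    hz.2 (hZ ⟨hzZ, hz.1⟩)
  have := hz.1
  rw [mem_closedBall, dist_eq_norm] at this
  rw [mem_ball_zero_iff]
  have h2 := norm_le_norm_add_norm_sub x z
  rw [norm_sub_rev] at h2
  linarith

/-- The ball construction for a map of class `C¹`. -/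
def vortexGrowth (T : G.Thresholds c₀) (hc₀ : 0 < c₀) (hQ : ContDiff ℝ 1 Q) (hε : 0 < ε)
    {ρ R : ℝ} (hρR : ρ ≤ R) (s₁ : ℝ) : BallGrowth where
  μ := energyMeasure G c₀ ε Q R
  Λ := logBound G.kappa (T.K * √ε)
  Z := G.singularSet c₀ ε Q T.c ρ
  ρ := ρ
  nontriv x r := 0 < r ∧ ‖x‖ + r < ρ ∧ ¬ Orientable (G.dir ∘ squareAverage ε Q) x r
  -- A ball of radius `2 ε` contains the square of half-width `ε`. A maximal family of singular
  -- points at mutual distance at least `4 ε` has disjoint balls of radius `2 ε`, while its balls of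
  -- radius `4 ε` cover the singular set.
  s₀ := 4 * ε
  s₁ := s₁
  s₀_pos := by positivity
  Λ_nonneg s _ := logBound_nonneg G.kappa_pos (mul_pos T.K_pos (Real.sqrt_pos.2 hε)) s
  Λ_mono s t _ hst := logBound_mono G.kappa_pos (mul_pos T.K_pos (Real.sqrt_pos.2 hε)) hst
  Λ_div s t hs hst := logBound_div G.kappa_pos (mul_pos T.K_pos (Real.sqrt_pos.2 hε))
    (lt_of_lt_of_le (by positivity) hs) hst
  nontriv_lt _ _ h := h.2.1
  exists_nontriv {ι} _ c r x R' hr hdis hsub hR' hZ h := by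
    by_contra hno
    push Not at hno
    refine h.2.2 (orientable_average_of_balls T hQ hε hr hdis hsub hR' h.2.1 hZ fun i => ?_)
    refine hno i (hr i) ?_
    have h1 := dist_add_le_of_closedBall_subset (hr i).le (hsub i)
    rw [dist_eq_norm] at h1
    have h2 := norm_le_norm_add_norm_sub x (c i)
    rw [norm_sub_rev] at h2
    linarith [h.2.1]
  growth x s t hs hst _ h hxt hZ := by
    have hs0 : 0 < s := lt_of_lt_of_le (by positivity) hs
    have hsub : ball x t \ ball x s ⊆ ball 0 ρ := fun z hz => by
      have := hz.1
      rw [mem_ball, dist_eq_norm] at this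
      rw [mem_ball_zero_iff]
      have h2 := norm_le_norm_add_norm_sub x z
      rw [norm_sub_rev] at h2
      linarith
    have hZ' : ∀ z ∈ ball x t \ ball x s, z ∉ G.singularSet c₀ ε Q T.c ρ := fun z hz hzZ => by
      have : z ∈ G.singularSet c₀ ε Q T.c ρ ∩ (ball x t \ ball x s) := ⟨hzZ, hz⟩
      rw [hZ] at this
      exact this
    rw [energyMeasure_apply (measurableSet_ball.diff measurableSet_ball)
      (hsub.trans (ball_subset_ball hρR)),
      lintegral_annulus (continuous_density hQ) (fun z => density_nonneg hc₀ z) x hs0]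
    refine logBound_sub_le_lintegral G.kappa_pos (mul_pos T.K_pos (Real.sqrt_pos.2 hε)) hs0 hst
      fun τ hτ => ?_
    have hτ0 : 0 < τ := hs0.trans_le hτ.1
    rw [mul_assoc, ← Real.sqrt_mul hε.le]
    refine T.le_circleEnergy hQ hε (by linarith [hτ.1]) (fun θ => ?_) fun hor => h.2.2 ?_
    · have hz : circleMap x τ θ ∈ ball x t \ ball x s := by
        simp only [Set.mem_sdiff, mem_ball, dist_eq_norm, circleMap_sub_center,
          norm_circleMap_zero, abs_of_pos hτ0, not_lt]
        exact ⟨hτ.2, hτ.1⟩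
      by_contra hneg
      exact hZ' _ hz ⟨hsub hz, not_lt.1 hneg⟩
    -- The annulus has no singular point, so an orientation on the circle of radius `τ` would
    -- propagate to the ball of radius `s`.
    · refine Orientable.of_annulus (fun z => G.norm_dir _) hτ.1 hs0.le ?_ hor
      have hss : closedBall x τ \ ball x s ⊆ ball x t \ ball x s :=
        Set.sdiff_subset_sdiff_left (closedBall_subset_ball hτ.2)
      exact continuousOn_lineProj_average T hQ hε (hss.trans hsub) fun z hz => hZ' z (hss hz)

theorem squareEnergy_le_lintegral (hc₀ : 0 < c₀) (hQ : ContDiff ℝ 1 Q) (hε : 0 < ε) (p : ℂ) :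
    ENNReal.ofReal (G.squareEnergy c₀ ε Q p) ≤
      ∫⁻ z in ball p (2 * ε), ENNReal.ofReal (G.density c₀ ε Q z) := by
  have hd := continuous_density (G := G) (c₀ := c₀) (ε := ε) hQ
  have hd0 : ∀ z, 0 ≤ G.density c₀ ε Q z := fun z => density_nonneg hc₀ z
  have hεε : -ε ≤ ε := by linarith
  have hdc : Continuous (Function.uncurry fun s t : ℝ =>
      G.density c₀ ε Q (p + (s + t * Complex.I))) := hd.comp (by fun_prop)
  have hmp := Complex.volume_preserving_equiv_real_prod.symm
  have e1 : ENNReal.ofReal (G.squareEnergy c₀ ε Q p) =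
      ∫⁻ q in Ioc (-ε) ε ×ˢ Ioc (-ε) ε,
        ENNReal.ofReal (G.density c₀ ε Q (p + (q.1 + q.2 * Complex.I))) := by
    unfold squareEnergy
    rw [intervalIntegral.integral_of_le hεε]
    simp only [intervalIntegral.integral_of_le hεε]
    have hi : Integrable (fun q : ℝ × ℝ => G.density c₀ ε Q (p + (q.1 + q.2 * Complex.I)))
        (volume.restrict (Ioc (-ε) ε ×ˢ Ioc (-ε) ε)) :=
      (hdc.continuousOn.integrableOn_compact (isCompact_Icc.prod isCompact_Icc)).mono_set
        (prod_mono Ioc_subset_Icc_self Ioc_subset_Icc_self)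
    rw [Measure.volume_eq_prod, ← Measure.prod_restrict] at hi ⊢
    rw [← ofReal_integral_eq_lintegral_ofReal hi (Eventually.of_forall fun q => hd0 _),
      integral_prod _ hi]
  rw [e1]
  have e2 : ∫⁻ z in ball p (2 * ε), ENNReal.ofReal (G.density c₀ ε Q z) =
      ∫⁻ q : ℝ × ℝ, (ball p (2 * ε)).indicator (fun z => ENNReal.ofReal (G.density c₀ ε Q z))
        (p + (q.1 + q.2 * Complex.I)) := by
    rw [← lintegral_indicator measurableSet_ball, ← lintegral_add_left_eq_self _ p,
      ← hmp.lintegral_comp_emb Complex.measurableEquivRealProd.symm.measurableEmbedding]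
    simp [Complex.measurableEquivRealProd_symm_apply, Complex.mk_eq_add_mul_I]
  rw [e2, ← lintegral_indicator (measurableSet_Ioc.prod measurableSet_Ioc)]
  refine lintegral_mono fun q => ?_
  by_cases hq : q ∈ Ioc (-ε) ε ×ˢ Ioc (-ε) ε
  · rw [indicator_of_mem hq, indicator_of_mem]
    rw [mem_ball, dist_eq_norm, add_sub_cancel_left]
    have h1 : |q.1| ≤ ε := abs_le.2 ⟨hq.1.1.le, hq.1.2⟩
    have h2 : |q.2| ≤ ε := abs_le.2 ⟨hq.2.1.le, hq.2.2⟩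
    rw [Complex.norm_add_mul_I]
    apply (Real.sqrt_lt' (by positivity)).2
    nlinarith [sq_le_sq' (by linarith [abs_nonneg q.1]) h1,
      sq_le_sq' (by linarith [abs_nonneg q.2]) h2, sq_abs q.1, sq_abs q.2]
  · rw [indicator_of_notMem hq]
    exact zero_le

/-- Each singular point carries energy at least `c` within distance `2 ε`. At the radius `4 ε` the
required amount `2 κ log (1 + 2 / K)` is at most `4 κ / K`, which the choice of `K` keeps below `c`.
-/
theorem exists_hasFamily_vortexGrowth (T : G.Thresholds c₀) (hc₀ : 0 < c₀) (hQ : ContDiff ℝ 1 Q)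
    (hε : 0 < ε) {ρ R : ℝ} (hρR : ρ + 2 * ε ≤ R) (hρ : ρ ≤ R) (s₁ : ℝ)
    (hfin : energyMeasure G c₀ ε Q R univ ≠ ⊤) :
    ∃ n, (vortexGrowth T hc₀ hQ hε hρ s₁).HasFamily (4 * ε) n := by
  have : IsFiniteMeasure (energyMeasure G c₀ ε Q R) := ⟨lt_top_iff_ne_top.2 hfin⟩
  have hZ : ∀ x ∈ G.singularSet c₀ ε Q T.c ρ,
      ENNReal.ofReal T.c ≤ energyMeasure G c₀ ε Q R (ball x (4 * ε / 2)) := by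
    intro x hx
    rw [show 4 * ε / 2 = 2 * ε by ring, energyMeasure_apply measurableSet_ball]
    · exact (ENNReal.ofReal_le_ofReal hx.2).trans (squareEnergy_le_lintegral hc₀ hQ hε x)
    · apply ball_subset_ball'
      have := mem_ball.1 hx.1
      linarith
  obtain ⟨S, hSfin, hSZ, hdis, hcov⟩ := exists_finite_cover (δ := 4 * ε) (by positivity)
    T.c_pos hZ
  have := hSfin.fintype
  refine BallGrowth.exists_hasFamily_initial (B := vortexGrowth T hc₀ hQ hε hρ s₁)
    (ι := S) (x := fun x => x) (A := fun x => ball (x : ℂ) (4 * ε / 2))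
    (fun _ => measurableSet_ball) hdis (fun x => ball_subset_ball (by
      change 4 * ε / 2 ≤ 4 * ε
      linarith)) (fun x => ?_) hcov
  refine le_trans (ENNReal.ofReal_le_ofReal ?_) (hZ x (hSZ x.2))
  change logBound G.kappa (T.K * √ε) (4 * ε) ≤ T.c
  have hK := T.K_pos
  have hκ := G.kappa_pos
  have hsε := Real.sqrt_pos.2 hε
  unfold logBound
  rw [sqrt_four_mul]
  have h1 : 2 * √ε / (T.K * √ε) = 2 / T.K := by field_simp
  have h2 := Real.log_le_sub_one_of_pos (show 0 < 1 + 2 / T.K by positivity)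
  rw [h1]
  have h3 : 2 * G.kappa * Real.log (1 + 2 / T.K) ≤ 2 * G.kappa * (2 / T.K) := by
    gcongr; linarith
  refine h3.trans ?_
  rw [← mul_div_assoc, div_le_iff₀ hK]
  linarith [T.kappa_le]

end GapField

/-! ### The sharp lower bound for maps of class `C¹`. -/

namespace GapField

variable {V F : Type*} [NormedAddCommGroup V] [NormedSpace ℝ V]
  [NormedAddCommGroup F] [InnerProductSpace ℝ F] {G : GapField V F} {c₀ ε : ℝ} {Q : ℂ → V}

theorem volume_iUnion_Icc_le {ι : Type*} [Fintype ι] (a r : ι → ℝ) (hr : ∀ i, 0 ≤ r i) :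
    volume (⋃ i, Icc (a i - r i) (a i + r i)) ≤ ENNReal.ofReal (2 * ∑ i, r i) := by
  refine (measure_iUnion_fintype_le _ _).trans (le_of_eq ?_)
  rw [Finset.mul_sum, ENNReal.ofReal_sum_of_nonneg fun i _ => by have := hr i; positivity]
  refine Finset.sum_congr rfl fun i _ => ?_
  rw [Real.volume_Icc]
  congr 1; ring

theorem continuous_circleEnergy (hQ : ContDiff ℝ 1 Q) (x : ℂ) :
    Continuous (G.circleEnergy c₀ ε Q x) := by
  unfold circleEnergy
  refine intervalIntegral.continuous_parametric_intervalIntegral_of_continuous'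
    (f := fun τ θ => G.density c₀ ε Q (circleMap x τ θ) * τ) ?_ _ _
  have h : Continuous fun p : ℝ × ℝ => circleMap x p.1 p.2 := by unfold circleMap; fun_prop
  exact ((continuous_density hQ).comp h).mul continuous_fst

/-- The radii of the circles of high energy. -/
theorem volume_high_energy_le (hc₀ : 0 < c₀) (hQ : ContDiff ℝ 1 Q) {s t R : ℝ} (hs : 0 < s)
    (htR : t ≤ R) {e L : ℝ} (he : 0 < e)
    (hE : energyMeasure G c₀ ε Q R univ ≤ ENNReal.ofReal L) :
    volume (Ico s t ∩ {τ | e ≤ G.circleEnergy c₀ ε Q 0 τ}) ≤ ENNReal.ofReal (L / e) := by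
  have hm : Measurable (G.circleEnergy c₀ ε Q 0) := (continuous_circleEnergy hQ 0).measurable
  have h1 := mul_meas_ge_le_lintegral (μ := volume.restrict (Ico s t))
    (ENNReal.measurable_ofReal.comp hm) (ENNReal.ofReal e)
  have h2 : ∫⁻ τ in Ico s t, ENNReal.ofReal (G.circleEnergy c₀ ε Q 0 τ) ≤ ENNReal.ofReal L := by
    refine le_trans ?_ hE
    have := lintegral_annulus (continuous_density (G := G) (c₀ := c₀) (ε := ε) hQ)
      (fun z => density_nonneg hc₀ z) 0 (t := t) hs
    rw [energyMeasure_univ]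
    refine this.symm.le.trans (lintegral_mono_set ?_)
    exact sdiff_subset.trans (ball_subset_ball htR)
  have h3 : volume.restrict (Ico s t) {τ | e ≤ G.circleEnergy c₀ ε Q 0 τ} ≤
      volume.restrict (Ico s t) {τ | ENNReal.ofReal e ≤
        (ENNReal.ofReal ∘ G.circleEnergy c₀ ε Q 0) τ} :=
    measure_mono fun τ hτ => ENNReal.ofReal_le_ofReal hτ
  rw [Measure.restrict_apply (measurableSet_le measurable_const hm), inter_comm] at h3
  refine h3.trans ?_
  rw [ENNReal.ofReal_div_of_pos he, ENNReal.le_div_iff_mul_le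
    (Or.inl (ENNReal.ofReal_pos.2 he).ne') (Or.inl ENNReal.ofReal_ne_top), mul_comm]
  exact h1.trans h2

theorem log_le_logBound (T : G.Thresholds c₀) (hε : 0 < ε) {s : ℝ} (hs : 0 < s) :
    2 * G.kappa * Real.log (√s / T.K) - G.kappa * Real.log ε ≤
      logBound G.kappa (T.K * √ε) s := by
  have hK := T.K_pos
  have hκ := G.kappa_pos
  have hsε := Real.sqrt_pos.2 hε
  have hss := Real.sqrt_pos.2 hs
  have h1 : Real.log (√s / (T.K * √ε)) = Real.log (√s / T.K) - Real.log ε / 2 := by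
    rw [← div_div, Real.log_div (by positivity) (by positivity), Real.log_sqrt hε.le]
  have h2 : Real.log (√s / (T.K * √ε)) ≤ Real.log (1 + √s / (T.K * √ε)) :=
    Real.log_le_log (by positivity) (by linarith)
  unfold logBound
  nlinarith

/-- Circles of energy at least `c / ε` occupy at most this measure of radii if the total energy is
below `logBound`. The bound is independent of `ε` because `logBound` is at most of order `1 / √ε`.
-/
theorem logBound_le (T : G.Thresholds c₀) (hε : 0 < ε) (hε1 : ε < 1) :
    logBound G.kappa (T.K * √ε) (1 / 32) / (T.c / ε) ≤ 1 / 16 := by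
  have hK := T.K_pos
  have hc := T.c_pos
  have hκ := G.kappa_pos
  have hsε := Real.sqrt_pos.2 hε
  have hs : √(1 / 32) ≤ 3 / 16 := by
    rw [Real.sqrt_le_left (by norm_num)]; norm_num
  have hs0 := Real.sqrt_nonneg (1 / 32)
  have hsε1 : √ε ≤ 1 := Real.sqrt_le_one.2 hε1.le
  have h1 := Real.log_le_sub_one_of_pos (show 0 < 1 + √(1 / 32) / (T.K * √ε) by positivity)
  have h2 : logBound G.kappa (T.K * √ε) (1 / 32) ≤ 2 * G.kappa * (√(1 / 32) / (T.K * √ε)) := by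
    unfold logBound
    gcongr; linarith
  rw [div_le_iff₀ (by positivity)]
  refine h2.trans ?_
  rw [← mul_div_assoc, ← mul_div_assoc, div_le_div_iff₀ (by positivity) hε]
  have h3 : ε = √ε * √ε := (Real.mul_self_sqrt hε.le).symm
  calc 2 * G.kappa * √(1 / 32) * ε = (2 * G.kappa * √(1 / 32) * √ε) * √ε := by
        rw [mul_assoc (2 * G.kappa * √(1 / 32)), ← h3]
    _ ≤ (2 * G.kappa * (3 / 16) * 1) * √ε := by gcongr
    _ ≤ 1 / 16 * T.c * (T.K * √ε) := by nlinarith [T.kappa_le]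

/-- The sharp lower bound for the energy of maps of class `C¹` whose direction turns by a half
turn on many circles. -/
theorem exists_energy_ge (G : GapField V F) [CompleteSpace V] (hc₀ : 0 < c₀) :
    ∃ M : ℝ, 0 < M ∧ ∀ {Q : ℂ → V}, ContDiff ℝ 1 Q → ∀ {ε : ℝ}, 0 < ε → ε < 1 → ∀ {N : Set ℝ},
      N ⊆ Ioo (1 / 2) (7 / 8) → ENNReal.ofReal (1 / 8) < volume N →
      (∀ r ∈ N, ¬ Orientable (G.dir ∘ Q) 0 r) →
      ENNReal.ofReal (G.kappa * |Real.log ε| - M) ≤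
        ∫⁻ z in ball 0 (31 / 32), ENNReal.ofReal (G.density c₀ ε Q z) := by
  obtain ⟨T⟩ := nonempty_thresholds G hc₀
  have hκ := G.kappa_pos
  have hc := T.c_pos
  obtain ⟨C, hC⟩ : ∃ C, C = 2 * G.kappa * Real.log (√(1 / 32) / T.K) := ⟨_, rfl⟩
  have hlog160 : 0 < Real.log 160 := Real.log_pos (by norm_num)
  refine ⟨G.kappa * Real.log 160 + |C|, by positivity, ?_⟩
  intro Q hQ ε hε hε1 N hN hNvol hor
  have hlogε : |Real.log ε| = -Real.log ε := abs_of_neg (Real.log_neg hε hε1)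
  -- For larger `ε` the constant makes the left side nonpositive. For smaller `ε` the initial radius
  -- `4 ε` is below the final one `1 / 32`, and squares centred in the disk of radius `15 / 16` stay
  -- in the disk of radius `31 / 32`.
  rcases lt_or_ge (1 / 160) ε with hbig | hsmall
  · have h1 : -Real.log ε ≤ Real.log 160 := by
      rw [← Real.log_inv]
      refine Real.log_le_log (by positivity) ?_
      rw [inv_le_comm₀ hε (by norm_num)]; linarith
    rw [ENNReal.ofReal_of_nonpos]
    · exact zero_le
    · rw [hlogε]
      have := mul_le_mul_of_nonneg_left h1 hκ.le
      linarith [abs_nonneg C]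
  by_contra! hlt
  obtain ⟨Λ, hΛ⟩ : ∃ Λ, Λ = logBound G.kappa (T.K * √ε) (1 / 32) := ⟨_, rfl⟩
  have hΛ0 : 0 ≤ Λ := hΛ ▸ logBound_nonneg hκ (mul_pos T.K_pos (Real.sqrt_pos.2 hε)) _
  have hE : energyMeasure G c₀ ε Q (31 / 32) univ < ENNReal.ofReal Λ := by
    rw [energyMeasure_univ]
    refine hlt.trans_le (ENNReal.ofReal_le_ofReal ?_)
    have := log_le_logBound T hε (show (0 : ℝ) < 1 / 32 by norm_num)
    rw [← hC, ← hΛ] at this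
    have h2 : 0 < G.kappa * Real.log 160 := by positivity
    rw [hlogε]
    linarith [neg_abs_le C]
  obtain ⟨n, hn⟩ := exists_hasFamily_vortexGrowth T hc₀ hQ hε (ρ := 15 / 16) (R := 31 / 32)
    (by linarith) (by norm_num) (1 / 32) (hE.trans ENNReal.ofReal_lt_top).ne
  obtain ⟨B, hB⟩ : ∃ B, B = vortexGrowth T hc₀ hQ hε
    (show (15 / 16 : ℝ) ≤ 31 / 32 by norm_num) (1 / 32) := ⟨_, rfl⟩
  rw [← hB] at hn
  have hs₀ : B.s₀ = 4 * ε := by rw [hB]; rfl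
  have hs₁ : B.s₁ = 1 / 32 := by rw [hB]; rfl
  rw [← hs₀] at hn
  have hs01 : B.s₀ ≤ B.s₁ := by rw [hs₀, hs₁]; linarith
  obtain ⟨m, hm⟩ := hn.exists_final le_rfl hs01
  obtain ⟨ι, _, c, r, hr, hdis, hcov, hsum, htriv⟩ := hm.sum_radius_lt hs01 (by
    rw [hs₁, hB]
    exact hE.trans_eq (by rw [hΛ]; rfl))
  have hZ : B.Z = G.singularSet c₀ ε Q T.c (15 / 16) := by rw [hB]; rfl
  have hnon : ∀ i, ‖c i‖ + r i < 15 / 16 →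
      Orientable (G.dir ∘ squareAverage ε Q) (c i) (r i) := by
    intro i hi
    by_contra hno
    apply htriv i
    rw [hB]
    exact ⟨hr i, hi, hno⟩
  rw [hZ] at hcov
  rw [hs₁] at hsum
  -- The radii of circles meeting some ball have measure at most twice the sum of the radii, hence
  -- at most `1 / 16`, and those of circles of high energy again at most `1 / 16`; together they
  -- cannot exhaust `N`.
  obtain ⟨ρ, hρN, hρ⟩ : ∃ ρ ∈ N, ρ ∉ (⋃ i, Icc (‖c i‖ - r i) (‖c i‖ + r i)) ∪
      (Ico (1 / 2) (7 / 8) ∩ {τ | T.c / ε ≤ G.circleEnergy c₀ ε Q 0 τ}) := by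
    by_contra! hsub
    have h1 := volume_iUnion_Icc_le (fun i => ‖c i‖) r fun i => (hr i).le
    have h2 := volume_high_energy_le (s := 1 / 2) (t := 7 / 8) hc₀ hQ (by norm_num)
      (by norm_num) (show 0 < T.c / ε by positivity) hE.le
    have h3 : volume N ≤ ENNReal.ofReal (1 / 16) + ENNReal.ofReal (1 / 16) :=
      (measure_mono hsub).trans ((measure_union_le _ _).trans (add_le_add
        (h1.trans (ENNReal.ofReal_le_ofReal (by linarith)))
        (h2.trans (ENNReal.ofReal_le_ofReal (by rw [hΛ]; exact logBound_le T hε hε1)))))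
    rw [← ENNReal.ofReal_add (by norm_num) (by norm_num)] at h3
    norm_num at h3 hNvol
    exact absurd hNvol (not_lt.2 h3)
  have hρI := hN hρN
  have hρ0 : 0 < ρ := by linarith [hρI.1]
  rw [mem_union, not_or] at hρ
  have hsep : ∀ i, ‖c i‖ + r i < ρ ∨ ρ < ‖c i‖ - r i := by
    intro i
    by_contra! h
    exact hρ.1 (mem_iUnion.2 ⟨i, h.2, h.1⟩)
  have hlowE : G.circleEnergy c₀ ε Q 0 ρ < T.c / ε := by
    by_contra! h
    exact hρ.2 ⟨⟨hρI.1.le, hρI.2⟩, h⟩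
  have hin : ∀ z ∈ G.singularSet c₀ ε Q T.c (15 / 16), ‖z‖ ≤ ρ →
      ∃ i, ‖c i‖ + r i < ρ ∧ z ∈ ball (c i) (r i) := by
    intro z hz hzρ
    obtain ⟨i, hi⟩ := mem_iUnion.1 (hcov hz)
    refine ⟨i, (hsep i).resolve_right fun h => ?_, hi⟩
    rw [mem_ball, dist_eq_norm] at hi
    have := norm_le_norm_add_norm_sub z (c i)
    linarith
  -- Every singular point in the closed disk of radius `ρ` lies in a ball strictly inside it. All
  -- such balls have an orientable boundary, so the averages are orientable on the circle; the low
  -- energy transfers this to `Q`.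
  have hoa : Orientable (G.dir ∘ squareAverage ε Q) 0 ρ := by
    refine orientable_average_of_balls T hQ hε (ι := {i // ‖c i‖ + r i < ρ}) (ρ := 15 / 16)
      (c := fun i => c i) (r := fun i => r i) (fun i => hr i)
      (fun i j hij => hdis fun e => hij (Subtype.ext e)) (fun i => ?_) hρ0
      (by rw [norm_zero]; linarith [hρI.2]) (fun z hz => ?_) fun i => hnon i (by
        linarith [hρI.2, i.2])
    · apply closedBall_subset_closedBall'
      rw [dist_zero_right]; linarith [i.2]
    · obtain ⟨i, hi, hzi⟩ := hin z hz.1 (mem_closedBall_zero_iff.1 hz.2)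
      exact mem_iUnion.2 ⟨⟨i, hi⟩, hzi⟩
  refine hor ρ hρN ((T.orientable_iff hQ hε (by linarith [hρI.1]) (fun θ => ?_) hlowE).1 hoa)
  by_contra! hθ
  have hnorm : ‖circleMap 0 ρ θ‖ = ρ := by rw [norm_circleMap_zero, abs_of_pos hρ0]
  obtain ⟨i, hi, hzi⟩ := hin (circleMap 0 ρ θ)
    ⟨by rw [mem_ball_zero_iff, hnorm]; linarith [hρI.2], hθ⟩ hnorm.le
  rw [mem_ball, dist_eq_norm] at hzi
  have := norm_le_norm_add_norm_sub (c i) (circleMap 0 ρ θ)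
  rw [norm_sub_rev] at hzi
  rw [norm_sub_rev] at this
  have h3 := norm_le_norm_add_norm_sub (circleMap 0 ρ θ) (c i)
  have h4 := norm_sub_rev (circleMap 0 ρ θ) (c i)
  have h5 := norm_sub_norm_le (circleMap 0 ρ θ) (c i)
  linarith

end GapField

/-! ### Eigenvalues and eigenvectors -/

/-- The smallest eigenvalue. -/
def eig3 (Q : S0) : ℝ := (isHermitian Q).eigenvalues₀ ⟨2, by simp⟩

theorem eig2_le_eig1 (Q : S0) : eig2 Q ≤ eig1 Q :=
  (isHermitian Q).eigenvalues₀_antitone (by simp)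

theorem eig3_le_eig2 (Q : S0) : eig3 Q ≤ eig2 Q :=
  (isHermitian Q).eigenvalues₀_antitone (by simp [Fin.le_def])

/-- The position of the eigenvalues in the decreasing enumeration. -/
def eigenIndex : Fin 3 ≃ Fin 3 :=
  (finCongr (Fintype.card_fin 3).symm).trans
    (Fintype.equivOfCardEq (Fintype.card_fin (Fintype.card (Fin 3))))

theorem eigenvalues_eigenIndex (Q : S0) (j : Fin 3) :
    (isHermitian Q).eigenvalues (eigenIndex j) =
      (isHermitian Q).eigenvalues₀ (finCongr (Fintype.card_fin 3).symm j) := by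
  simp [Matrix.IsHermitian.eigenvalues, eigenIndex]

theorem sum_eigenvalues (Q : S0) (g : ℝ → ℝ) :
    ∑ i, g ((isHermitian Q).eigenvalues i) = g (eig1 Q) + g (eig2 Q) + g (eig3 Q) := by
  rw [← eigenIndex.sum_comp, Fin.sum_univ_three]
  simp only [eigenvalues_eigenIndex]
  rfl

/-- Diagonalisation and invariance of the trace under conjugation. -/
theorem trace_pow (Q : S0) (k : ℕ) :
    (Q.1 ^ k).trace = eig1 Q ^ k + eig2 Q ^ k + eig3 Q ^ k := by
  rw [← sum_eigenvalues Q fun t => t ^ k]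
  conv_lhs => rw [(isHermitian Q).spectral_theorem, ← map_pow, Unitary.conjStarAlgAut_apply,
    Matrix.trace_mul_comm, ← mul_assoc, Unitary.coe_star_mul_self, one_mul, Matrix.diagonal_pow,
    Matrix.trace_diagonal]
  simp

theorem eig_sum (Q : S0) : eig1 Q + eig2 Q + eig3 Q = 0 := by
  have h := trace_pow Q 1
  rw [pow_one, Q.2.2] at h
  simpa using h.symm

/-- An orthonormal frame of eigenvectors. -/
structure IsFrame (Q : S0) (e : Fin 3 → Fin 3 → ℝ) : Prop where
  orth : ∀ i j, e i ⬝ᵥ e j = if i = j then 1 else 0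
  expand : ∀ x : Fin 3 → ℝ, x = ∑ j, (x ⬝ᵥ e j) • e j
  eig_zero : Q.1 *ᵥ e 0 = eig1 Q • e 0
  eig_one : Q.1 *ᵥ e 1 = eig2 Q • e 1
  eig_two : Q.1 *ᵥ e 2 = eig3 Q • e 2

theorem exists_isFrame (Q : S0) : ∃ e, IsFrame Q e := by
  let b := (isHermitian Q).eigenvectorBasis
  have hb : ∀ j, Q.1 *ᵥ ⇑(b (eigenIndex j)) =
      (isHermitian Q).eigenvalues₀ (finCongr (Fintype.card_fin 3).symm j) •
        ⇑(b (eigenIndex j)) := fun j => by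
    rw [(isHermitian Q).mulVec_eigenvectorBasis, eigenvalues_eigenIndex]
  refine ⟨fun j => ⇑(b (eigenIndex j)), ?_, ?_, hb 0, hb 1, hb 2⟩
  · intro i j
    have h := orthonormal_iff_ite.1 b.orthonormal (eigenIndex j) (eigenIndex i)
    rw [EuclideanSpace.inner_eq_star_dotProduct] at h
    simp only [star_trivial, EmbeddingLike.apply_eq_iff_eq] at h
    rw [h]
    simp only [eq_comm]
  · intro x
    have h := b.sum_repr' (WithLp.toLp 2 x)
    rw [← eigenIndex.sum_comp] at h
    have h2 := congrArg WithLp.ofLp h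
    simp only [EuclideanSpace.inner_eq_star_dotProduct, star_trivial] at h2
    conv_lhs => rw [← h2, WithLp.ofLp_sum]
    rfl

namespace IsFrame

variable {Q : S0} {e : Fin 3 → Fin 3 → ℝ}

theorem dotProduct_self (h : IsFrame Q e) (x : Fin 3 → ℝ) :
    x ⬝ᵥ x = (x ⬝ᵥ e 0) ^ 2 + (x ⬝ᵥ e 1) ^ 2 + (x ⬝ᵥ e 2) ^ 2 := by
  conv_lhs => rw [h.expand x]
  rw [sum_dotProduct, Fin.sum_univ_three]
  simp only [smul_dotProduct, smul_eq_mul]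
  conv_lhs => simp only [← h.expand x]
  rw [dotProduct_comm (e 0), dotProduct_comm (e 1), dotProduct_comm (e 2)]
  ring

theorem mulVec (h : IsFrame Q e) (x : Fin 3 → ℝ) : Q.1 *ᵥ x =
    (eig1 Q * (x ⬝ᵥ e 0)) • e 0 + (eig2 Q * (x ⬝ᵥ e 1)) • e 1 + (eig3 Q * (x ⬝ᵥ e 2)) • e 2 := by
  conv_lhs => rw [h.expand x]
  rw [Fin.sum_univ_three, Matrix.mulVec_add, Matrix.mulVec_add, Matrix.mulVec_smul,
    Matrix.mulVec_smul, Matrix.mulVec_smul, h.eig_zero, h.eig_one, h.eig_two, smul_smul,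
    smul_smul, smul_smul, mul_comm, mul_comm (x ⬝ᵥ e 1), mul_comm (x ⬝ᵥ e 2)]

theorem quadratic (h : IsFrame Q e) (x : Fin 3 → ℝ) : x ⬝ᵥ Q.1 *ᵥ x =
    eig1 Q * (x ⬝ᵥ e 0) ^ 2 + eig2 Q * (x ⬝ᵥ e 1) ^ 2 + eig3 Q * (x ⬝ᵥ e 2) ^ 2 := by
  rw [h.mulVec, dotProduct_add, dotProduct_add, dotProduct_smul, dotProduct_smul,
    dotProduct_smul]
  simp only [smul_eq_mul]
  ring

theorem dotProduct_eq_zero (h : IsFrame Q e) {n : Fin 3 → ℝ} (hn : Q.1 *ᵥ n = eig1 Q • n)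
    (hlt : eig2 Q < eig1 Q) : n ⬝ᵥ e 1 = 0 ∧ n ⬝ᵥ e 2 = 0 := by
  have h3 := eig3_le_eig2 Q
  rw [h.mulVec] at hn
  have o : ∀ i j, i ≠ j → e i ⬝ᵥ e j = 0 := fun i j hij => by rw [h.orth, if_neg hij]
  have o1 : ∀ i, e i ⬝ᵥ e i = 1 := fun i => by rw [h.orth, if_pos rfl]
  constructor
  · have h1 := congrArg (fun v => v ⬝ᵥ e 1) hn
    simp only [add_dotProduct, smul_dotProduct, o 0 1 (by decide), o 2 1 (by decide), o1,
      smul_eq_mul] at h1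
    have h2 : (eig1 Q - eig2 Q) * (n ⬝ᵥ e 1) = 0 := by linarith
    exact (mul_eq_zero.1 h2).resolve_left (by linarith)
  · have h1 := congrArg (fun v => v ⬝ᵥ e 2) hn
    simp only [add_dotProduct, smul_dotProduct, o 0 2 (by decide), o 1 2 (by decide), o1,
      smul_eq_mul] at h1
    have h2 : (eig1 Q - eig3 Q) * (n ⬝ᵥ e 2) = 0 := by linarith
    exact (mul_eq_zero.1 h2).resolve_left (by linarith)

end IsFrame

theorem quadratic_le (Q : S0) {x : Fin 3 → ℝ} (hx : x ⬝ᵥ x = 1) : x ⬝ᵥ Q.1 *ᵥ x ≤ eig1 Q := by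
  obtain ⟨e, h⟩ := exists_isFrame Q
  have h1 := h.dotProduct_self x
  have h2 := eig2_le_eig1 Q
  have h3 := eig3_le_eig2 Q
  rw [h.quadratic]
  rw [hx] at h1
  have e0 : (x ⬝ᵥ e 0) ^ 2 = 1 - (x ⬝ᵥ e 1) ^ 2 - (x ⬝ᵥ e 2) ^ 2 := by linarith
  rw [e0]
  linarith [mul_nonneg (sub_nonneg.2 h2) (sq_nonneg (x ⬝ᵥ e 1)),
    mul_nonneg (sub_nonneg.2 (h3.trans h2)) (sq_nonneg (x ⬝ᵥ e 2))]

theorem le_quadratic (Q : S0) {x : Fin 3 → ℝ} (hx : x ⬝ᵥ x = 1) : eig3 Q ≤ x ⬝ᵥ Q.1 *ᵥ x := by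
  obtain ⟨e, h⟩ := exists_isFrame Q
  have h1 := h.dotProduct_self x
  have h2 := eig2_le_eig1 Q
  have h3 := eig3_le_eig2 Q
  rw [h.quadratic]
  rw [hx] at h1
  have e0 : (x ⬝ᵥ e 2) ^ 2 = 1 - (x ⬝ᵥ e 1) ^ 2 - (x ⬝ᵥ e 0) ^ 2 := by linarith
  rw [e0]
  linarith [mul_nonneg (sub_nonneg.2 h3) (sq_nonneg (x ⬝ᵥ e 1)),
    mul_nonneg (sub_nonneg.2 (h3.trans h2)) (sq_nonneg (x ⬝ᵥ e 0))]

/-- The quadratic form of `Q` away from a leading eigenvector. -/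
theorem quadratic_le_of_gap (Q : S0) (hlt : eig2 Q < eig1 Q) {n x : Fin 3 → ℝ} (hn1 : n ⬝ᵥ n = 1)
    (hn : Q.1 *ᵥ n = eig1 Q • n) (hx : x ⬝ᵥ x = 1) :
    (eig1 Q - eig2 Q) * (1 - (n ⬝ᵥ x) ^ 2) ≤ eig1 Q - x ⬝ᵥ Q.1 *ᵥ x := by
  obtain ⟨e, h⟩ := exists_isFrame Q
  obtain ⟨h1, h2⟩ := h.dotProduct_eq_zero hn hlt
  have h3 := h.dotProduct_self n
  rw [hn1, h1, h2] at h3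
  have h4 := h.dotProduct_self x
  rw [hx] at h4
  have h5 : n ⬝ᵥ x = (n ⬝ᵥ e 0) * (x ⬝ᵥ e 0) := by
    conv_lhs => rw [h.expand n]
    rw [Fin.sum_univ_three, h1, h2, zero_smul, zero_smul, add_zero, add_zero, smul_dotProduct,
      dotProduct_comm (e 0), smul_eq_mul]
  have h6 : (n ⬝ᵥ x) ^ 2 = (x ⬝ᵥ e 0) ^ 2 := by
    rw [h5, mul_pow]; nlinarith
  rw [h6, h.quadratic]
  have e0 : (x ⬝ᵥ e 1) ^ 2 = 1 - (x ⬝ᵥ e 0) ^ 2 - (x ⬝ᵥ e 2) ^ 2 := by linarith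
  rw [e0]
  linarith [mul_nonneg (sub_nonneg.2 (eig3_le_eig2 Q)) (sq_nonneg (x ⬝ᵥ e 2))]

theorem dotProduct_mulVec_leading (Q : S0) :
    leadingEigenvector Q ⬝ᵥ Q.1 *ᵥ leadingEigenvector Q = eig1 Q := by
  obtain ⟨h1, h2⟩ := (exists_leadingEigenvector Q).choose_spec
  change leadingEigenvector Q ⬝ᵥ leadingEigenvector Q = 1 at h1
  change Q.1 *ᵥ leadingEigenvector Q = eig1 Q • leadingEigenvector Q at h2
  rw [h2, dotProduct_smul, h1, smul_eq_mul, mul_one]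

theorem leadingEigenvector_dotProduct (Q : S0) :
    leadingEigenvector Q ⬝ᵥ leadingEigenvector Q = 1 :=
  (exists_leadingEigenvector Q).choose_spec.1

theorem mulVec_leadingEigenvector (Q : S0) :
    Q.1 *ᵥ leadingEigenvector Q = eig1 Q • leadingEigenvector Q :=
  (exists_leadingEigenvector Q).choose_spec.2

/-! ### Comparison of two tensors -/

/-- The Euclidean space of `3 × 3` matrices. -/
abbrev MatrixSpace : Type := EuclideanSpace ℝ (Fin 3 × Fin 3)

/-- The entries of a tensor. -/
def entries : S0 →ₗ[ℝ] MatrixSpace where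
  toFun Q := WithLp.toLp 2 fun p => Q.1 p.1 p.2
  map_add' _ _ := rfl
  map_smul' _ _ := rfl

theorem entries_apply (Q : S0) (p : Fin 3 × Fin 3) : entries Q p = Q.1 p.1 p.2 := rfl

/-- The matrix `x ⊗ x`. -/
def square (x : Fin 3 → ℝ) : MatrixSpace := WithLp.toLp 2 fun p => x p.1 * x p.2

theorem inner_square (Q : S0) (x : Fin 3 → ℝ) :
    inner ℝ (square x) (entries Q) = x ⬝ᵥ Q.1 *ᵥ x := by
  rw [EuclideanSpace.inner_eq_star_dotProduct]
  simp only [dotProduct, Matrix.mulVec, entries_apply, square, star_trivial,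
    Fintype.sum_prod_type, Finset.mul_sum]
  refine Finset.sum_congr rfl fun i _ => Finset.sum_congr rfl fun j _ => ?_
  ring

theorem inner_square_square (x y : Fin 3 → ℝ) :
    inner ℝ (square x) (square y) = (x ⬝ᵥ y) ^ 2 := by
  rw [EuclideanSpace.inner_eq_star_dotProduct]
  simp only [dotProduct, square, star_trivial, Fintype.sum_prod_type, sq, Finset.mul_sum,
    Finset.sum_mul]
  refine Finset.sum_congr rfl fun i _ => Finset.sum_congr rfl fun j _ => ?_
  ring

theorem norm_square {x : Fin 3 → ℝ} (hx : x ⬝ᵥ x = 1) : ‖square x‖ = 1 := by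
  have h := inner_square_square x x
  rw [hx, real_inner_self_eq_norm_sq] at h
  nlinarith [norm_nonneg (square x)]

theorem quadratic_sub_le (P Q : S0) {x : Fin 3 → ℝ} (hx : x ⬝ᵥ x = 1) :
    x ⬝ᵥ P.1 *ᵥ x - x ⬝ᵥ Q.1 *ᵥ x ≤ ‖entries P - entries Q‖ := by
  rw [← inner_square, ← inner_square, ← inner_sub_right]
  have := real_inner_le_norm (square x) (entries P - entries Q)
  rwa [norm_square hx, one_mul] at this

theorem eig1_sub_le (P Q : S0) : eig1 P - eig1 Q ≤ ‖entries P - entries Q‖ := by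
  have h1 := quadratic_sub_le P Q (leadingEigenvector_dotProduct P)
  have h2 := quadratic_le Q (leadingEigenvector_dotProduct P)
  rw [dotProduct_mulVec_leading] at h1
  linarith

theorem eig3_sub_le (P Q : S0) : eig3 P - eig3 Q ≤ ‖entries P - entries Q‖ := by
  obtain ⟨e, he⟩ := exists_isFrame Q
  have h0 : e 2 ⬝ᵥ e 2 = 1 := by simp [he.orth]
  have h1 := quadratic_sub_le P Q h0
  have h2 := le_quadratic P h0
  rw [he.eig_two, dotProduct_smul, h0, smul_eq_mul, mul_one] at h1
  linarith

/-- Since the trace vanishes, `λ₁ - λ₂ = 2 λ₁ + λ₃`, and each extreme eigenvalue is 1-Lipschitz by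
the Rayleigh quotient. -/
theorem gap_sub_le (P Q : S0) :
    (eig1 P - eig2 P) - (eig1 Q - eig2 Q) ≤ 3 * ‖entries P - entries Q‖ := by
  have h1 := eig1_sub_le P Q
  have h3 := eig3_sub_le P Q
  have hP := eig_sum P
  have hQ := eig_sum Q
  linarith

/-- The difference `P - Q` is tested against `n ⊗ n - d ⊗ d`. With `t = 1 - (n ⬝ᵥ d)²`, each tensor
contributes at least `m t` because its quadratic form drops by the gap away from its leading line,
while the test matrix has squared norm `2 t`. This sharp constant is what produces `κ_*`. -/
theorem separation (P Q : S0) {m : ℝ} (hm : 0 < m) (hP : m ≤ eig1 P - eig2 P)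
    (hQ : m ≤ eig1 Q - eig2 Q) :
    2 * m ^ 2 * (1 - (leadingEigenvector P ⬝ᵥ leadingEigenvector Q) ^ 2) ≤
      ‖entries P - entries Q‖ ^ 2 := by
  set n := leadingEigenvector P
  set d := leadingEigenvector Q
  have hn : n ⬝ᵥ n = 1 := leadingEigenvector_dotProduct P
  have hd : d ⬝ᵥ d = 1 := leadingEigenvector_dotProduct Q
  have h1 := quadratic_le_of_gap P (by linarith) hn (mulVec_leadingEigenvector P) hd
  have h2 := quadratic_le_of_gap Q (by linarith) hd (mulVec_leadingEigenvector Q) hn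
  rw [dotProduct_comm d n] at h2
  have h3 : n ⬝ᵥ P.1 *ᵥ n = eig1 P := dotProduct_mulVec_leading P
  have h4 : d ⬝ᵥ Q.1 *ᵥ d = eig1 Q := dotProduct_mulVec_leading Q
  have h5 : inner ℝ (square n - square d) (entries P - entries Q) =
      (eig1 P - d ⬝ᵥ P.1 *ᵥ d) + (eig1 Q - n ⬝ᵥ Q.1 *ᵥ n) := by
    rw [inner_sub_left, inner_sub_right, inner_sub_right, inner_square, inner_square,
      inner_square, inner_square, h3, h4]
    ring
  have h6 : ‖square n - square d‖ ^ 2 = 2 * (1 - (n ⬝ᵥ d) ^ 2) := by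
    rw [norm_sub_sq_real, norm_square hn, norm_square hd, inner_square_square]
    ring
  have h7 := real_inner_le_norm (square n - square d) (entries P - entries Q)
  rw [h5] at h7
  set t := 1 - (n ⬝ᵥ d) ^ 2
  have ht : 0 ≤ t := by nlinarith [sq_nonneg ‖square n - square d‖]
  have h8 : 2 * m * t ≤ ‖square n - square d‖ * ‖entries P - entries Q‖ := by
    nlinarith
  rcases ht.eq_or_lt with h0 | hpos
  · rw [← h0, mul_zero]; positivity
  · have h9 := pow_le_pow_left₀ (by positivity) h8 2
    rw [mul_pow, mul_pow (‖square n - square d‖), h6] at h9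
    have h10 : (2 * t) * (2 * m ^ 2 * t) ≤ (2 * t) * ‖entries P - entries Q‖ ^ 2 := by nlinarith
    exact le_of_mul_le_mul_left h10 (by positivity)

/-! ### Lower bounds for the potential -/

section potential

variable {a b c : ℝ}

theorem sStar_pos (ha : 0 < a) (hb : 0 < b) (hc : 0 < c) : 0 < sStar a b c := by
  unfold sStar; positivity

theorem sStar_eq (ha : 0 < a) (hc : 0 < c) :
    3 * a = 2 * c * sStar a b c ^ 2 - b * sStar a b c := by
  have hD : √(b ^ 2 + 24 * a * c) ^ 2 = b ^ 2 + 24 * a * c := Real.sq_sqrt (by positivity)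
  have h : 4 * c * sStar a b c = b + √(b ^ 2 + 24 * a * c) := by
    unfold sStar; field_simp
  have h2 : (4 * c * sStar a b c - b) ^ 2 = b ^ 2 + 24 * a * c := by rw [← hD, h]; ring
  have h3 : 8 * c * (2 * c * sStar a b c ^ 2 - b * sStar a b c - 3 * a) = 0 := by linarith
  have := (mul_eq_zero.1 h3).resolve_left (by positivity)
  linarith

theorem b_lt_sStar (ha : 0 < a) (hb : 0 < b) (hc : 0 < c) : b < 2 * c * sStar a b c := by
  have h := sStar_eq (b := b) ha hc
  have hs := sStar_pos ha hb hc
  by_contra hle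
  nlinarith

/-- The value of the potential on uniaxial tensors. -/
def profile (a b c u : ℝ) : ℝ := -a * u ^ 2 / 3 - 2 * b * u ^ 3 / 27 + c * u ^ 4 / 9

/-- `s_*` is a critical point of the profile, by `sStar_eq`, so it is a double root of the
difference. -/
theorem profile_sub (ha : 0 < a) (hc : 0 < c) (u : ℝ) :
    profile a b c u - profile a b c (sStar a b c) = (u - sStar a b c) ^ 2 *
      (c / 9 * u ^ 2 + (2 * sStar a b c * c / 9 - 2 * b / 27) * u +
        sStar a b c / 2 * (2 * sStar a b c * c / 9 - 2 * b / 27)) := by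
  have h := sStar_eq (b := b) ha hc
  have ha' : a = (2 * c * sStar a b c ^ 2 - b * sStar a b c) / 3 := by linarith
  generalize sStar a b c = s at *
  unfold profile
  rw [ha']
  ring

theorem bulk_uniaxial (s : ℝ) {n : Fin 3 → ℝ} (hn : n ⬝ᵥ n = 1) :
    bulk a b c (uniaxial s n hn) = profile a b c s := by
  have hv : Matrix.vecMulVec n n * Matrix.vecMulVec n n = Matrix.vecMulVec n n := by
    rw [Matrix.vecMulVec_mul_vecMulVec, hn, one_smul]
  have ht : (Matrix.vecMulVec n n).trace = 1 := by rw [Matrix.trace_vecMulVec, hn]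
  set N := Matrix.vecMulVec n n with hN
  have h1 : (uniaxial s n hn).1 = s • (N - (1 / 3 : ℝ) • 1) := rfl
  have h2 : (uniaxial s n hn).1 ^ 2 = s ^ 2 • ((1 / 3 : ℝ) • N + (1 / 9 : ℝ) • 1) := by
    rw [h1, smul_pow, sq (N - _), sub_mul, mul_sub, mul_sub, hv]
    simp only [smul_mul_assoc, mul_smul_comm, one_mul, mul_one]
    module
  have h3 : (uniaxial s n hn).1 ^ 3 = s ^ 3 • ((1 / 3 : ℝ) • N - (1 / 27 : ℝ) • 1) := by
    rw [pow_succ, h2, h1, smul_mul_smul_comm, ← pow_succ, add_mul, mul_sub, mul_sub]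
    simp only [smul_mul_assoc, mul_smul_comm, one_mul, mul_one, hv]
    module
  unfold bulk
  rw [h2, h3]
  simp only [Matrix.trace_smul, Matrix.trace_add, Matrix.trace_sub, ht, Matrix.trace_one,
    Fintype.card_fin, smul_eq_mul]
  unfold profile
  push_cast
  ring

/-- The lower bound for the potential in terms of `w = 3 λ₁ / 2` and `d = (λ₂ - λ₃) / 2`. -/
theorem bulk_sub_ge (ha : 0 < a) (hb : 0 < b) (hc : 0 < c) (Q : S0) :
    ∃ u w d : ℝ, 0 ≤ d ∧ d ≤ w ∧ 0 ≤ u ∧ u ^ 2 = w ^ 2 + 3 * d ^ 2 ∧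
      eig1 Q - eig2 Q = w - d ∧
      (u - sStar a b c) ^ 2 * (c / 9 * u ^ 2 + sStar a b c * b / 54) + 2 * b / 3 * (w * d ^ 2) ≤
        bulk a b c Q - profile a b c (sStar a b c) := by
  have h12 := eig2_le_eig1 Q
  have h23 := eig3_le_eig2 Q
  have hsum := eig_sum Q
  have hs := sStar_pos ha hb hc
  have hbs := b_lt_sStar ha hb hc
  obtain ⟨w, hw⟩ : ∃ w, w = 3 / 2 * eig1 Q := ⟨_, rfl⟩
  obtain ⟨d, hd⟩ : ∃ d, d = (eig2 Q - eig3 Q) / 2 := ⟨_, rfl⟩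
  have e1 : eig1 Q = 2 * w / 3 := by linarith
  have e2 : eig2 Q = -(w / 3) + d := by linarith
  have e3 : eig3 Q = -(w / 3) - d := by linarith
  have hd0 : 0 ≤ d := by linarith
  have hdw : d ≤ w := by linarith
  have hw0 : 0 ≤ w := hd0.trans hdw
  have hu2 : √(w ^ 2 + 3 * d ^ 2) ^ 2 = w ^ 2 + 3 * d ^ 2 := Real.sq_sqrt (by positivity)
  have huw : w ≤ √(w ^ 2 + 3 * d ^ 2) := Real.le_sqrt_of_sq_le (by nlinarith)
  refine ⟨√(w ^ 2 + 3 * d ^ 2), w, d, hd0, hdw, Real.sqrt_nonneg _, hu2, by linarith, ?_⟩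
  generalize √(w ^ 2 + 3 * d ^ 2) = u at *
  have hu0 : 0 ≤ u := hw0.trans huw
  have hT : eig1 Q ^ 2 + eig2 Q ^ 2 + eig3 Q ^ 2 = 2 * u ^ 2 / 3 := by
    rw [e1, e2, e3, hu2]; ring
  have hT3 : eig1 Q ^ 3 + eig2 Q ^ 3 + eig3 Q ^ 3 = 2 * w ^ 3 / 9 - 2 * (w * d ^ 2) := by
    rw [e1, e2, e3]; ring
  -- The variable `u` carries `tr Q²`, and `d` measures biaxiality. Relative to the uniaxial tensor
  -- of the same norm, two terms remain, both nonnegative as `w ≤ u`.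
  have hbulk : bulk a b c Q =
      profile a b c u + 2 * b / 27 * (u ^ 3 - w ^ 3) + 2 * b / 3 * (w * d ^ 2) := by
    unfold bulk profile
    rw [trace_pow, trace_pow, hT, hT3]
    ring
  have hp := profile_sub (b := b) ha hc u
  have hcube : w ^ 3 ≤ u ^ 3 := pow_le_pow_left₀ hw0 huw 3
  generalize sStar a b c = s at *
  have hβ : b / 27 ≤ 2 * s * c / 9 - 2 * b / 27 := by linarith
  have h5 : (u - s) ^ 2 * (c / 9 * u ^ 2 + s * b / 54) ≤ profile a b c u - profile a b c s := by
    rw [hp]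
    refine mul_le_mul_of_nonneg_left ?_ (sq_nonneg _)
    have h6 : s / 2 * (b / 27) ≤ s / 2 * (2 * s * c / 9 - 2 * b / 27) := by gcongr
    have h7 : 0 ≤ (2 * s * c / 9 - 2 * b / 27) * u := mul_nonneg (by linarith [hb]) hu0
    linarith
  have h8 : 0 ≤ 2 * b / 27 * (u ^ 3 - w ^ 3) := mul_nonneg (by positivity) (by linarith)
  linarith

theorem profile_le_bulk (ha : 0 < a) (hb : 0 < b) (hc : 0 < c) (Q : S0) :
    profile a b c (sStar a b c) ≤ bulk a b c Q := by
  obtain ⟨u, w, d, hd, hdw, -, -, -, h⟩ := bulk_sub_ge ha hb hc Q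
  have hs := sStar_pos ha hb hc
  have hw : 0 ≤ w := hd.trans hdw
  have : 0 ≤ (u - sStar a b c) ^ 2 * (c / 9 * u ^ 2 + sStar a b c * b / 54) +
    2 * b / 3 * (w * d ^ 2) := by positivity
  linarith

/-- The infimum of the bulk term is attained at uniaxial tensors of scalar order `s_*`. -/
theorem potential_eq (ha : 0 < a) (hb : 0 < b) (hc : 0 < c) (Q : S0) :
    potential a b c Q = bulk a b c Q - profile a b c (sStar a b c) := by
  have hn : (![1, 0, 0] : Fin 3 → ℝ) ⬝ᵥ ![1, 0, 0] = 1 := by simp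
  unfold potential
  congr 1
  apply le_antisymm
  · rw [← bulk_uniaxial (sStar a b c) hn]
    exact ciInf_le ⟨profile a b c (sStar a b c), by
      rintro _ ⟨P, rfl⟩; exact profile_le_bulk ha hb hc P⟩ _
  · exact le_ciInf (profile_le_bulk ha hb hc)

theorem potential_nonneg (ha : 0 < a) (hb : 0 < b) (hc : 0 < c) (Q : S0) :
    0 ≤ potential a b c Q := by
  rw [potential_eq ha hb hc]
  linarith [profile_le_bulk ha hb hc Q]

theorem uniaxial_mem_vacuum (ha : 0 < a) (hb : 0 < b) (hc : 0 < c) {n : Fin 3 → ℝ}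
    (hn : n ⬝ᵥ n = 1) : uniaxial (sStar a b c) n hn ∈ vacuum a b c := by
  change potential a b c _ = 0
  rw [potential_eq ha hb hc, bulk_uniaxial, sub_self]

/-- With `s = s_*`, `s (1 - φ) = s - w + d`. Its square is controlled by `(u - s)²` and the
biaxiality term `w d²` of `bulk_sub_ge`; the latter degenerates only for small `w`, where `u` is far
from `s`. -/
theorem exists_pen_le_potential (ha : 0 < a) (hb : 0 < b) (hc : 0 < c) :
    ∃ c₀, 0 < c₀ ∧ ∀ Q : S0, c₀ * pen (phi a b c Q) ≤ potential a b c Q := by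
  have hs := sStar_pos ha hb hc
  obtain ⟨s, hsdef⟩ : ∃ s, s = sStar a b c := ⟨_, rfl⟩
  rw [← hsdef] at hs
  -- `216 = 4 * 54` is what the case of small `w` requires, and `75 = (25 / 2) * 6` comes from the
  -- term `d²` in the other case.
  refine ⟨s ^ 2 / (216 / (s * b) + 75 / (s * b)), by positivity, fun Q => ?_⟩
  obtain ⟨u, w, d, hd, hdw, hu0, hu, hgap, hge⟩ := bulk_sub_ge ha hb hc Q
  rw [← potential_eq ha hb hc, ← hsdef] at hge
  have hw : 0 ≤ w := hd.trans hdw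
  have hf : 0 ≤ potential a b c Q := potential_nonneg ha hb hc Q
  have hγ : (u - s) ^ 2 * (s * b / 54) + 2 * b / 3 * (w * d ^ 2) ≤ potential a b c Q := by
    refine le_trans ?_ hge
    have : 0 ≤ (u - s) ^ 2 * (c / 9 * u ^ 2) := by positivity
    nlinarith
  unfold pen phi
  rw [hgap, ← hsdef]
  rcases le_total s (w - d) with h1 | h1
  · rw [max_eq_left (by rw [sub_nonpos]; exact (one_le_div hs).2 h1)]
    simpa using hf
  have h2 : 0 ≤ 1 - (w - d) / s := by rw [sub_nonneg]; exact (div_le_one hs).2 h1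
  rw [max_eq_right h2, div_mul_eq_mul_div, div_le_iff₀ (by positivity), ← mul_pow,
    show s * (1 - (w - d) / s) = s - w + d by field_simp; ring]
  have hsb : 0 < s * b := by positivity
  rw [← add_div, ← mul_div_assoc, le_div_iff₀ hsb]
  have hγ' : (u - s) ^ 2 * (s * b) + 36 * b * (w * d ^ 2) ≤ 54 * potential a b c Q := by linarith
  have huw : w ≤ u := by nlinarith [sq_nonneg d]
  -- If `w ≥ s / 4` the biaxiality term controls `d²`. Otherwise `u ≤ 2 w ≤ s / 2`, and `(u - s)²`
  -- is at least `s² / 4`, while `0 ≤ s - w + d ≤ s`.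
  rcases le_total (s / 4) w with h3 | h3
  · have h4 : u - w ≤ 3 / 2 * d := by
      by_contra! h
      nlinarith
    have h5 : (s - w + d) ^ 2 ≤ 2 * (u - s) ^ 2 + 25 / 2 * d ^ 2 := by
      have h6 : s - w + d ≤ |s - u| + 5 / 2 * d := by linarith [le_abs_self (s - u)]
      have h7 := pow_le_pow_left₀ (by linarith) h6 2
      nlinarith [sq_nonneg (|s - u| - 5 / 2 * d), sq_abs (s - u)]
    have h8 : s * b / 4 * d ^ 2 ≤ b * (w * d ^ 2) := by
      have : 0 ≤ b * d ^ 2 := by positivity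
      nlinarith
    have h9 := mul_le_mul_of_nonneg_right h5 hsb.le
    nlinarith [mul_nonneg hb.le (mul_nonneg hw (sq_nonneg d)), mul_nonneg hsb.le (sq_nonneg d)]
  · have hu2 : u ≤ 2 * w := by nlinarith
    have h4 : (s - w + d) ^ 2 ≤ s ^ 2 := pow_le_pow_left₀ (by linarith) (by linarith) 2
    have h5 : s ^ 2 ≤ 4 * (u - s) ^ 2 := by nlinarith
    have h6 := mul_le_mul_of_nonneg_right (h4.trans h5) hsb.le
    nlinarith [mul_nonneg hb.le (mul_nonneg hw (sq_nonneg d))]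

/-- A gap `φ ≥ 1` forces `u ≥ φ s_*`, and the part `(u - s_*)² u²` of the lower bound then grows
like a quartic in `φ`. It serves only when the essential infimum exceeds one. -/
theorem exists_sq_le_potential (ha : 0 < a) (hb : 0 < b) (hc : 0 < c) :
    ∃ c₁, 0 < c₁ ∧ ∀ Q : S0, 1 ≤ phi a b c Q →
      c₁ * (phi a b c Q ^ 2 - 1) ^ 2 ≤ potential a b c Q := by
  have hs := sStar_pos ha hb hc
  refine ⟨c / 36 * sStar a b c ^ 4, by positivity, fun Q hQ => ?_⟩
  obtain ⟨u, w, d, hd, hdw, hu0, hu, hgap, hge⟩ := bulk_sub_ge ha hb hc Q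
  rw [← potential_eq ha hb hc] at hge
  obtain ⟨p, hp⟩ : ∃ p, p = phi a b c Q := ⟨_, rfl⟩
  rw [← hp] at hQ ⊢
  have hwd : w - d = p * sStar a b c := by
    rw [hp, ← hgap]; unfold phi; field_simp
  generalize sStar a b c = s at *
  have hw : 0 ≤ w := hd.trans hdw
  have huw : w ≤ u := by nlinarith [sq_nonneg d]
  have hps : p * s ≤ u := by linarith
  have h1 : p * s * (p * s - s) ≤ u * (u - s) := by
    apply mul_le_mul hps (by linarith) _ hu0
    nlinarith
  have h0 : 0 ≤ p * s * (p * s - s) := by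
    have : p * s * (p * s - s) = p * (p - 1) * s ^ 2 := by ring
    rw [this]
    exact mul_nonneg (mul_nonneg (by linarith) (by linarith)) (sq_nonneg s)
  have h2 := pow_le_pow_left₀ h0 h1 2
  have h3 : (p ^ 2 - 1) ^ 2 ≤ 4 * (p * (p - 1)) ^ 2 := by
    have : p ^ 2 - 1 ≤ 2 * (p * (p - 1)) := by nlinarith
    have h4 := pow_le_pow_left₀ (by nlinarith) this 2
    linarith
  have h4 : c / 36 * s ^ 4 * (p ^ 2 - 1) ^ 2 ≤ c / 9 * (p * s * (p * s - s)) ^ 2 := by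
    have : c / 36 * s ^ 4 * (p ^ 2 - 1) ^ 2 ≤ c / 36 * s ^ 4 * (4 * (p * (p - 1)) ^ 2) := by
      gcongr
    refine this.trans (le_of_eq ?_)
    ring
  have h5 : c / 9 * (p * s * (p * s - s)) ^ 2 ≤ c / 9 * (u * (u - s)) ^ 2 := by gcongr
  have h6 : 0 ≤ (u - s) ^ 2 * (s * b / 54) := by positivity
  have h7 : 0 ≤ 2 * b / 3 * (w * d ^ 2) := by positivity
  nlinarith

end potential

/-! ### The field of directions of a tensor -/

theorem entries_injective : Function.Injective entries := by
  intro P Q h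
  ext i j
  exact congrArg (fun v : MatrixSpace => v (i, j)) h

/-- The orthogonal projection of a matrix to a symmetric traceless one. -/
def toTensor (v : MatrixSpace) : S0 :=
  (LinearEquiv.ofInjective entries entries_injective).symm
    ((LinearMap.range entries).orthogonalProjectionOnto v)

theorem entries_toTensor (v : MatrixSpace) :
    entries (toTensor v) = (LinearMap.range entries).orthogonalProjectionOnto v := by
  have := (LinearEquiv.ofInjective entries entries_injective).apply_symm_apply
    ((LinearMap.range entries).orthogonalProjectionOnto v)
  exact congrArg Subtype.val this

theorem toTensor_entries (Q : S0) : toTensor (entries Q) = Q := by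
  apply entries_injective
  rw [entries_toTensor]
  exact Submodule.starProjection_eq_self_iff.2 (LinearMap.mem_range_self entries Q)

theorem norm_toTensor_sub_le (u v : MatrixSpace) :
    ‖entries (toTensor u) - entries (toTensor v)‖ ≤ ‖u - v‖ := by
  rw [entries_toTensor, entries_toTensor, ← Submodule.coe_sub, ← map_sub]
  exact Submodule.norm_orthogonalProjectionOnto_apply_le (LinearMap.range entries) _

theorem phi_nonneg {a b c : ℝ} (ha : 0 < a) (hb : 0 < b) (hc : 0 < c) (Q : S0) :
    0 ≤ phi a b c Q :=
  div_nonneg (sub_nonneg.2 (eig2_le_eig1 Q)) (sStar_pos ha hb hc).le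

/-- The gap `φ` and the leading eigenvector as a field of directions. -/
def tensorField {a b c : ℝ} (ha : 0 < a) (hb : 0 < b) (hc : 0 < c) :
    GapField MatrixSpace (EuclideanSpace ℝ (Fin 3)) where
  -- Gap and direction are composed with the orthogonal projection to `S₀`, so that they are defined
  -- on a Euclidean space of all matrices; the projection is 1-Lipschitz and leaves the constants
  -- unchanged.
  gap v := phi a b c (toTensor v)
  dir v := WithLp.toLp 2 (leadingEigenvector (toTensor v))
  lip := 3 / sStar a b c
  scale := sStar a b c
  lip_pos := by have := sStar_pos ha hb hc; positivity
  scale_pos := sStar_pos ha hb hc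
  gap_sub_le u v := by
    have hs := sStar_pos ha hb hc
    unfold phi
    rw [← sub_div, div_mul_eq_mul_div, div_le_div_iff_of_pos_right hs]
    refine (gap_sub_le _ _).trans ?_
    gcongr
    exact norm_toTensor_sub_le u v
  norm_dir v := by
    have h := leadingEigenvector_dotProduct (toTensor v)
    rw [EuclideanSpace.norm_eq, Real.sqrt_eq_one]
    simp only [Real.norm_eq_abs, sq_abs]
    rw [← h]
    simp [dotProduct, sq]
  separation m hm u v hu hv := by
    have hs := sStar_pos ha hb hc
    have hu' : m * sStar a b c ≤ eig1 (toTensor u) - eig2 (toTensor u) := (le_div_iff₀ hs).1 hu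
    have hv' : m * sStar a b c ≤ eig1 (toTensor v) - eig2 (toTensor v) := (le_div_iff₀ hs).1 hv
    have h := separation _ _ (mul_pos hm hs) hu' hv'
    have h2 := pow_le_pow_left₀ (norm_nonneg _) (norm_toTensor_sub_le u v) 2
    rw [EuclideanSpace.inner_eq_star_dotProduct]
    simp only [star_trivial]
    rw [dotProduct_comm]
    refine le_trans (le_of_eq ?_) (h.trans h2)
    ring

theorem tensorField_kappa {a b c : ℝ} (ha : 0 < a) (hb : 0 < b) (hc : 0 < c) :
    (tensorField ha hb hc).kappa = kappaStar a b c := rfl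

theorem uniaxial_eq_of_eq_or_neg (s : ℝ) {n m : Fin 3 → ℝ} (hn : n ⬝ᵥ n = 1) (hm : m ⬝ᵥ m = 1)
    (h : n = m ∨ n = -m) : uniaxial s n hn = uniaxial s m hm := by
  apply Subtype.ext
  unfold uniaxial
  rcases h with rfl | rfl
  · rfl
  · simp [Matrix.vecMulVec_neg, Matrix.neg_vecMulVec]

theorem dotProduct_eq_one_of_mem_sphere {v : EuclideanSpace ℝ (Fin 3)}
    (hv : v ∈ sphere (0 : EuclideanSpace ℝ (Fin 3)) 1) : (v : Fin 3 → ℝ) ⬝ᵥ v = 1 := by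
  have h := real_inner_self_eq_norm_sq v
  rw [mem_sphere_zero_iff_norm.1 hv, EuclideanSpace.inner_eq_star_dotProduct] at h
  simpa using h

/-- A loop of uniaxial tensors with orientable directors is contractible. -/
theorem nullhomotopic_of_orientable {a b c : ℝ} (ha : 0 < a) (hb : 0 < b) (hc : 0 < c)
    (γ : C(Circle, vacuum a b c)) {n : ℂ → EuclideanSpace ℝ (Fin 3)} (hn : ∀ z, ‖n z‖ = 1) {r : ℝ}
    (hγ : ∀ z : Circle, ∀ h, (γ z : S0) = uniaxial (sStar a b c) (n (r * z)) h)
    (h : Orientable n 0 r) : γ.Nullhomotopic := by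
  obtain ⟨v, hv, hvn⟩ := h
  have hv1 : ∀ z : Circle, ‖v z‖ = 1 := fun z => by
    rcases hvn z (mem_sphere_zero_iff_norm.2 z.norm_coe) with h | h <;> rw [h] <;> simp [hn]
  let w : C(Circle, sphere (0 : EuclideanSpace ℝ (Fin 3)) 1) :=
    ⟨fun z => ⟨v z, by simp [hv1]⟩, by
      refine Continuous.subtype_mk ?_ _
      exact hv.comp_continuous continuous_subtype_val fun z =>
        mem_sphere_zero_iff_norm.2 z.norm_coe⟩
  let U : C(sphere (0 : EuclideanSpace ℝ (Fin 3)) 1, vacuum a b c) :=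
    ⟨fun x => ⟨uniaxial (sStar a b c) x (dotProduct_eq_one_of_mem_sphere x.2),
      uniaxial_mem_vacuum ha hb hc _⟩, by
      refine Continuous.subtype_mk (Continuous.subtype_mk ?_ _) _
      have : Continuous fun x : sphere (0 : EuclideanSpace ℝ (Fin 3)) 1 =>
          ((x : EuclideanSpace ℝ (Fin 3)) : Fin 3 → ℝ) :=
        (PiLp.continuous_ofLp 2 _).comp continuous_subtype_val
      exact ((this.matrix_vecMulVec this).sub
        (continuous_const (y := (1 / 3 : ℝ) • (1 : Matrix (Fin 3) (Fin 3) ℝ)))).const_smul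
          (sStar a b c)⟩
  -- The uniaxial tensor is even in its director, so the orientation, equal to `n` up to sign,
  -- factors the loop through the sphere.
  have hU : γ = U.comp w := by
    ext1 z
    apply Subtype.ext
    have hnz : (n (r * z) : Fin 3 → ℝ) ⬝ᵥ n (r * z) = 1 :=
      dotProduct_eq_one_of_mem_sphere (by simp [hn])
    rw [hγ z hnz]
    refine uniaxial_eq_of_eq_or_neg _ _ (dotProduct_eq_one_of_mem_sphere (w z).2) ?_
    have := hvn z (mem_sphere_zero_iff_norm.2 z.norm_coe)
    rw [zero_add] at this
    rcases this with h | h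
    · left; exact congrArg WithLp.ofLp h.symm
    · right
      have h2 := congrArg (fun x => -WithLp.ofLp x) h
      simp only [WithLp.ofLp_neg, neg_neg] at h2
      exact h2.symm
  rw [hU]
  exact (nullhomotopic_sphere (by simp) w).comp_right U

/-! ### Convergence on circles -/

/-- A uniformly equicontinuous sequence that converges on a dense subset of a compact set
converges uniformly. -/
theorem exists_tendstoUniformlyOn {X V : Type*} [PseudoMetricSpace X] [NormedAddCommGroup V]
    [CompleteSpace V] {f : ℕ → X → V} {K D : Set X} (hK : IsCompact K) (hDK : K ⊆ closure D)
    (hD : ∀ x ∈ D, CauchySeq fun j => f j x)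
    (heq : ∀ δ > 0, ∃ h > 0, ∀ j, ∀ x ∈ K ∪ D, ∀ y ∈ K ∪ D, dist x y < h → dist (f j x) (f j y) < δ) :
    ∃ W : X → V, TendstoUniformlyOn f W atTop K := by
  have hcauchy : UniformCauchySeqOn f atTop K := by
    rw [Metric.uniformCauchySeqOn_iff]
    intro δ hδ
    obtain ⟨h, hh, heq'⟩ := heq (δ / 3) (by positivity)
    obtain ⟨t, htD, hcov⟩ := hK.elim_finite_subcover_image (b := D) (c := fun x => ball x h)
      (fun _ _ => isOpen_ball) (fun x hx => by
        obtain ⟨y, hy, hxy⟩ := Metric.mem_closure_iff.1 (hDK hx) h hh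
        exact mem_iUnion₂.2 ⟨y, hy, hxy⟩)
    obtain ⟨htfin, hcov⟩ := hcov
    have hN : ∀ᶠ N in atTop, ∀ y ∈ t, ∀ m ≥ N, ∀ n ≥ N, dist (f m y) (f n y) < δ / 3 := by
      rw [eventually_all_finite htfin]
      intro y hy
      obtain ⟨N, hN⟩ := Metric.cauchySeq_iff.1 (hD y (htD hy)) (δ / 3) (by positivity)
      exact eventually_atTop.2 ⟨N, fun N' hN' m hm n hn =>
        hN m (hN'.trans hm) n (hN'.trans hn)⟩
    obtain ⟨N, hN⟩ := hN.exists
    refine ⟨N, fun m hm n hn x hx => ?_⟩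
    obtain ⟨y, hy, hxy⟩ := mem_iUnion₂.1 (hcov hx)
    have h1 := heq' m x (Or.inl hx) y (Or.inr (htD hy)) hxy
    have h2 := heq' n x (Or.inl hx) y (Or.inr (htD hy)) hxy
    have h3 := hN y hy m hm n hn
    have h4 := dist_triangle4 (f m x) (f m y) (f n y) (f n x)
    rw [dist_comm (f n y)] at h4
    linarith
  have hlim : ∀ x, ∃ w, x ∈ K → Tendsto (fun j => f j x) atTop (𝓝 w) := by
    intro x
    by_cases hx : x ∈ K
    · obtain ⟨w, hw⟩ := cauchySeq_tendsto_of_complete (hcauchy.cauchySeq hx)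
      exact ⟨w, fun _ => hw⟩
    · exact ⟨0, fun h => absurd h hx⟩
  choose W hW using hlim
  exact ⟨W, hcauchy.tendstoUniformlyOn_of_tendsto fun x hx => hW x hx⟩

/-- Fubini in polar coordinates; the Jacobian `r` is positive and can be divided out. -/
theorem ae_circle {P : ℂ → Prop} {R : ℝ} (h : ∀ᵐ z ∂(volume.restrict (ball (0 : ℂ) R)), P z) :
    ∀ᵐ r ∂(volume.restrict (Ioo 0 R)), ∀ᵐ θ ∂(volume.restrict (Ioo (-Real.pi) Real.pi)),
      P (circleMap 0 r θ) := by
  obtain ⟨t, hPt, htm, ht0⟩ := exists_measurable_superset_of_null (ae_iff.1 h)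
  rw [Measure.restrict_apply htm] at ht0
  have h1 : ∫⁻ z, (t ∩ ball 0 R).indicator 1 z = 0 := by
    rw [lintegral_indicator_one (htm.inter measurableSet_ball), ht0]
  rw [← Complex.lintegral_comp_polarCoord_symm, polarCoord_target, Measure.volume_eq_prod,
    ← Measure.prod_restrict] at h1
  have hcirc : ∀ p : ℝ × ℝ, Complex.polarCoord.symm p = circleMap 0 p.1 p.2 := by
    intro p
    rw [Complex.polarCoord_symm_apply, circleMap, Complex.exp_mul_I, Complex.ofReal_cos,
      Complex.ofReal_sin, zero_add]
  simp only [hcirc] at h1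
  have hc : Continuous fun p : ℝ × ℝ => circleMap 0 p.1 p.2 := by unfold circleMap; fun_prop
  have hmeas : Measurable fun p : ℝ × ℝ => ENNReal.ofReal p.1 •
      (t ∩ ball 0 R).indicator (1 : ℂ → ENNReal) (circleMap 0 p.1 p.2) :=
    (ENNReal.measurable_ofReal.comp measurable_fst).smul
      ((measurable_one.indicator (htm.inter measurableSet_ball)).comp hc.measurable)
  rw [lintegral_eq_zero_iff hmeas] at h1
  have h2 := Measure.ae_ae_of_ae_prod h1
  have h3 := ae_restrict_of_ae_restrict_of_subset (s := Ioo 0 R) (t := Ioi (0 : ℝ))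
    (fun r hr => hr.1) h2
  filter_upwards [h3, ae_restrict_mem measurableSet_Ioo] with r hr hrI
  filter_upwards [hr] with θ hθ
  by_contra hP
  have hmem : circleMap 0 r θ ∈ t ∩ ball 0 R := by
    refine ⟨hPt hP, ?_⟩
    rw [mem_ball_zero_iff, norm_circleMap_zero, abs_of_pos hrI.1]
    exact hrI.2
  simp only [indicator_of_mem hmem, Pi.one_apply, smul_eq_mul, mul_one, Pi.zero_apply,
    ENNReal.ofReal_eq_zero] at hθ
  linarith [hrI.1]

namespace GapField

variable {V F : Type*} [NormedAddCommGroup V] [NormedSpace ℝ V]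
  [NormedAddCommGroup F] [InnerProductSpace ℝ F] {G : GapField V F} {c₀ ε : ℝ}

theorem norm_sub_sq_le_circleEnergy [CompleteSpace V] {Q : ℂ → V} (hc₀ : 0 < c₀)
    (hQ : ContDiff ℝ 1 Q) {r : ℝ} (hr : 0 < r) {s t : ℝ} (hs : -Real.pi ≤ s) (hst : s ≤ t)
    (ht : t ≤ Real.pi) : ‖Q (circleMap 0 r t) - Q (circleMap 0 r s)‖ ^ 2 ≤
      (t - s) * (2 * r * G.circleEnergy c₀ ε Q 0 r) := by
  have hu' := continuous_circleDeriv hQ 0 r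
  have hdens : Continuous fun θ => G.density c₀ ε Q (circleMap 0 r θ) * r :=
    ((continuous_density hQ).comp (continuous_circleMap 0 r)).mul continuous_const
  refine (sq_norm_sub_le_integral (hasDerivAt_circle hQ 0 r) hu' hst).trans ?_
  refine mul_le_mul_of_nonneg_left ?_ (by linarith)
  have hper : ∫ θ in -Real.pi..Real.pi, G.density c₀ ε Q (circleMap 0 r θ) * r =
      G.circleEnergy c₀ ε Q 0 r := by
    have : Function.Periodic (fun θ => G.density c₀ ε Q (circleMap 0 r θ) * r)
        (2 * Real.pi) := fun θ => by
      simp only [periodic_circleMap 0 r θ]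
    have h := this.intervalIntegral_add_eq (-Real.pi) 0
    rw [zero_add, show -Real.pi + 2 * Real.pi = Real.pi by ring] at h
    exact h
  rw [← hper, ← intervalIntegral.integral_const_mul]
  calc ∫ θ in s..t, ‖circleDeriv Q 0 r θ‖ ^ 2
      ≤ ∫ θ in -Real.pi..Real.pi, ‖circleDeriv Q 0 r θ‖ ^ 2 :=
        intervalIntegral.integral_mono_interval hs hst ht
          (Eventually.of_forall fun _ => sq_nonneg _) ((hu'.norm.pow 2).intervalIntegrable _ _)
    _ ≤ _ := by
        refine intervalIntegral.integral_mono_on (by linarith)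
          ((hu'.norm.pow 2).intervalIntegrable _ _)
          ((continuous_const.mul hdens).intervalIntegrable _ _) fun θ _ => ?_
        refine (norm_circleDeriv_sq_le_density (G := G) (ε := ε) hr hc₀ 0 θ).trans (le_of_eq ?_)
        ring

end GapField

namespace GapField

variable {V F : Type*} [NormedAddCommGroup V] [NormedSpace ℝ V]
  [NormedAddCommGroup F] [InnerProductSpace ℝ F] {G : GapField V F} {c₀ ε : ℝ}

theorem orientable_of_tendstoUniformlyOn {Q : ℕ → ℂ → V} {W : ℂ → V} {r m : ℝ} (hr : 0 < r)
    (hQ : TendstoUniformlyOn Q W atTop (sphere 0 r)) (hW : ContinuousOn W (sphere 0 r))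
    (hm : 0 < m) (hgap : ∀ z ∈ sphere (0 : ℂ) r, m ≤ G.gap (W z))
    (hor : ∀ j, Orientable (G.dir ∘ Q j) 0 r) : Orientable (G.dir ∘ W) 0 r := by
  have hmaps : ∀ z ∈ sphere (0 : ℂ) 1, 0 + (r : ℂ) * z ∈ sphere (0 : ℂ) r := fun z hz => by
    rw [zero_add, mem_sphere_zero_iff_norm, norm_mul, mem_sphere_zero_iff_norm.1 hz, mul_one,
      Complex.norm_real, Real.norm_eq_abs, abs_of_pos hr]
  have hL := G.lip_pos
  have hS := G.scale_pos
  obtain ⟨δ, hδ, hδ1, hδ2⟩ : ∃ δ, 0 < δ ∧ G.lip * δ ≤ m / 2 ∧ δ < G.scale * (m / 2) := by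
    refine ⟨min (m / 2 / G.lip) (G.scale * m / 4), by positivity, ?_, ?_⟩
    · rw [mul_comm, ← le_div_iff₀ hL]; exact min_le_left _ _
    · refine (min_le_right _ _).trans_lt ?_
      have := mul_pos hS hm
      linarith
  obtain ⟨j, hj⟩ := (Metric.tendstoUniformlyOn_iff.1 hQ δ hδ).exists
  simp only [dist_eq_norm] at hj
  refine G.orientable_of_close (W := Q j) (m := m / 2) (δ := δ) (by positivity)
    (hW.comp (by fun_prop) hmaps) (fun z hz => ?_)
    (fun z hz => by linarith [hgap _ (hmaps z hz)]) (fun z hz => (hj _ (hmaps z hz)).le) hδ2 (hor j)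
  have h1 := G.gap_sub_le (W (0 + r * z)) (Q j (0 + r * z))
  have h2 := mul_le_mul_of_nonneg_left (hj _ (hmaps z hz)).le hL.le
  linarith [hgap _ (hmaps z hz)]

theorem circleMap_arg {r : ℝ} {z : ℂ} (hz : z ∈ sphere (0 : ℂ) r) :
    circleMap 0 r z.arg = z := by
  have := Complex.norm_mul_exp_arg_mul_I z
  rw [mem_sphere_zero_iff_norm.1 hz] at this
  rw [circleMap, zero_add, this]

variable [CompleteSpace V]

/-- Maps of bounded energy on a circle that converge almost everywhere converge uniformly. -/
theorem exists_tendstoUniformlyOn_sphere (hc₀ : 0 < c₀) {Q : ℕ → ℂ → V}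
    (hQ : ∀ j, ContDiff ℝ 1 (Q j)) {r e : ℝ} (hr : 0 < r)
    (he : ∀ j, G.circleEnergy c₀ ε (Q j) 0 r ≤ e) {u : ℂ → V}
    (hu : ∀ᵐ θ ∂(volume.restrict (Ioo (-Real.pi) Real.pi)),
      Tendsto (fun j => Q j (circleMap 0 r θ)) atTop (𝓝 (u (circleMap 0 r θ)))) :
    ∃ W : ℂ → V, TendstoUniformlyOn Q W atTop (sphere 0 r) ∧ ContinuousOn W (sphere 0 r) ∧
      ∀ᵐ θ ∂(volume.restrict (Ioo (-Real.pi) Real.pi)),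
        W (circleMap 0 r θ) = u (circleMap 0 r θ) := by
  have hπ := Real.pi_pos
  let p : ℝ → Prop := fun θ => θ ∈ Ioo (-Real.pi) Real.pi →
    Tendsto (fun j => Q j (circleMap 0 r θ)) atTop (𝓝 (u (circleMap 0 r θ)))
  have hp : ∀ᵐ θ, p θ := (ae_restrict_iff' measurableSet_Ioo).1 hu
  have hpd : Dense {θ | p θ} := Measure.dense_of_ae hp
  have hDI : Ioo (-Real.pi) Real.pi ∩ {θ | p θ} ⊆ Icc (-Real.pi) Real.pi :=
    inter_subset_left.trans Ioo_subset_Icc_self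
  have he0 : 0 ≤ e := (intervalIntegral.integral_nonneg (by positivity) fun _ _ =>
    mul_nonneg (density_nonneg hc₀ _) hr.le).trans (he 0)
  obtain ⟨W, hW⟩ := exists_tendstoUniformlyOn (f := fun j θ => Q j (circleMap 0 r θ))
    (K := Icc (-Real.pi) Real.pi) (D := Ioo (-Real.pi) Real.pi ∩ {θ | p θ}) isCompact_Icc (by
      rw [← closure_Ioo (by linarith : -Real.pi ≠ Real.pi)]
      exact closure_minimal (hpd.open_subset_closure_inter isOpen_Ioo) isClosed_closure)
    (fun θ hθ => (hθ.2 hθ.1).cauchySeq) (fun δ hδ => by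
      rw [union_eq_left.2 hDI]
      -- A bound on the energy of the circle gives a Hölder modulus of exponent one half, the same
      -- for all `j`.
      refine ⟨δ ^ 2 / (2 * r * e + 1), by positivity, fun j s hs t ht hst => ?_⟩
      wlog hle : s ≤ t generalizing s t
      · rw [dist_comm]
        rw [dist_comm] at hst
        exact this t ht s hs hst (le_of_not_ge hle)
      rw [dist_comm, Real.dist_eq, abs_of_nonneg (by linarith), lt_div_iff₀ (by positivity)] at hst
      rw [dist_comm, dist_eq_norm]
      have h := norm_sub_sq_le_circleEnergy (G := G) (ε := ε) hc₀ (hQ j) hr hs.1 hle ht.2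
      have h2 : 2 * r * G.circleEnergy c₀ ε (Q j) 0 r ≤ 2 * r * e + 1 := by
        have := mul_le_mul_of_nonneg_left (he j) (show 0 ≤ 2 * r by positivity)
        linarith
      have h3 := mul_le_mul_of_nonneg_left h2 (sub_nonneg.2 hle)
      exact lt_of_pow_lt_pow_left₀ 2 hδ.le (by linarith))
  -- The argument jumps across the negative axis, so continuity of the limit on the circle is
  -- deduced from uniform convergence and not from that of `W` in the angle.
  have hu1 : TendstoUniformlyOn Q (fun z => W z.arg) atTop (sphere 0 r) := by
    intro U hU
    filter_upwards [hW U hU] with j hj z hz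
    have := hj z.arg (Ioc_subset_Icc_self (Complex.arg_mem_Ioc z))
    simpa only [circleMap_arg hz] using this
  refine ⟨fun z => W z.arg, hu1, hu1.continuousOn
    (Frequently.of_forall fun j => (hQ j).continuous.continuousOn), ?_⟩
  filter_upwards [hu] with θ hθ
  exact tendsto_nhds_unique (hu1.tendsto_at (by
    rw [mem_sphere_zero_iff_norm, norm_circleMap_zero, abs_of_pos hr])) hθ

/-- The lower bound for limits of maps of class `C¹`. -/
theorem exists_energy_ge_of_tendsto (G : GapField V F) (hc₀ : 0 < c₀) :
    ∃ M : ℝ, 0 < M ∧ ∀ {Q : ℕ → ℂ → V}, (∀ j, ContDiff ℝ 1 (Q j)) → ∀ {ε : ℝ}, 0 < ε → ε < 1 →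
      ∀ {E : ENNReal}, (∀ j, ∫⁻ z in ball 0 (31 / 32), ENNReal.ofReal (G.density c₀ ε (Q j) z) ≤ E) →
      ∀ {u : ℂ → V}, (∀ᵐ z ∂(volume.restrict (ball (0 : ℂ) (31 / 32))),
        Tendsto (fun j => Q j z) atTop (𝓝 (u z))) →
      (∀ᵐ r ∂(volume.restrict (Ioo (1 / 2 : ℝ) (7 / 8))), ∀ W : ℂ → V,
        ContinuousOn W (sphere 0 r) → (∀ᵐ θ ∂(volume.restrict (Ioo (-Real.pi) Real.pi)),
          W (circleMap 0 r θ) = u (circleMap 0 r θ)) →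
        (∃ m > 0, ∀ z ∈ sphere (0 : ℂ) r, m ≤ G.gap (W z)) ∧ ¬ Orientable (G.dir ∘ W) 0 r) →
      ENNReal.ofReal (G.kappa * |Real.log ε| - M) ≤ E := by
  obtain ⟨M, hM, hcore⟩ := exists_energy_ge G hc₀
  refine ⟨M, hM, fun {Q} hQ {ε} hε hε1 {E} hE {u} hu hnon => ?_⟩
  by_cases hEtop : E = ⊤
  · rw [hEtop]; exact le_top
  obtain ⟨e, he, heE⟩ : ∃ e : ℝ, 0 < e ∧ E.toReal / e ≤ 1 / 16 :=
    ⟨16 * (E.toReal + 1), by positivity, by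
      rw [div_le_iff₀ (by positivity)]; linarith⟩
  have hB : ∀ j, volume (Ico (1 / 2) (7 / 8) ∩ {τ | e ≤ G.circleEnergy c₀ ε (Q j) 0 τ}) ≤
      ENNReal.ofReal (1 / 16) := fun j =>
    (volume_high_energy_le (R := 31 / 32) (L := E.toReal) hc₀ (hQ j) (by norm_num) (by norm_num) he
      (by
        rw [energyMeasure_univ, ENNReal.ofReal_toReal hEtop]; exact hE j)).trans
      (ENNReal.ofReal_le_ofReal heE)
  have hsub : Ioo (1 / 2 : ℝ) (7 / 8) ⊆ Ioo 0 (31 / 32) :=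
    Ioo_subset_Ioo (by norm_num) (by norm_num)
  -- Otherwise infinitely many maps would be orientable on the circle with bounded energy there; a
  -- subsequence converges uniformly and the limit would be orientable.
  have hev : ∀ᵐ r ∂(volume.restrict (Ioo (1 / 2 : ℝ) (7 / 8))), ∃ J, ∀ j ≥ J,
      e ≤ G.circleEnergy c₀ ε (Q j) 0 r ∨ ¬ Orientable (G.dir ∘ Q j) 0 r := by
    filter_upwards [hnon, ae_restrict_of_ae_restrict_of_subset hsub (ae_circle hu),
      ae_restrict_mem measurableSet_Ioo] with r hW hur hrI
    have hr : 0 < r := by linarith [hrI.1]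
    by_contra! hfreq
    obtain ⟨φ, hφ, hφP⟩ := extraction_of_frequently_atTop (frequently_atTop.2 hfreq)
    obtain ⟨W, hWu, hWc, hWae⟩ := exists_tendstoUniformlyOn_sphere (Q := fun j => Q (φ j)) hc₀
      (fun j => hQ _) hr (fun j => (hφP j).1.le)
      (hur.mono fun θ hθ => hθ.comp hφ.tendsto_atTop)
    obtain ⟨⟨m, hm, hgap⟩, hno⟩ := hW W hWc hWae
    exact hno (orientable_of_tendstoUniformlyOn hr hWu hWc hm hgap fun j => (hφP j).2)
  let S : ℕ → Set ℝ := fun J => {r | r ∈ Ioo (1 / 2 : ℝ) (7 / 8) ∧ ∀ j ≥ J,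
    e ≤ G.circleEnergy c₀ ε (Q j) 0 r ∨ ¬ Orientable (G.dir ∘ Q j) 0 r}
  have hSmono : Monotone S := fun J J' h r hr => ⟨hr.1, fun j hj => hr.2 j (h.trans hj)⟩
  -- The interval has length `3 / 8`. A single index `J` keeps measure above `1 / 4`, and removing
  -- the radii of high energy, at most `1 / 16`, leaves more than the `1 / 8` needed by
  -- `exists_energy_ge`.
  have hSU : ENNReal.ofReal (1 / 4) < volume (⋃ J, S J) := by
    have h1 : volume (Ioo (1 / 2 : ℝ) (7 / 8)) ≤ volume (⋃ J, S J) := by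
      rw [ae_restrict_iff' measurableSet_Ioo] at hev
      refine measure_mono_ae ?_
      filter_upwards [hev] with r hr hrI
      obtain ⟨J, hJ⟩ := hr hrI
      exact mem_iUnion.2 ⟨J, hrI, hJ⟩
    refine lt_of_lt_of_le ?_ h1
    rw [Real.volume_Ioo]
    exact (ENNReal.ofReal_lt_ofReal_iff (by norm_num)).2 (by norm_num)
  rw [hSmono.measure_iUnion, lt_iSup_iff] at hSU
  obtain ⟨J, hJ⟩ := hSU
  refine (hcore (hQ J) hε hε1 (N := {r | r ∈ S J ∧ ¬ Orientable (G.dir ∘ Q J) 0 r})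
    (fun r hr => hr.1.1) ?_ fun r hr => hr.2).trans (hE J)
  by_contra! hN
  have hcov : S J ⊆ {r | r ∈ S J ∧ ¬ Orientable (G.dir ∘ Q J) 0 r} ∪
      (Ico (1 / 2) (7 / 8) ∩ {τ | e ≤ G.circleEnergy c₀ ε (Q J) 0 τ}) := by
    intro r hr
    rcases hr.2 J le_rfl with h | h
    · exact Or.inr ⟨Ioo_subset_Ico_self hr.1, h⟩
    · exact Or.inl ⟨hr, h⟩
  have h1 := (measure_mono hcov).trans ((measure_union_le _ _).trans (add_le_add hN (hB J)))
  rw [← ENNReal.ofReal_add (by norm_num) (by norm_num)] at h1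
  have h2 := (ENNReal.ofReal_lt_ofReal_iff (by norm_num)).1 (hJ.trans_le h1)
  norm_num at h2

end GapField

/-! ### Mollification -/

theorem sq_lintegral_le {α : Type*} [MeasurableSpace α] {ν : Measure α} (hν : ν univ ≤ 1)
    {f : α → ENNReal} (hf : AEMeasurable f ν) : (∫⁻ x, f x ∂ν) ^ 2 ≤ ∫⁻ x, f x ^ 2 ∂ν := by
  have h := ENNReal.lintegral_mul_le_Lp_mul_Lq ν Real.HolderConjugate.two_two hf
    (g := fun _ => 1) aemeasurable_const
  simp only [Pi.mul_apply, mul_one, ENNReal.one_rpow, lintegral_const, one_mul] at h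
  have h1 : (ν univ) ^ (1 / 2 : ℝ) ≤ 1 := ENNReal.rpow_le_one hν (by norm_num)
  have h2 : ∫⁻ x, f x ∂ν ≤ (∫⁻ x, f x ^ 2 ∂ν) ^ (1 / 2 : ℝ) := by
    refine h.trans ((mul_le_mul_right h1 _).trans ?_)
    rw [mul_one]
    simp only [ENNReal.rpow_two]
    exact le_rfl
  calc _ ≤ ((∫⁻ x, f x ^ 2 ∂ν) ^ (1 / 2 : ℝ)) ^ 2 := pow_le_pow_left' h2 2
    _ = _ := by rw [← ENNReal.rpow_two, ← ENNReal.rpow_mul]; norm_num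

section mollify

variable {X V : Type*} [NormedAddCommGroup X] [InnerProductSpace ℝ X] [FiniteDimensional ℝ X]
  [MeasurableSpace X] [BorelSpace X] [NormedAddCommGroup V] [NormedSpace ℝ V]

/-- The convolution of `f` with a normalised bump function. -/
def mollify (φ : ContDiffBump (0 : X)) (f : X → V) : X → V :=
  MeasureTheory.convolution (φ.normed volume) f (ContinuousLinearMap.lsmul ℝ ℝ) volume

theorem mollify_apply (φ : ContDiffBump (0 : X)) (f : X → V) (x : X) :
    mollify φ f x = ∫ t, φ.normed volume t • f (x - t) := rfl

theorem mollify_apply' (φ : ContDiffBump (0 : X)) (f : X → V) (x : X) :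
    mollify φ f x = ∫ t, φ.normed volume (x - t) • f t :=
  convolution_lsmul_swap

/-- Jensen's inequality for the probability density of the bump, then Fubini and translation
invariance. The constant one matters, since the leading coefficient must not deteriorate. -/
theorem lintegral_mollify_sq_le (φ : ContDiffBump (0 : X)) {f : X → V}
    (hf : AEStronglyMeasurable f volume) :
    ∫⁻ x, ‖mollify φ f x‖ₑ ^ 2 ≤ ∫⁻ x, ‖f x‖ₑ ^ 2 := by
  have hφ : Measurable fun t => ENNReal.ofReal (φ.normed volume t) :=
    ENNReal.measurable_ofReal.comp φ.continuous_normed.measurable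
  have hφ1 : ∫⁻ t, ENNReal.ofReal (φ.normed volume t) = 1 := by
    rw [← ofReal_integral_eq_lintegral_ofReal φ.integrable_normed
      (Eventually.of_forall φ.nonneg_normed), φ.integral_normed, ENNReal.ofReal_one]
  have hpt : ∀ x, ‖mollify φ f x‖ₑ ^ 2 ≤
      ∫⁻ t, ENNReal.ofReal (φ.normed volume t) * ‖f (x - t)‖ₑ ^ 2 := by
    intro x
    have hfx : AEMeasurable (fun t => ‖f (x - t)‖ₑ) volume :=
      (hf.comp_measurePreserving (Measure.measurePreserving_sub_left volume x)).enorm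
    have h1 : ‖mollify φ f x‖ₑ ≤
        ∫⁻ t, ‖f (x - t)‖ₑ ∂(volume.withDensity fun t => ENNReal.ofReal (φ.normed volume t)) := by
      rw [lintegral_withDensity_eq_lintegral_mul₀ hφ.aemeasurable hfx, mollify_apply]
      refine (enorm_integral_le_lintegral_enorm _).trans (le_of_eq ?_)
      refine lintegral_congr fun t => ?_
      rw [enorm_smul, Real.enorm_of_nonneg (φ.nonneg_normed t)]
      rfl
    refine (pow_le_pow_left' h1 2).trans ((sq_lintegral_le ?_ ?_).trans (le_of_eq ?_))
    · rw [withDensity_apply _ MeasurableSet.univ, Measure.restrict_univ, hφ1]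
    · exact hfx.mono_ac (withDensity_absolutelyContinuous _ _)
    · rw [lintegral_withDensity_eq_lintegral_mul₀ hφ.aemeasurable (hfx.pow_const 2)]
      rfl
  refine (lintegral_mono hpt).trans (le_of_eq ?_)
  rw [lintegral_lintegral_swap]
  · have h2 : ∀ t, ∫⁻ x, ENNReal.ofReal (φ.normed volume t) * ‖f (x - t)‖ₑ ^ 2 =
        ENNReal.ofReal (φ.normed volume t) * ∫⁻ x, ‖f x‖ₑ ^ 2 := by
      intro t
      rw [lintegral_const_mul' _ _ ENNReal.ofReal_ne_top,
        lintegral_sub_right_eq_self (fun x => ‖f x‖ₑ ^ 2) t]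
    simp only [h2]
    rw [lintegral_mul_const _ hφ, hφ1, one_mul]
  · exact (hφ.comp measurable_snd).aemeasurable.mul
      ((hf.comp_quasiMeasurePreserving (quasiMeasurePreserving_sub volume volume)).enorm.pow_const 2)

theorem contDiff_mollify (φ : ContDiffBump (0 : X)) {f : X → V} (hf : LocallyIntegrable f volume) :
    ContDiff ℝ 1 (mollify φ f) :=
  φ.hasCompactSupport_normed.contDiff_convolution_left _ (φ.contDiff_normed (n := 1)) hf

theorem fderiv_mollify_apply (φ : ContDiffBump (0 : X)) {f : X → V}
    (hf : LocallyIntegrable f volume) (x e : X) :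
    fderiv ℝ (mollify φ f) x e = ∫ t, fderiv ℝ (φ.normed volume) (x - t) e • f t := by
  have hφ : ContDiff ℝ 1 (φ.normed volume) := φ.contDiff_normed (n := 1)
  have h := φ.hasCompactSupport_normed.hasFDerivAt_convolution_left
    (ContinuousLinearMap.lsmul ℝ ℝ) (μ := volume) hφ hf x
  have hex := (φ.hasCompactSupport_normed (μ := volume)).fderiv (𝕜 := ℝ)
    |>.convolutionExists_left ((ContinuousLinearMap.lsmul ℝ ℝ : ℝ →L[ℝ] V →L[ℝ] V).precompL X)
      (hφ.continuous_fderiv one_ne_zero) hf x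
  unfold mollify
  rw [h.fderiv, convolution_def, ContinuousLinearMap.integral_apply hex]
  rw [← integral_sub_left_eq_self _ volume x]
  simp

/-- Mollification commutes with weak derivatives away from the boundary. -/
theorem fderiv_mollify_eq (φ : ContDiffBump (0 : X)) {u g : X → V} {R : ℝ} {e : X}
    (hu : LocallyIntegrable ((ball 0 R).indicator u) volume)
    (hweak : ∀ ψ : X → ℝ, ContDiff ℝ ∞ ψ → HasCompactSupport ψ → tsupport ψ ⊆ ball 0 R →
      ∫ x in ball 0 R, fderiv ℝ ψ x e • u x = -∫ x in ball 0 R, ψ x • g x)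
    {x : X} (hx : ‖x‖ + φ.rOut < R) :
    fderiv ℝ (mollify φ ((ball 0 R).indicator u)) x e = mollify φ ((ball 0 R).indicator g) x := by
  rw [fderiv_mollify_apply φ hu, mollify_apply']
  have h1 : ∀ (q : X → ℝ) (f : X → V), ∫ t, q t • (ball 0 R).indicator f t =
      ∫ t in ball 0 R, q t • f t := by
    intro q f
    rw [← integral_indicator measurableSet_ball]
    congr 1
    ext t
    by_cases ht : t ∈ ball (0 : X) R <;> simp [ht]
  rw [h1, h1]
  have hφ : ContDiff ℝ ∞ (φ.normed (volume : Measure X)) := φ.contDiff_normed (n := ⊤)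
  have hsub : ContDiff ℝ ∞ fun t : X => x - t := contDiff_const.sub contDiff_id
  have hsupp : Function.support (fun t => φ.normed volume (x - t)) ⊆ closedBall x φ.rOut := by
    intro t ht
    have : x - t ∈ Function.support (φ.normed (volume : Measure X)) := ht
    rw [φ.support_normed_eq, mem_ball_zero_iff] at this
    rw [mem_closedBall, dist_comm, dist_eq_norm]
    exact this.le
  have hts : tsupport (fun t => φ.normed volume (x - t)) ⊆ closedBall x φ.rOut :=
    closure_minimal hsupp isClosed_closedBall
  have h := hweak (fun t => φ.normed volume (x - t)) (hφ.comp hsub)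
    (HasCompactSupport.of_support_subset_isCompact (isCompact_closedBall x φ.rOut) hsupp)
    (hts.trans (closedBall_subset_ball' (by rw [dist_zero_right]; linarith)))
  have hd : ∀ t, fderiv ℝ (fun t => φ.normed volume (x - t)) t e =
      -fderiv ℝ (φ.normed volume) (x - t) e := by
    intro t
    have h2 : HasFDerivAt (fun t : X => x - t) (-ContinuousLinearMap.id ℝ X) t :=
      (hasFDerivAt_id t).const_sub x
    have h3 := ((hφ.differentiable (by simp) (x - t)).hasFDerivAt).comp t h2
    have h4 : fderiv ℝ (fun t => φ.normed volume (x - t)) t =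
      (fderiv ℝ (φ.normed volume) (x - t)).comp (-ContinuousLinearMap.id ℝ X) := h3.fderiv
    rw [h4]
    simp
  simp only [hd, neg_smul, integral_neg, neg_inj] at h
  exact h

/-- Approximation of a Sobolev map in the unit ball by maps of class `C¹`. -/
theorem exists_approximation [CompleteSpace V] {ι : Type*} {u : X → V} {g : ι → X → V} {e : ι → X} {R R' : ℝ}
    (hR : R' < R) (hu : MemLp u 2 (volume.restrict (ball 0 R)))
    (hg : ∀ k, MemLp (g k) 2 (volume.restrict (ball 0 R)))
    (hweak : ∀ k, ∀ ψ : X → ℝ, ContDiff ℝ ∞ ψ → HasCompactSupport ψ → tsupport ψ ⊆ ball 0 R →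
      ∫ x in ball 0 R, fderiv ℝ ψ x (e k) • u x = -∫ x in ball 0 R, ψ x • g k x) :
    ∃ U : ℕ → X → V, (∀ j, ContDiff ℝ 1 (U j)) ∧
      (∀ᵐ x ∂(volume.restrict (ball 0 R)), Tendsto (fun j => U j x) atTop (𝓝 (u x))) ∧
      ∀ j k, ∫⁻ x in ball 0 R', ‖fderiv ℝ (U j) x (e k)‖ₑ ^ 2 ≤ ∫⁻ x in ball 0 R, ‖g k x‖ₑ ^ 2 := by
  have hlu : LocallyIntegrable ((ball 0 R).indicator u) volume :=
    ((memLp_indicator_iff_restrict measurableSet_ball).2 hu).locallyIntegrable (by norm_num)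
  -- The outer radius stays below `R - R'`, so weak derivatives commute with mollification on the
  -- smaller ball. The fixed ratio two of the radii is what pointwise convergence at almost every
  -- point requires.
  let φ : ℕ → ContDiffBump (0 : X) := fun j =>
    { rIn := (R - R') / 4 / (j + 1)
      rOut := (R - R') / 2 / (j + 1)
      rIn_pos := by have := sub_pos.2 hR; positivity
      rIn_lt_rOut := by
        have := sub_pos.2 hR
        gcongr
        norm_num }
  have hrOut : ∀ j, (φ j).rOut = (R - R') / 2 / (j + 1) := fun _ => rfl
  have hrIn : ∀ j, (φ j).rIn = (R - R') / 4 / (j + 1) := fun _ => rfl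
  refine ⟨fun j => mollify (φ j) ((ball 0 R).indicator u), fun j => contDiff_mollify _ hlu, ?_,
    fun j k => ?_⟩
  · have h := ContDiffBump.ae_convolution_tendsto_right_of_locallyIntegrable (φ := φ) (K := 2)
      (l := atTop) (by
        simp only [hrOut]
        have := (tendsto_one_div_add_atTop_nhds_zero_nat (𝕜 := ℝ)).const_mul ((R - R') / 2)
        simpa [div_eq_mul_inv] using this)
      (Eventually.of_forall fun j => by rw [hrOut, hrIn]; apply le_of_eq; ring) hlu
    filter_upwards [ae_restrict_of_ae h, ae_restrict_mem measurableSet_ball] with x hx hxR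
    rw [indicator_of_mem hxR] at hx
    exact hx
  · have hsmall : (φ j).rOut < R - R' := by
      rw [hrOut]
      have := sub_pos.2 hR
      refine (div_le_self (by positivity) (by linarith [(Nat.cast_nonneg j : (0 : ℝ) ≤ j)])).trans_lt
        (by linarith)
    calc ∫⁻ x in ball 0 R', ‖fderiv ℝ (mollify (φ j) ((ball 0 R).indicator u)) x (e k)‖ₑ ^ 2
        = ∫⁻ x in ball 0 R', ‖mollify (φ j) ((ball 0 R).indicator (g k)) x‖ₑ ^ 2 := by
          refine setLIntegral_congr_fun measurableSet_ball fun x hx => ?_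
          rw [mem_ball_zero_iff] at hx
          rw [fderiv_mollify_eq (φ j) hlu (hweak k) (by linarith)]
      _ ≤ ∫⁻ x, ‖mollify (φ j) ((ball 0 R).indicator (g k)) x‖ₑ ^ 2 := setLIntegral_le_lintegral _ _
      _ ≤ ∫⁻ x, ‖(ball 0 R).indicator (g k) x‖ₑ ^ 2 := lintegral_mollify_sq_le _
          ((memLp_indicator_iff_restrict measurableSet_ball).2 (hg k)).1
      _ = _ := by
          rw [← lintegral_indicator measurableSet_ball]
          refine lintegral_congr fun x => ?_
          by_cases hx : x ∈ ball (0 : X) R <;> simp [hx]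

end mollify

/-- It upgrades closed conditions known at almost every angle to all angles: a set of full measure
is dense. -/
theorem Icc_subset_of_ae {a b : ℝ} (hab : a < b) {C : Set ℝ} (hC : IsClosed C)
    (h : ∀ᵐ θ ∂(volume.restrict (Ioo a b)), θ ∈ C) : Icc a b ⊆ C := by
  have hd : Dense {θ | θ ∈ Ioo a b → θ ∈ C} :=
    Measure.dense_of_ae ((ae_restrict_iff' measurableSet_Ioo).1 h)
  rw [← closure_Ioo hab.ne]
  refine closure_minimal ((hd.open_subset_closure_inter isOpen_Ioo).trans ?_) hC
  exact closure_minimal (fun θ hθ => hθ.2 hθ.1) hC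

/-! ### The plane and the complex numbers -/

/-- The identification of `ℂ` with the plane. -/
def complexEquiv : ℂ ≃ₗᵢ[ℝ] Plane := Complex.orthonormalBasisOneI.repr

theorem complexEquiv_one : complexEquiv 1 = EuclideanSpace.single 0 1 := by
  have := Complex.orthonormalBasisOneI.repr_self 0
  rwa [Complex.coe_orthonormalBasisOneI] at this

theorem complexEquiv_I : complexEquiv Complex.I = EuclideanSpace.single 1 1 := by
  have := Complex.orthonormalBasisOneI.repr_self 1
  rwa [Complex.coe_orthonormalBasisOneI] at this

theorem complexEquiv_circleMap (r θ : ℝ) : complexEquiv (circleMap 0 r θ) = polarPoint r θ := by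
  have h : circleMap 0 r θ = (r * Real.cos θ) • (1 : ℂ) + (r * Real.sin θ) • Complex.I := by
    rw [circleMap, Complex.exp_mul_I, ← Complex.ofReal_cos, ← Complex.ofReal_sin]
    simp only [Complex.real_smul]
    push_cast
    ring
  rw [h, map_add, map_smul, map_smul, complexEquiv_one, complexEquiv_I]
  ext i
  fin_cases i <;> simp [polarPoint]

theorem ae_complexEquiv {R : ℝ} {P : Plane → Prop}
    (h : ∀ᵐ x ∂(volume.restrict (ball (0 : Plane) R)), P x) :
    ∀ᵐ z ∂(volume.restrict (ball (0 : ℂ) R)), P (complexEquiv z) := by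
  rw [ae_restrict_iff' measurableSet_ball] at h ⊢
  filter_upwards [complexEquiv.measurePreserving.quasiMeasurePreserving.ae h] with z hz hzR
  refine hz ?_
  rw [mem_ball_zero_iff] at hzR ⊢
  rwa [complexEquiv.norm_map]

theorem lintegral_complexEquiv {R : ℝ} (f : Plane → ENNReal) :
    ∫⁻ z in ball (0 : ℂ) R, f (complexEquiv z) = ∫⁻ x in ball (0 : Plane) R, f x := by
  rw [← complexEquiv.measurePreserving.setLIntegral_comp_preimage_emb
    complexEquiv.toHomeomorph.measurableEmbedding]
  congr 2
  ext z
  simp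

/-! ### The boundary condition -/

section boundary

variable {a b c : ℝ} (ha : 0 < a) (hb : 0 < b) (hc : 0 < c)

theorem tensorField_gap_entries (Q : S0) : (tensorField ha hb hc).gap (entries Q) = phi a b c Q := by
  change phi a b c (toTensor (entries Q)) = _
  rw [toTensor_entries]

theorem tensorField_dir_entries (Q : S0) :
    (tensorField ha hb hc).dir (entries Q) = WithLp.toLp 2 (leadingEigenvector Q) := by
  change WithLp.toLp 2 (leadingEigenvector (toTensor (entries Q))) = _
  rw [toTensor_entries]

/-- The entries are expressed through the projection, the only part of the director known to vary
continuously. -/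
theorem uniaxial_apply (s : ℝ) (v : EuclideanSpace ℝ (Fin 3)) (hv : (v : Fin 3 → ℝ) ⬝ᵥ v = 1)
    (i j : Fin 3) : (uniaxial s v hv).1 i j =
      s * (lineProj v (EuclideanSpace.single j 1) i - 1 / 3 * (1 : Matrix (Fin 3) (Fin 3) ℝ) i j) := by
  have : (uniaxial s v hv).1 =
      s • (Matrix.vecMulVec v v - (1 / 3 : ℝ) • (1 : Matrix (Fin 3) (Fin 3) ℝ)) := rfl
  rw [this, lineProj_apply]
  simp [Matrix.vecMulVec_apply, EuclideanSpace.inner_single_right, mul_comm]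

/-- The trace of the tensor field on a circle with nontrivial boundary class is not orientable. -/
theorem not_orientable_of_not_nullhomotopic {Q : Plane → S0} {r m : ℝ} (hr : 0 < r) (hm : 0 < m)
    (hphi : ∀ᵐ θ ∂(volume.restrict (Ioo (-Real.pi) Real.pi)), m ≤ phi a b c (Q (polarPoint r θ)))
    {γ : C(Circle, vacuum a b c)}
    (hγ : ∀ᵐ θ : ℝ, (γ (Circle.exp θ) : S0) = rho a b c (Q (polarPoint r θ)))
    (hnull : ¬ γ.Nullhomotopic) {W : ℂ → MatrixSpace} (hW : ContinuousOn W (sphere 0 r))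
    (hWQ : ∀ᵐ θ ∂(volume.restrict (Ioo (-Real.pi) Real.pi)),
      W (circleMap 0 r θ) = entries (Q (complexEquiv (circleMap 0 r θ)))) :
    (∀ z ∈ sphere (0 : ℂ) r, m ≤ (tensorField ha hb hc).gap (W z)) ∧
      ¬ Orientable ((tensorField ha hb hc).dir ∘ W) 0 r := by
  have hπ : -Real.pi < Real.pi := by linarith [Real.pi_pos]
  set G := tensorField ha hb hc with hG
  have hWc : Continuous fun θ => W (circleMap 0 r θ) :=
    hW.comp_continuous (continuous_circleMap 0 r) fun θ => by
      rw [mem_sphere_zero_iff_norm, norm_circleMap_zero, abs_of_pos hr]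
  simp only [complexEquiv_circleMap] at hWQ
  have hgapθ : Icc (-Real.pi) Real.pi ⊆ {θ | m ≤ G.gap (W (circleMap 0 r θ))} := by
    refine Icc_subset_of_ae hπ
      (isClosed_le continuous_const (G.continuous_gap.comp hWc)) ?_
    filter_upwards [hphi, hWQ] with θ h1 h2
    rw [h2, tensorField_gap_entries]
    exact h1
  have hgap : ∀ z ∈ sphere (0 : ℂ) r, m ≤ G.gap (W z) := by
    intro z hz
    have := hgapθ (Ioc_subset_Icc_self (Complex.arg_mem_Ioc z))
    rwa [Set.mem_ofPred_eq, GapField.circleMap_arg hz] at this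
  refine ⟨hgap, fun hor => hnull ?_⟩
  have hproj : ContinuousOn (fun z => lineProj (G.dir (W z))) (sphere 0 r) :=
    G.continuousOn_lineProj hW fun z hz => hm.trans_le (hgap z hz)
  have hprojθ : Continuous fun θ => lineProj (G.dir (W (circleMap 0 r θ))) :=
    hproj.comp_continuous (continuous_circleMap 0 r) fun θ => by
      rw [mem_sphere_zero_iff_norm, norm_circleMap_zero, abs_of_pos hr]
  have hunit : ∀ v, (G.dir v : Fin 3 → ℝ) ⬝ᵥ G.dir v = 1 := fun v =>
    dotProduct_eq_one_of_mem_sphere (mem_sphere_zero_iff_norm.2 (G.norm_dir v))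
  -- Both sides are continuous in the angle and agree almost everywhere, so the loop is the uniaxial
  -- tensor of the directors of `W` at every angle.
  have hθ : Icc (-Real.pi) Real.pi ⊆ {θ | ∀ i j, (γ (Circle.exp θ) : S0).1 i j =
      (uniaxial (sStar a b c) (G.dir (W (circleMap 0 r θ))) (hunit _)).1 i j} := by
    refine Icc_subset_of_ae hπ ?_ ?_
    · simp only [uniaxial_apply, Set.ofPred_forall]
      refine isClosed_iInter fun i => isClosed_iInter fun j => isClosed_eq ?_ ?_
      · have h1 : Continuous fun θ => (γ (Circle.exp θ) : S0).1 :=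
          continuous_subtype_val.comp (continuous_subtype_val.comp
            (γ.continuous.comp Circle.exp.continuous))
        exact (continuous_apply_apply i j).comp h1
      · have h2 : Continuous fun θ =>
            lineProj (G.dir (W (circleMap 0 r θ))) (EuclideanSpace.single j 1) i :=
          (EuclideanSpace.proj i : EuclideanSpace ℝ (Fin 3) →L[ℝ] ℝ).continuous.comp
            (hprojθ.clm_apply continuous_const)
        exact continuous_const.mul (h2.sub continuous_const)
    · filter_upwards [ae_restrict_of_ae hγ, hWQ] with θ h1 h2 i j
      rw [h1]
      have : (G.dir (W (circleMap 0 r θ)) : Fin 3 → ℝ) = leadingEigenvector (Q (polarPoint r θ)) := by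
        rw [h2, hG, tensorField_dir_entries]
      unfold rho
      simp only [this]
  refine nullhomotopic_of_orientable ha hb hc γ (n := G.dir ∘ W) (fun z => G.norm_dir _)
    (fun z hz => ?_) hor
  have h1 := hθ (Ioc_subset_Icc_self (Complex.arg_mem_Ioc z))
  have h2 : circleMap 0 r (Complex.arg z) = r * z := by
    have h3 := GapField.circleMap_arg (r := r) (z := r * z) (by
      rw [mem_sphere_zero_iff_norm, norm_mul, z.norm_coe, mul_one, Complex.norm_real,
        Real.norm_eq_abs, abs_of_pos hr])
    rwa [Complex.arg_real_mul _ hr] at h3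
  simp only [Set.mem_ofPred_eq, Circle.exp_arg] at h1
  apply Subtype.ext
  ext i j
  rw [h1 i j]
  simp only [Function.comp_apply, h2]

end boundary

/-! ### Sobolev maps with values in the space of tensors -/

theorem norm_entries_sq (Q : S0) : ‖entries Q‖ ^ 2 = ∑ i, ∑ j, Q.1 i j ^ 2 := by
  rw [EuclideanSpace.norm_sq_eq, Fintype.sum_prod_type]
  simp [entries_apply]

theorem memLp_entries {f : Plane → S0} {μ : Measure Plane}
    (h : ∀ i j, MemLp (fun x => (f x).1 i j) 2 μ) : MemLp (fun x => entries (f x)) 2 μ :=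
  MemLp.of_eval_piLp fun p => h p.1 p.2

theorem integral_smul_entries {f : Plane → S0} {s : Set Plane} {q : Plane → ℝ}
    (h : Integrable (fun x => q x • entries (f x)) (volume.restrict s)) (p : Fin 3 × Fin 3) :
    (∫ x in s, q x • entries (f x)) p = ∫ x in s, (f x).1 p.1 p.2 * q x := by
  have h1 := (EuclideanSpace.proj p : MatrixSpace →L[ℝ] ℝ).integral_comp_comm h
  refine h1.symm.trans (integral_congr_ae (Eventually.of_forall fun x => ?_))
  simp [entries_apply, mul_comm]

theorem IsH1.weak_entries {R : ℝ} {Q : Plane → S0} {DQ : Fin 2 → Plane → S0}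
    (h : IsH1 (ball 0 R) Q DQ) (k : Fin 2) (ψ : Plane → ℝ) (hψ : ContDiff ℝ ∞ ψ)
    (hψc : HasCompactSupport ψ) (hψs : tsupport ψ ⊆ ball 0 R) :
    ∫ x in ball 0 R, fderiv ℝ ψ x (EuclideanSpace.single k 1) • entries (Q x) =
      -∫ x in ball 0 R, ψ x • entries (DQ k x) := by
  have hfin : IsFiniteMeasure (volume.restrict (ball (0 : Plane) R)) :=
    ⟨by rw [Measure.restrict_apply_univ]; exact measure_ball_lt_top⟩
  have hint : ∀ {q : Plane → ℝ} {f : Plane → S0}, Continuous q → HasCompactSupport q →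
      (∀ i j, MemLp (fun x => (f x).1 i j) 2 (volume.restrict (ball 0 R))) →
      Integrable (fun x => q x • entries (f x)) (volume.restrict (ball 0 R)) := by
    intro q f hq hqc hf
    obtain ⟨C, hC⟩ := hqc.exists_bound_of_continuous hq
    exact ((memLp_entries hf).integrable (by norm_num)).bdd_smul C hq.aestronglyMeasurable
      (Eventually.of_forall hC)
  have hd : Continuous fun x => fderiv ℝ ψ x (EuclideanSpace.single k 1) :=
    (hψ.continuous_fderiv (by simp)).clm_apply continuous_const
  have hdc : HasCompactSupport fun x => fderiv ℝ ψ x (EuclideanSpace.single k 1) :=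
    hψc.fderiv_apply ℝ _
  ext p
  rw [integral_smul_entries (hint hd hdc h.memLp), PiLp.neg_apply,
    integral_smul_entries (hint hψ.continuous hψc (h.memLp_grad k))]
  exact h.weak k p.1 p.2 ψ hψ hψc hψs

section energy

variable {a b c : ℝ}

/-- The energy controls the Dirichlet energy and the penalisation separately. -/
theorem lintegral_add_le_energy {c₀ : ℝ} (hc₀ : 0 < c₀)
    (hpot : ∀ Q : S0, c₀ * pen (phi a b c Q) ≤ potential a b c Q) {ε : ℝ} {R : ℝ} {Q : Plane → S0}
    {DQ : Fin 2 → Plane → S0} (hQ : IsH1 (ball 0 R) Q DQ) :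
    (∫⁻ x in ball 0 R, ENNReal.ofReal (1 / 2) * ∑ k, ‖entries (DQ k x)‖ₑ ^ 2) +
      ∫⁻ x in ball 0 R, ENNReal.ofReal (c₀ / ε ^ 2 * pen (phi a b c (Q x))) ≤
      energy a b c ε Q DQ (ball 0 R) := by
  have hm : AEMeasurable (fun x => ENNReal.ofReal (1 / 2) * ∑ k, ‖entries (DQ k x)‖ₑ ^ 2)
      (volume.restrict (ball 0 R)) :=
    (Finset.aemeasurable_fun_sum _ fun k _ =>
      (memLp_entries (hQ.memLp_grad k)).1.enorm.pow_const 2).const_mul _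
  rw [← lintegral_add_left' hm]
  refine lintegral_mono fun x => ?_
  have h1 : ENNReal.ofReal (1 / 2) * ∑ k, ‖entries (DQ k x)‖ₑ ^ 2 =
      ENNReal.ofReal (1 / 2 * ∑ k, ‖entries (DQ k x)‖ ^ 2) := by
    rw [ENNReal.ofReal_mul (by norm_num), ENNReal.ofReal_sum_of_nonneg fun _ _ => sq_nonneg _]
    simp only [ENNReal.ofReal_pow (norm_nonneg _), ofReal_norm]
  have h2 := pen_nonneg (phi a b c (Q x))
  rw [h1, ← ENNReal.ofReal_add (by positivity) (by positivity)]
  apply ENNReal.ofReal_le_ofReal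
  unfold energyDensity
  simp only [norm_entries_sq]
  refine add_le_add le_rfl ?_
  rw [div_mul_eq_mul_div, one_div_mul_eq_div]
  exact div_le_div_of_nonneg_right (hpot _) (sq_nonneg ε)

/-- The energy density of a map on the plane, read in the complex plane. -/
theorem ofReal_density_comp (G : GapField MatrixSpace (EuclideanSpace ℝ (Fin 3))) {c₀ ε : ℝ}
    (hc₀ : 0 < c₀) {U : Plane → MatrixSpace} (hU : ContDiff ℝ 1 U) (z : ℂ) :
    ENNReal.ofReal (G.density c₀ ε (U ∘ complexEquiv) z) =
      ENNReal.ofReal (1 / 2) *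
        ∑ k, ‖fderiv ℝ U (complexEquiv z) (EuclideanSpace.single k 1)‖ₑ ^ 2 +
      ENNReal.ofReal (c₀ / ε ^ 2 * pen (G.gap (U (complexEquiv z)))) := by
  have hd : ∀ w, fderiv ℝ (U ∘ complexEquiv) z w =
      fderiv ℝ U (complexEquiv z) (complexEquiv w) := by
    intro w
    have h1 := ((hU.differentiable one_ne_zero (complexEquiv z)).hasFDerivAt).comp z
      complexEquiv.toContinuousLinearEquiv.hasFDerivAt
    have h2 : fderiv ℝ (U ∘ complexEquiv) z = _ := h1.fderiv
    rw [h2]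
    rfl
  have h2 := pen_nonneg (G.gap (U (complexEquiv z)))
  have h3 : ENNReal.ofReal (1 / 2) *
        ∑ k, ‖fderiv ℝ U (complexEquiv z) (EuclideanSpace.single k 1)‖ₑ ^ 2 =
      ENNReal.ofReal (1 / 2 *
        ∑ k, ‖fderiv ℝ U (complexEquiv z) (EuclideanSpace.single k 1)‖ ^ 2) := by
    rw [ENNReal.ofReal_mul (by norm_num), ENNReal.ofReal_sum_of_nonneg fun _ _ => sq_nonneg _]
    simp only [ENNReal.ofReal_pow (norm_nonneg _), ofReal_norm]
  rw [h3, ← ENNReal.ofReal_add (by positivity) (by positivity)]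
  congr 1
  unfold GapField.density
  rw [hd, hd, complexEquiv_one, complexEquiv_I, Fin.sum_univ_two]
  simp only [Function.comp_apply]
  ring

/-- Mollification does not increase the Dirichlet energy and makes the penalty converge, so the
bound for `C¹` maps passes to the limit. The lower bound `m` for the gap enters only through its
positivity, hence the coefficient is the full `κ_*` and `M` does not depend on `m`. -/
theorem exists_energy_ge_of_isH1 (ha : 0 < a) (hb : 0 < b) (hc : 0 < c) :
    ∃ M : ℝ, 0 < M ∧ ∀ {ε : ℝ}, 0 < ε → ε < 1 →
    ∀ {Q : Plane → S0} {DQ : Fin 2 → Plane → S0}, IsH1 (ball 0 1) Q DQ →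
    ∀ {m : ℝ}, 0 < m → (∀ᵐ x ∂(volume.restrict annulus), m ≤ phi a b c (Q x)) →
    NontrivialBoundaryClass a b c Q →
    ENNReal.ofReal (kappaStar a b c * |Real.log ε| - M) ≤ energy a b c ε Q DQ (ball 0 1) := by
  obtain ⟨c₀, hc₀, hpot⟩ := exists_pen_le_potential ha hb hc
  obtain ⟨M, hM, hmain⟩ := (tensorField ha hb hc).exists_energy_ge_of_tendsto hc₀
  refine ⟨M, hM, fun {ε} hε hε1 {Q DQ} hQ {m} hm hphi hbd => ?_⟩
  obtain ⟨U, hU, hUlim, hUgrad⟩ := exists_approximation (e := fun k : Fin 2 =>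
    (EuclideanSpace.single k 1 : Plane)) (R' := 31 / 32) (by norm_num) (memLp_entries hQ.memLp)
    (fun k => memLp_entries (hQ.memLp_grad k)) hQ.weak_entries
  have hE := lintegral_add_le_energy (ε := ε) hc₀ hpot hQ
  set A := ∫⁻ x in ball (0 : Plane) 1, ENNReal.ofReal (1 / 2) * ∑ k, ‖entries (DQ k x)‖ₑ ^ 2
    with hA
  set B := ∫⁻ x in ball (0 : Plane) 1, ENNReal.ofReal (c₀ / ε ^ 2 * pen (phi a b c (Q x)))
  have hgapc := (tensorField ha hb hc).continuous_gap
  have hpenc : ∀ j, Continuous fun x =>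
      ENNReal.ofReal (c₀ / ε ^ 2 * pen ((tensorField ha hb hc).gap (U j x))) := fun j =>
    ENNReal.continuous_ofReal.comp (continuous_const.mul
      (continuous_pen.comp (hgapc.comp (hU j).continuous)))
  have hsubset : ball (0 : Plane) (31 / 32) ⊆ ball 0 1 := ball_subset_ball (by norm_num)
  have hlim : Tendsto (fun j => ∫⁻ x in ball (0 : Plane) (31 / 32),
      ENNReal.ofReal (c₀ / ε ^ 2 * pen ((tensorField ha hb hc).gap (U j x)))) atTop
      (𝓝 (∫⁻ x in ball (0 : Plane) (31 / 32),
        ENNReal.ofReal (c₀ / ε ^ 2 * pen (phi a b c (Q x))))) := by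
    refine tendsto_lintegral_of_dominated_convergence' (fun _ => ENNReal.ofReal (c₀ / ε ^ 2))
      (fun j => (hpenc j).measurable.aemeasurable) (fun j => Eventually.of_forall fun x => ?_) ?_ ?_
    · apply ENNReal.ofReal_le_ofReal
      refine mul_le_of_le_one_right (by positivity) ?_
      -- The gap is never negative, so the penalty is at most one and dominated convergence applies
      -- without bounds on the maps.
      have h0 : 0 ≤ (tensorField ha hb hc).gap (U j x) := phi_nonneg ha hb hc _
      unfold pen
      exact pow_le_one₀ (le_max_left _ _) (max_le zero_le_one (by linarith))
    · rw [setLIntegral_const]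
      exact ENNReal.mul_ne_top ENNReal.ofReal_ne_top measure_ball_lt_top.ne
    · filter_upwards [ae_restrict_of_ae_restrict_of_subset hsubset hUlim] with x hx
      have hcont : Continuous fun v : MatrixSpace =>
          ENNReal.ofReal (c₀ / ε ^ 2 * pen ((tensorField ha hb hc).gap v)) :=
        ENNReal.continuous_ofReal.comp (continuous_const.mul (continuous_pen.comp hgapc))
      have h1 := (hcont.tendsto _).comp hx
      simp only [tensorField_gap_entries] at h1
      exact h1
  have hLB : ∫⁻ x in ball (0 : Plane) (31 / 32),
      ENNReal.ofReal (c₀ / ε ^ 2 * pen (phi a b c (Q x))) ≤ B := lintegral_mono_set hsubset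
  by_cases htop : energy a b c ε Q DQ (ball 0 1) = ⊤
  · rw [htop]; exact le_top
  have hBtop : B ≠ ⊤ := ne_top_of_le_ne_top htop (le_add_self.trans hE)
  -- Only the limit of the penalty is controlled, so the approximations satisfy the energy bound up
  -- to `δ` after an index shift.
  refine ENNReal.le_of_forall_pos_le_add fun δ hδ _ => ?_
  have hδ' : (δ : ENNReal) ≠ 0 := by exact_mod_cast hδ.ne'
  obtain ⟨J, hJ⟩ := eventually_atTop.1 (hlim.eventually_lt_const
    (hLB.trans_lt (ENNReal.lt_add_right hBtop hδ')))
  rw [← tensorField_kappa ha hb hc]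
  refine hmain (Q := fun j => U (j + J) ∘ complexEquiv)
    (fun j => (hU _).comp complexEquiv.contDiff) hε hε1 (E := energy a b c ε Q DQ (ball 0 1) + δ)
    (fun j => ?_) (u := fun z => entries (Q (complexEquiv z))) ?_ ?_
  · simp only [ofReal_density_comp (tensorField ha hb hc) hc₀ (hU _)]
    rw [lintegral_complexEquiv (fun x => ENNReal.ofReal (1 / 2) *
        ∑ k, ‖fderiv ℝ (U (j + J)) x (EuclideanSpace.single k 1)‖ₑ ^ 2 +
      ENNReal.ofReal (c₀ / ε ^ 2 * pen ((tensorField ha hb hc).gap (U (j + J) x)))),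
      lintegral_add_right _ (hpenc _).measurable]
    have h1 : ∫⁻ x in ball (0 : Plane) (31 / 32), ENNReal.ofReal (1 / 2) *
        ∑ k, ‖fderiv ℝ (U (j + J)) x (EuclideanSpace.single k 1)‖ₑ ^ 2 ≤ A := by
      rw [hA, lintegral_const_mul' _ _ ENNReal.ofReal_ne_top,
        lintegral_const_mul' _ _ ENNReal.ofReal_ne_top,
        lintegral_finsetSum' _ fun k _ =>
          (memLp_entries (hQ.memLp_grad k)).1.enorm.pow_const 2,
        lintegral_finsetSum' _ fun k _ =>
          ((((hU (j + J)).continuous_fderiv one_ne_zero).clm_apply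
            continuous_const).enorm.measurable.aemeasurable.pow_const 2)]
      exact mul_le_mul_right (Finset.sum_le_sum fun k _ => hUgrad (j + J) k) _
    calc _ ≤ A + (B + δ) := add_le_add h1 (hJ _ (by omega)).le
      _ = A + B + δ := (add_assoc _ _ _).symm
      _ ≤ _ := by gcongr
  · have h1 := ae_complexEquiv hUlim
    filter_upwards [ae_restrict_of_ae_restrict_of_subset
      (ball_subset_ball (by norm_num : (31 / 32 : ℝ) ≤ 1)) h1] with z hz
    exact hz.comp (tendsto_add_atTop_nat J)
  · have h1 : ∀ᵐ x ∂(volume.restrict (ball (0 : Plane) 1)),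
        x ∉ ball (0 : Plane) (1 / 2) → m ≤ phi a b c (Q x) := by
      rw [annulus, ae_restrict_iff' (measurableSet_ball.diff measurableSet_ball)] at hphi
      rw [ae_restrict_iff' measurableSet_ball]
      filter_upwards [hphi] with x hx hx1 hx2
      exact hx ⟨hx1, hx2⟩
    have h2 := ae_circle (ae_complexEquiv h1)
    filter_upwards [ae_restrict_of_ae_restrict_of_subset
      (Ioo_subset_Ioo (by norm_num) (by norm_num) : Ioo (1 / 2 : ℝ) (7 / 8) ⊆ Ioo 0 1) h2,
      ae_restrict_of_ae_restrict_of_subset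
      (Ioo_subset_Ioo le_rfl (by norm_num) : Ioo (1 / 2 : ℝ) (7 / 8) ⊆ Ioo (1 / 2) 1) hbd,
      ae_restrict_mem measurableSet_Ioo] with r hr ⟨γ, hγ, hnull⟩ hrI W hW hWQ
    have hr0 : 0 < r := by linarith [hrI.1]
    have h3 : ∀ᵐ θ ∂(volume.restrict (Ioo (-Real.pi) Real.pi)),
        m ≤ phi a b c (Q (polarPoint r θ)) := by
      filter_upwards [hr] with θ hθ
      rw [← complexEquiv_circleMap]
      refine hθ ?_
      rw [mem_ball_zero_iff, complexEquiv.norm_map, norm_circleMap_zero, abs_of_pos hr0]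
      linarith [hrI.1]
    obtain ⟨h4, h5⟩ := not_orientable_of_not_nullhomotopic ha hb hc hr0 hm h3 hγ hnull hW hWQ
    exact ⟨⟨m, hm, h4⟩, h5⟩

end energy

/-! ### The energy bound for a large essential infimum -/

section final

variable {a b c : ℝ}

theorem volume_annulus_ne_top : volume annulus ≠ ⊤ :=
  ((measure_mono sdiff_subset).trans_lt measure_ball_lt_top).ne

theorem volume_annulus_pos : 0 < volume annulus := by
  refine (measure_ball_pos volume (EuclideanSpace.single 0 (3 / 4 : ℝ) : Plane)
    (by norm_num : (0 : ℝ) < 1 / 8)).trans_le (measure_mono fun x hx => ?_)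
  have h1 : ‖(EuclideanSpace.single 0 (3 / 4 : ℝ) : Plane)‖ = 3 / 4 := by
    rw [PiLp.norm_single, Real.norm_eq_abs, abs_of_pos (by norm_num)]
  rw [mem_ball_iff_norm] at hx
  have h2 := abs_norm_sub_norm_le x (EuclideanSpace.single 0 (3 / 4 : ℝ) : Plane)
  rw [h1] at h2
  have h3 := abs_lt.1 (h2.trans_lt hx)
  constructor
  · rw [mem_ball_zero_iff]; linarith [h3.2]
  · rw [mem_ball_zero_iff]; linarith [h3.1]

/-- Over `ℝ` the essential infimum is meaningful because `φ` is bounded below by zero. -/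
theorem ae_phi0_le (ha : 0 < a) (hb : 0 < b) (hc : 0 < c)
    (Q : Plane → S0) :
    ∀ᵐ x ∂(volume.restrict annulus), phi0 a b c Q annulus ≤ phi a b c (Q x) :=
  ae_essInf_le ⟨0, eventually_map.2 (Eventually.of_forall fun x => phi_nonneg ha hb hc (Q x))⟩

theorem le_energy_of_one_le {c₁ : ℝ} (hc₁ : 0 < c₁) (hpot : ∀ Q : S0, 1 ≤ phi a b c Q →
    c₁ * (phi a b c Q ^ 2 - 1) ^ 2 ≤ potential a b c Q) {ε : ℝ} {Q : Plane → S0}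
    {DQ : Fin 2 → Plane → S0} {m : ℝ} (hm : 1 ≤ m)
    (hphi : ∀ᵐ x ∂(volume.restrict annulus), m ≤ phi a b c (Q x)) :
    ENNReal.ofReal (c₁ * (volume annulus).toReal * (m ^ 2 - 1) ^ 2 / ε ^ 2) ≤
      energy a b c ε Q DQ (ball 0 1) := by
  have h1 : ENNReal.ofReal (c₁ * (volume annulus).toReal * (m ^ 2 - 1) ^ 2 / ε ^ 2) =
      ∫⁻ _ in annulus, ENNReal.ofReal (1 / ε ^ 2 * (c₁ * (m ^ 2 - 1) ^ 2)) := by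
    rw [setLIntegral_const]
    nth_rewrite 2 [← ENNReal.ofReal_toReal volume_annulus_ne_top]
    rw [← ENNReal.ofReal_mul (by positivity)]
    congr 1
    ring
  rw [h1]
  refine le_trans (lintegral_mono_ae ?_) (lintegral_mono_set sdiff_subset)
  filter_upwards [hphi] with x hx
  apply ENNReal.ofReal_le_ofReal
  have h2 : (0 : ℝ) ≤ 1 / 2 * ∑ k, ∑ i, ∑ j, ((DQ k x).1 i j) ^ 2 := by positivity
  have h3 : c₁ * (m ^ 2 - 1) ^ 2 ≤ potential a b c (Q x) := by
    refine le_trans ?_ (hpot _ (hm.trans hx))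
    have h4 : 0 ≤ m ^ 2 - 1 := by nlinarith
    gcongr
  have h5 : 1 / ε ^ 2 * (c₁ * (m ^ 2 - 1) ^ 2) ≤ 1 / ε ^ 2 * potential a b c (Q x) :=
    mul_le_mul_of_nonneg_left h3 (by positivity)
  unfold energyDensity
  linarith

/-- With `l = |log ε|` and `Y = X l`, multiplying the hypothesis by `ε² l²` and using `ε l² ≤ 4` and
`ε l ≤ 1` turns it into `B Y² ≤ 4 κ (1 + Y)`. For `Y > 1` this gives `B Y ≤ 8 κ`. -/
theorem mul_log_le {ε : ℝ} (hε : 0 < ε) (hε1 : ε < 1) {B κ X : ℝ} (hB : 0 < B) (hκ : 0 < κ)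
    (hX : 0 < X) (h : B * X ^ 2 / ε ^ 2 ≤ κ * (1 + X) * |Real.log ε|) :
    X * |Real.log ε| ≤ 8 * κ / B + 1 := by
  have hl : |Real.log ε| = -Real.log ε := abs_of_neg (Real.log_neg hε hε1)
  rw [hl] at h ⊢
  set l := -Real.log ε with hldef
  have hl0 : 0 < l := neg_pos.2 (Real.log_neg hε hε1)
  have hs : 0 < √ε := Real.sqrt_pos.2 hε
  have hsq : √ε ^ 2 = ε := Real.sq_sqrt hε.le
  have h1 : √ε * l ≤ 2 := by
    have h2 := Real.add_one_le_exp (l / 2)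
    have h3 : Real.exp (l / 2) * √ε = 1 := by
      rw [Real.sqrt_eq_rpow, Real.rpow_def_of_pos hε, ← Real.exp_add, hldef]
      ring_nf
      simp
    nlinarith
  have h4 : ε * l ^ 2 ≤ 4 := by
    have : ε * l ^ 2 = (√ε * l) ^ 2 := by rw [mul_pow, hsq]
    rw [this]
    nlinarith [mul_pos hs hl0]
  rw [div_le_iff₀ (by positivity)] at h
  have h5 : B * (X * l) ^ 2 ≤ κ * (1 + X) * l * (4 * ε) := by
    calc B * (X * l) ^ 2 = B * X ^ 2 * l ^ 2 := by ring
      _ ≤ κ * (1 + X) * l * ε ^ 2 * l ^ 2 := by gcongr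
      _ = κ * (1 + X) * l * ε * (ε * l ^ 2) := by ring
      _ ≤ κ * (1 + X) * l * ε * 4 := by gcongr
      _ = _ := by ring
  have h6 : ε * l ≤ 1 := by
    have h7 := Real.add_one_le_exp l
    have h8 : Real.exp l * ε = 1 := by
      rw [hldef, Real.exp_neg, Real.exp_log hε, inv_mul_cancel₀ hε.ne']
    nlinarith
  have hY : 0 < X * l := mul_pos hX hl0
  have h7 : B * (X * l) ^ 2 ≤ 4 * κ * (1 + X * l) := by
    have h8 : κ * (1 + X) * l * (4 * ε) ≤ 4 * κ * (1 + X * l) := by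
      have h9 : (1 + X) * l * ε ≤ 1 + X * l := by
        have : X * l * ε ≤ X * l := mul_le_of_le_one_right hY.le hε1.le
        nlinarith
      nlinarith
    exact h5.trans h8
  by_contra! h8
  have h9 : 1 < X * l := lt_of_le_of_lt (by have : 0 < 8 * κ / B := by positivity
                                            linarith) h8
  have h10 : 8 * κ < B * (X * l) := by
    have : 8 * κ / B < X * l := by linarith
    rwa [div_lt_iff₀' hB] at this
  nlinarith

theorem kappaStar_pos (ha : 0 < a) (hb : 0 < b) (hc : 0 < c) : 0 < kappaStar a b c := by
  have := sStar_pos ha hb hc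
  have := Real.pi_pos
  unfold kappaStar
  positivity

end final

end QTensor

end
theorem proposition2p6 (a b c : ℝ) (ha : 0 < a) (hb : 0 < b) (hc : 0 < c) :
    0 < QTensor.kappaStar a b c ∧ ∃ M : ℝ, 0 < M ∧
      ∀ (ε : ℝ), 0 < ε → ε < 1 →
      ∀ (Q : QTensor.Plane → QTensor.S0) (DQ : Fin 2 → QTensor.Plane → QTensor.S0),
        QTensor.IsH1 (Metric.ball 0 1) Q DQ →
        0 < QTensor.phi0 a b c Q QTensor.annulus →
        QTensor.NontrivialBoundaryClass a b c Q →
        ENNReal.ofReal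
            (QTensor.kappaStar a b c * QTensor.phi0 a b c Q QTensor.annulus ^ 2 * |Real.log ε| - M)
          ≤ QTensor.energy a b c ε Q DQ (Metric.ball 0 1) := by
  have hκ := QTensor.kappaStar_pos ha hb hc
  obtain ⟨M, hM, hmain⟩ := QTensor.exists_energy_ge_of_isH1 ha hb hc
  obtain ⟨c₁, hc₁, hpot⟩ := QTensor.exists_sq_le_potential ha hb hc
  set B := c₁ * (volume QTensor.annulus).toReal with hB
  have hBpos : 0 < B := mul_pos hc₁
    (ENNReal.toReal_pos QTensor.volume_annulus_pos.ne' QTensor.volume_annulus_ne_top)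
  set κ := QTensor.kappaStar a b c
  refine ⟨hκ, M + κ * (8 * κ / B + 1), by positivity, fun ε hε hε1 Q DQ hQ hphi0 hbd => ?_⟩
  have hphi := QTensor.ae_phi0_le ha hb hc Q
  have h1 := hmain hε hε1 hQ hphi0 hphi hbd
  set m := QTensor.phi0 a b c Q QTensor.annulus
  have hl := abs_nonneg (Real.log ε)
  have hC : 0 < κ * (8 * κ / B + 1) := by positivity
  -- For `m ≤ 1` the factor `m²` only weakens the bound `h1`.
  rcases le_or_gt m 1 with hm | hm
  · refine le_trans (ENNReal.ofReal_le_ofReal ?_) h1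
    have h2 : κ * m ^ 2 * |Real.log ε| ≤ κ * 1 * |Real.log ε| := by
      gcongr
      exact pow_le_one₀ hphi0.le hm
    linarith
  have h2 := QTensor.le_energy_of_one_le hc₁ hpot (ε := ε) (DQ := DQ) hm.le hphi
  rw [← hB] at h2
  by_cases htop : QTensor.energy a b c ε Q DQ (Metric.ball 0 1) = ⊤
  · rw [htop]; exact le_top
  rw [ENNReal.ofReal_le_iff_le_toReal htop] at h1 h2 ⊢
  have hX : 0 < m ^ 2 - 1 := by nlinarith
  by_contra! hlt
  -- If the claim fails, the energy is below `κ m² |log ε|`, so the potential bound on the annulus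
  -- has the form required with `X = m² - 1`. The resulting bound on `κ X |log ε|` is exactly the
  -- second part of the constant, and `h1` covers the rest.
  have h3 := QTensor.mul_log_le hε hε1 hBpos hκ hX (h2.trans (by
    have : κ * (1 + (m ^ 2 - 1)) = κ * m ^ 2 := by ring
    rw [this]
    linarith))
  have h4 := mul_le_mul_of_nonneg_left h3 hκ.le
  linarith [mul_assoc κ (m ^ 2 - 1) |Real.log ε|]
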